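/- **Setting.** Let $d\ge 0$, $\Lambda>0$, let $\widetilde P_0$ be a probability law on $\mathbb R^d$, and let $(P_x)_{x\in\mathbb R^d}$ be the laws on $\mathbb D(\mathbb R_+,\mathbb R^d)$ of a time-homogeneous càdlàg Markov process (the motion of a free particle, with generator $L$), $x\mapsto P_x$ being a Markov kernel. Let $\widehat\mu(v,w,dh,dk)$ be a kernel from $\mathbb R^{2d}$ to $\mathbb R^{2d}$ with $\widehat\mu(v,w,dh,dk)=\widehat\mu(w,v,dk,dh)$ and $\widehat\mu(v,w,\mathbb R^{2d})\le\Lambda$ for all $v,w$; let $\mu(v,w,dh)=\widehat\mu(v,w,dh\times\mathbb R^d)$. Path spaces $\mathbb D([0,T],\mathbb R^d)$ carry the $\sigma$-algebra of the evaluations, which is the Borel $\sigma$-algebra of the Skorohod topology. *Interaction of particles $i,j$ at time $t$.* With probability $\widehat\mu(z^i,z^j,\mathbb R^{2d})/\Lambda$, where $z^i,z^j$ are the positions at time $t-$, they jump to $z^i+H$ and $z^j+K$, where $(H,K)$ has, after normalisation, the law $\widehat\mu(z^i,z^j,dh,dk)$ (Bird system) or $\mu(z^i,z^j,dh)\otimes\delta_0(dk)+\delta_0(dh)\otimes\mu(z^j,z^i,dk)$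 (Nanbu system); otherwise nothing happens. All draws are independent. *The particle system.* For $N\ge2$, $(\overline Z^1,\dots,\overline Z^N)$ starts from i.i.d. positions of law $\widetilde P_0$; each pair $\{i,j\}$ interacts at the jump times of a Poisson process of rate $\Lambda/(N-1)$, these processes being independent of each other and of everything else; between interactions the particles evolve independently as the free motion. For $1\le q\le N$ and $F:\mathbb D([0,T],\mathbb R^d)^q\to\mathbb R$ put $$(\eta^N_{0:T})^{\odot q}(F)=\frac{(N-q)!}{N!}\sum_{a:[q]\to[N]\text{ injective}}F(\overline Z^{a(1)}_{0:T},\dots,\overline Z^{a(q)}_{0:T}).$$ *The backward system.* Let $T_0=0$, $C_0=\{1,\dots,q\}$, and let $U_k,V_k$ $(k\ge1)$ be independent exponential variables of parameter $1$. Given $T_{k-1}$ and $C_{k-1}\subset[N]$ with $K=\#C_{k-1}$, let $$T'_k=\inf\Big\{T_{k-1}\le s\le T:(s-T_{k-1})\tfrac{\Lambda K(N-K)_+}{N-1}\ge U_k\Big\},\quad T''_k=\inf\Big\{T_{k-1}\le s\le T:(s-T_{k-1})\tfrac{\Lambda K(K-1)}{2(N-1)}\ge V_k\Big\},$$ $T_k=\min(T'_k,T''_k)$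 $(\inf\emptyset=\infty)$. If $T_k=T'_k<\infty$, draw $r(k)$ uniformly in $C_{k-1}$ and $j(k)$ uniformly in $[N]\setminus C_{k-1}$, and let $C_k=C_{k-1}\cup\{j(k)\}$. If $T_k=T''_k<\infty$, draw $r(k)$ uniformly in $C_{k-1}$ and $j(k)$ uniformly in $C_{k-1}\setminus\{r(k)\}$, and let $C_k=C_{k-1}$. Let $L_T=\#\{k\ge1:T_k=T''_k\le T\}$ (the number of loops). Given all this, $(Z^1,\dots,Z^N)$ starts from i.i.d. positions of law $\widetilde P_0$, has exactly the interactions between $r(k)$ and $j(k)$ at the times $T-T_k$ (for $T_k<\infty$), of the same type as above, and evolves by independent free motions between them. For $l\ge0$ define measures on $\mathbb D([0,T],\mathbb R^d)^q$ by $$\Delta^{N,l}_{q,T}(F)=\mathbb E\big(F(Z^1_{0:T},\dots,Z^q_{0:T})\,|\,L_T=l\big)\,\mathbb P(L_T=l)\,(N-1)^l,$$ $$\overline\Delta^{N,l}_{q,T}(F)=\mathbb E\big(F(Z^1_{0:T},\dots,Z^q_{0:T})\,|\,L_T\ge l\big)\,\mathbb P(L_T\ge l)\,(N-1)^l.$$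 Let $\widetilde K$ be the sum of $q$ independent Yule processes of parameter $\Lambda$ (each starts at $1$ and jumps from $k$ to $k+1$ after an exponential time of parameter $\Lambda k$). **Theorem.** Let $q\ge1$ and $T\ge0$. Then $\mathbb E(\widetilde K_T^{2l})<\infty$ for every $l\ge0$, and for every $N\ge2$ with $N\ge q$: 1. For every $l_0\ge0$ and every bounded measurable symmetric $F:\mathbb D([0,T],\mathbb R^d)^q\to\mathbb R$, $$\mathbb E\big((\eta^N_{0:T})^{\odot q}(F)\big)=\sum_{0\le l\le l_0}\frac1{(N-1)^l}\Delta^{N,l}_{q,T}(F)+\frac1{(N-1)^{l_0+1}}\overline\Delta^{N,l_0+1}_{q,T}(F).$$ 2. For every $l\ge0$, the nonnegative measures $\Delta^{N,l}_{q,T}$ and $\overline\Delta^{N,l}_{q,T}$ have total mass at most $\frac{(\Lambda T)^l}{l!}\mathbb E(\widetilde K_T^{2l})$, a bound that does not depend on $N$; and for every bounded measurable $F$, $$\max\big(|\Delta^{N,l}_{q,T}(F)|,|\overline\Delta^{N,l}_{q,T}(F)|\big)\le\frac{(\Lambda T)^l}{l!}\,\mathbb E(\widetilde K_T^{2l})\,\|F\|_\infty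 .$$ -/

import Mathlib

open MeasureTheory ProbabilityTheory Set Filter Topology
open scoped ENNReal NNReal

noncomputable section

namespace BirdNanbu

/-! ### Path spaces -/

/-- The state space `ℝ^d` of one particle. -/
abbrev E (d : ℕ) := EuclideanSpace ℝ (Fin d)

/-- Right-continuous with left limits. -/
def IsCadlag {ι X : Type*} [LinearOrder ι] [TopologicalSpace ι] [TopologicalSpace X]
    (x : ι → X) : Prop :=
  ∀ t, ContinuousWithinAt x (Ici t) t ∧ ∃ y, Tendsto x (𝓝[<] t) (𝓝 y)

/-- The space `𝔻(ι, ℝ^d)` of càdlàg paths indexed by `ι`. Its σ-algebra (that of a subtype of a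
product) is generated by the evaluations; it is the Borel σ-algebra of the Skorohod topology. -/
abbrev PathSpace (ι : Type) [LinearOrder ι] [TopologicalSpace ι] (d : ℕ) : Type :=
  {x : ι → E d // IsCadlag x}

instance (ι : Type) [LinearOrder ι] [TopologicalSpace ι] (d : ℕ) :
    CoeFun (PathSpace ι d) (fun _ => ι → E d) := ⟨Subtype.val⟩

/-- `𝔻(ℝ₊, ℝ^d)`. -/
abbrev Path (d : ℕ) := PathSpace ℝ≥0 d

/-- `𝔻([0,T], ℝ^d)`. -/
abbrev PathOn (T : ℝ≥0) (d : ℕ) := PathSpace (Icc (0 : ℝ≥0) T) d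

/-- The trajectory `x_{0:T}`. -/
def Path.restrict {d : ℕ} (T : ℝ≥0) (x : Path d) : PathOn T d :=
  ⟨fun t => x t.1, fun t => by
    obtain ⟨h1, y, h2⟩ := x.2 t.1
    refine ⟨?_, y, ?_⟩
    · exact h1.comp continuous_subtype_val.continuousWithinAt (fun u hu => hu)
    · refine h2.comp (tendsto_nhdsWithin_iff.2 ⟨?_, ?_⟩)
      · exact (continuous_subtype_val.tendsto t).mono_left nhdsWithin_le_nhds
      · filter_upwards [self_mem_nhdsWithin] with u hu using hu⟩

/-- The path `u ↦ x (s + u)`. -/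
def Path.shift {d : ℕ} (s : ℝ≥0) (x : Path d) : Path d :=
  ⟨fun u => x (s + u), fun t => by
    obtain ⟨h1, y, h2⟩ := x.2 (s + t)
    have hc : Continuous fun u : ℝ≥0 => s + u := by fun_prop
    refine ⟨?_, y, ?_⟩
    · exact ContinuousWithinAt.comp (f := fun u : ℝ≥0 => s + u) (t := Ici (s + t)) h1
        hc.continuousWithinAt (fun u hu => add_le_add_right (mem_Ici.1 hu) s)
    · refine h2.comp (tendsto_nhdsWithin_iff.2 ⟨?_, ?_⟩)
      · exact (hc.tendsto t).mono_left nhdsWithin_le_nhds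
      · filter_upwards [self_mem_nhdsWithin] with u hu using add_lt_add_right (mem_Iio.1 hu) s⟩

/-- The path that follows `x` on `[0, τ)` and then `y`, started at time `τ`. -/
def Path.concat {d : ℕ} (τ : ℝ≥0) (x y : Path d) : Path d :=
  ⟨fun u => if u < τ then x u else y (u - τ), fun t => by
    have hc : Continuous fun u : ℝ≥0 => u - τ := by fun_prop
    constructor
    · rcases lt_or_ge t τ with h | h
      · refine (x.2 t).1.congr_of_eventuallyEq ?_ (by simp [h])
        filter_upwards [mem_nhdsWithin_of_mem_nhds (Iio_mem_nhds h)] with u hu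
        exact if_pos hu
      · have h1 : ContinuousWithinAt (fun u => y (u - τ)) (Ici t) t :=
          ContinuousWithinAt.comp (f := fun u : ℝ≥0 => u - τ) (t := Ici (t - τ)) (y.2 (t - τ)).1
            hc.continuousWithinAt (fun u hu => tsub_le_tsub_right (mem_Ici.1 hu) τ)
        refine h1.congr (fun u hu => if_neg (not_lt.2 (h.trans hu))) (if_neg (not_lt.2 h))
    · rcases le_or_gt t τ with h | h
      · obtain ⟨l, hl⟩ := (x.2 t).2
        refine ⟨l, hl.congr' ?_⟩
        filter_upwards [self_mem_nhdsWithin] with u hu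
        exact (if_pos (lt_of_lt_of_le hu h)).symm
      · obtain ⟨l, hl⟩ := (y.2 (t - τ)).2
        have h2 : Tendsto (fun u : ℝ≥0 => u - τ) (𝓝[<] t) (𝓝[<] (t - τ)) := by
          refine tendsto_nhdsWithin_iff.2 ⟨(hc.tendsto t).mono_left nhdsWithin_le_nhds, ?_⟩
          filter_upwards [self_mem_nhdsWithin, mem_nhdsWithin_of_mem_nhds (Ioi_mem_nhds h)]
            with u hu hu'
          exact tsub_lt_tsub_right_of_le (le_of_lt (mem_Ioi.1 hu')) (mem_Iio.1 hu)
        refine ⟨l, (hl.comp h2).congr' ?_⟩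
        filter_upwards [mem_nhdsWithin_of_mem_nhds (Ioi_mem_nhds h)] with u hu
        exact (if_neg (not_lt.2 (le_of_lt hu))).symm⟩

/-! ### The data of the model -/

/-- The motion of a free particle: a time-homogeneous càdlàg Markov process in `ℝ^d` (the one with
generator `L`), given by the family `(P_x)` of its laws. -/
structure MarkovMotion (d : ℕ) where
  /-- `law x` is the law of the process started at `x`. -/
  law : Kernel (E d) (Path d)
  isMarkovKernel : IsMarkovKernel law
  start : ∀ x, ∀ᵐ w ∂(law x), w 0 = x
  /-- The Markov property: given the past up to time `s`, the future is that of the process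
  started at the present position. -/
  markov : ∀ (x : E d) (s : ℝ≥0) (A B : Set (Path d)),
    MeasurableSet[MeasurableSpace.comap (fun (w : Path d) (u : Iic s) => w u.1) inferInstance] A →
    MeasurableSet B →
    law x (A ∩ Path.shift s ⁻¹' B) = ∫⁻ w in A, law (w s) B ∂(law x)

attribute [instance] MarkovMotion.isMarkovKernel

/-- The two types of systems. -/
inductive SystemKind
  | bird
  | nanbu

/-- The data of the particle systems (except for the number of particles and the time horizon). -/
structure ParticleModel (d : ℕ) where
  motion : MarkovMotion d
  /-- The initial law. -/
  init : Measure (E d)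
  isProbabilityMeasure_init : IsProbabilityMeasure init
  /-- `muHat (v, w)` is the measure `μ̂(v, w, dh, dk)`. -/
  muHat : Kernel (E d × E d) (E d × E d)
  symm : ∀ v w, muHat (v, w) = (muHat (w, v)).map Prod.swap
  rate : ℝ
  rate_pos : 0 < rate
  bound : ∀ p, muHat p univ ≤ ENNReal.ofReal rate
  kind : SystemKind

attribute [instance] ParticleModel.isProbabilityMeasure_init

variable {d : ℕ}

namespace ParticleModel

/-- The first marginal `μ(v, w, dh) = μ̂(v, w, dh × ℝ^d)`. -/
def mu (M : ParticleModel d) (v w : E d) : Measure (E d) := (M.muHat (v, w)).map Prod.fst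

/-- The measure which, once normalised, is the law of the displacements `(H, K)` of two interacting
particles at `v` and `w`: `μ̂(v, w, dh, dk)` in a Bird system and
`μ(v, w, dh) ⊗ δ₀(dk) + δ₀(dh) ⊗ μ(w, v, dk)` in a Nanbu system. -/
def displacement (M : ParticleModel d) (v w : E d) : Measure (E d × E d) :=
  match M.kind with
  | .bird => M.muHat (v, w)
  | .nanbu => (M.mu v w).prod (Measure.dirac 0) + (Measure.dirac 0).prod (M.mu w v)

/-- The law of the configuration just after an interaction of the particles `i` and `j`, where
`xl` is the configuration of left limits and `x` is the configuration the free motion has reached: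
with probability `μ̂(xl i, xl j, ℝ^{2d}) / Λ` the particles `i` and `j` jump from their left limits
by independently drawn displacements, otherwise nothing happens. -/
def interact (M : ParticleModel d) {N : ℕ} (i j : Fin N) (xl x : Fin N → E d) :
    Measure (Fin N → E d) :=
  (M.muHat (xl i, xl j) univ / ENNReal.ofReal M.rate) •
      ((M.displacement (xl i) (xl j) univ)⁻¹ • M.displacement (xl i) (xl j)).map
        (fun hk => Function.update (Function.update x i (xl i + hk.1)) j (xl j + hk.2)) +
    (1 - M.muHat (xl i, xl j) univ / ENNReal.ofReal M.rate) • Measure.dirac x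

end ParticleModel

/-- An interaction: its time and the two particles. -/
abbrev Interaction (N : ℕ) := ℝ≥0 × Fin N × Fin N

namespace ParticleModel

/-- `M.evolve s es z` is the law of the paths `u ↦ Z_{s+u}` of `N` particles which are at `z` at
time `s`, interact as in the chronological list `es` (of interactions after time `s`) and move
independently of one another between the interactions. -/
def evolve (M : ParticleModel d) {N : ℕ} :
    ℝ≥0 → List (Interaction N) → (Fin N → E d) → Measure (Fin N → Path d)
  | _, [], z => Measure.pi fun m => M.motion.law (z m)
  | s, (t, i, j) :: es, z =>
      (Measure.pi fun m => M.motion.law (z m)).bind fun X =>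
        (M.interact i j (fun m => Function.leftLim (X m) (t - s)) (fun m => X m (t - s))).bind
          fun z' => (M.evolve t es z').map fun Y m => Path.concat (t - s) (X m) (Y m)

/-- The law of the trajectories on `[0,T]` of `N` particles with i.i.d. initial positions, given
the chronological list of the interactions. -/
def trajectories (M : ParticleModel d) {N : ℕ} (T : ℝ≥0) (es : List (Interaction N)) :
    Measure (Fin N → PathOn T d) :=
  ((Measure.pi fun _ => M.init).bind (M.evolve 0 es)).map fun X m => (X m).restrict T

end ParticleModel

/-! ### The particle system -/

/-- Finite configurations of points of the real line. -/
abbrev Points := Σ n : ℕ, (Fin n → ℝ)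

/-- The law of the jump times on `[0,T]` of a Poisson process of parameter `lam`: a Poisson
number (of mean `lam * T`) of independent uniform points. In `lam ^ n / n!` times the Lebesgue
measure on `[0,T]^n`, the normalisation `T ^ n` of the uniform law cancels. -/
def poissonProcess (lam : ℝ) (T : ℝ≥0) : Measure Points :=
  Measure.sum fun n : ℕ =>
    ENNReal.ofReal (Real.exp (-(lam * T)) * lam ^ n / n.factorial) •
      (Measure.pi fun _ : Fin n => (volume : Measure ℝ).restrict (Icc 0 (T : ℝ))).map
        (Sigma.mk (β := fun n : ℕ => Fin n → ℝ) n)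

/-- The pairs of particles. -/
abbrev Pair (N : ℕ) := {p : Fin N × Fin N // p.1 < p.2}

/-- The chronological list of all the interactions, given the jump times of the processes
`N_{i,j}`, `i < j`. -/
def interactions {N : ℕ} (ω : Pair N → Points) : List (Interaction N) :=
  ((Finset.univ : Finset (Pair N)).toList.flatMap fun p =>
    List.ofFn fun m => (((ω p).2 m).toNNReal, p.1.1, p.1.2)).insertionSort fun a b => a.1 ≤ b.1

/-- The law of the trajectories `(Z̄^i_{0:T})`, `i = 1, …, N`, of the particle system: each pair of
particles interacts at the jump times of a Poisson process of parameter `Λ / (N - 1)`, and these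
processes are independent. -/
def ParticleModel.systemLaw (M : ParticleModel d) (N : ℕ) (T : ℝ≥0) :
    Measure (Fin N → PathOn T d) :=
  (Measure.pi fun _ : Pair N => poissonProcess (M.rate / (N - 1)) T).bind fun ω =>
    M.trajectories T (interactions ω)

/-- The U-statistic `(η^N_{0:T})^{⊙q}(F)` of the trajectories `z` of the `N` particles. -/
def uStatistic {N : ℕ} {T : ℝ≥0} (q : ℕ) (F : (Fin q → PathOn T d) → ℝ)
    (z : Fin N → PathOn T d) : ℝ :=
  (∑ a : Fin q ↪ Fin N, F fun i => z (a i)) / (N.descFactorial q : ℝ)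

/-! ### The backward interaction graph -/

/-- The random variables for one step of the graph: `(U_k, V_k, c_k, c'_k)`, the choice function
`c_k` (respectively `c'_k`) being used to choose `r(k)` (respectively `j(k)`). -/
abbrev StepNoise (N : ℕ) := ℝ × ℝ × (Finset (Fin N) → Fin N) × (Finset (Fin N) → Fin N)

/-- The choice functions on the nonempty sets of particles. -/
def choiceFunctions (N : ℕ) : Set (Finset (Fin N) → Fin N) :=
  {c | ∀ S : Finset (Fin N), S.Nonempty → c S ∈ S}

/-- A uniformly distributed choice function: its values on the various nonempty sets `S` are
independent, and the value on `S` is uniform on `S`. -/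
def choiceLaw (N : ℕ) : Measure (Finset (Fin N) → Fin N) := uniformOn (choiceFunctions N)

instance (N : ℕ) [NeZero N] : IsProbabilityMeasure (choiceLaw N) :=
  isProbabilityMeasure_uniformOn (Set.toFinite _) <| by
    classical
    exact ⟨fun S => if h : S.Nonempty then h.choose else 0, fun S h => by
      simpa [h] using h.choose_spec⟩

instance : IsProbabilityMeasure (expMeasure 1) := isProbabilityMeasure_expMeasure one_pos

/-- The law of one step: independent exponential variables of parameter `1` and independent
uniform choices. -/
def stepLaw (N : ℕ) : Measure (StepNoise N) :=
  (expMeasure 1).prod ((expMeasure 1).prod ((choiceLaw N).prod (choiceLaw N)))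

instance (N : ℕ) [NeZero N] : IsProbabilityMeasure (stepLaw N) := by
  unfold stepLaw; infer_instance

/-- The law of the i.i.d. sequence of the variables of all the steps. -/
def noiseLaw (N : ℕ) [NeZero N] : Measure (ℕ → StepNoise N) :=
  Measure.infinitePi fun _ => stepLaw N

/-- `inf {τ ≤ s ≤ T : (s - τ) * ρ ≥ U}`, with `inf ∅ = ∞`. -/
def clock (T : ℝ≥0) (τ : EReal) (ρ U : ℝ) : EReal :=
  sInf ((fun s : ℝ => (s : EReal)) ''
    {s : ℝ | τ ≤ (s : EReal) ∧ s ≤ T ∧ U ≤ (s - τ.toReal) * ρ})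

/-- The state of the exploration after a step: the time `T_k` and the set
`C^1 ∪ … ∪ C^q` at time `T_k`. -/
structure Stage (N : ℕ) where
  time : EReal
  active : Finset (Fin N)

namespace Stage

variable {N : ℕ}

/-- The time `T'_k`, if `σ` is the state after the step `k - 1`. -/
def birthTime (lam : ℝ) (T : ℝ≥0) (σ : Stage N) (ν : StepNoise N) : EReal :=
  clock T σ.time (lam * σ.active.card * max ((N : ℝ) - σ.active.card) 0 / (N - 1)) ν.1

/-- The time `T''_k`, if `σ` is the state after the step `k - 1`. -/
def loopTime (lam : ℝ) (T : ℝ≥0) (σ : Stage N) (ν : StepNoise N) : EReal :=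
  clock T σ.time (lam * σ.active.card * ((σ.active.card : ℝ) - 1) / (2 * (N - 1))) ν.2.1

/-- The time `T_k = inf(T'_k, T''_k)`. -/
def nextTime (lam : ℝ) (T : ℝ≥0) (σ : Stage N) (ν : StepNoise N) : EReal :=
  min (σ.birthTime lam T ν) (σ.loopTime lam T ν)

/-- The particle `r(k)`. -/
def chosenR (σ : Stage N) (ν : StepNoise N) : Fin N := ν.2.2.1 σ.active

open Classical in
/-- The particle `j(k)`. -/
def chosenJ (lam : ℝ) (T : ℝ≥0) (σ : Stage N) (ν : StepNoise N) : Fin N :=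
  if σ.nextTime lam T ν = σ.birthTime lam T ν then ν.2.2.2 σ.activeᶜ
  else ν.2.2.2 (σ.active.erase (σ.chosenR ν))

open Classical in
/-- The state after the step `k`. -/
def next (lam : ℝ) (T : ℝ≥0) (σ : Stage N) (ν : StepNoise N) : Stage N where
  time := σ.nextTime lam T ν
  active :=
    if σ.nextTime lam T ν < ⊤ ∧ σ.nextTime lam T ν = σ.birthTime lam T ν then
      insert (σ.chosenJ lam T ν) σ.active
    else σ.active

end Stage

/-- The first `q` of the `N` particles. -/
def firstParticles (q N : ℕ) : Finset (Fin N) := Finset.univ.filter fun i => i.val < q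

/-- The state after `k` steps; it starts at time `0` from the first `q` particles. -/
def stage {N : ℕ} (lam : ℝ) (T : ℝ≥0) (q : ℕ) (ω : ℕ → StepNoise N) : ℕ → Stage N
  | 0 => ⟨0, firstParticles q N⟩
  | k + 1 => (stage lam T q ω k).next lam T (ω k)

/-- The number `L_T` of loops on `[0,T]`. -/
def loops {N : ℕ} (lam : ℝ) (T : ℝ≥0) (q : ℕ) (ω : ℕ → StepNoise N) : ℕ :=
  {k : ℕ | (stage lam T q ω (k + 1)).time < ⊤ ∧
    (stage lam T q ω (k + 1)).time = (stage lam T q ω k).loopTime lam T (ω k)}.ncard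

/-- The chronological list of the interactions of the backward graph: for `k = k', …, 1` (where
`k'`, almost surely finite, is the number of finite times `T_k`), the particles `r(k)` and `j(k)`
interact at the time `T - T_k`. -/
def backwardInteractions {N : ℕ} (lam : ℝ) (T : ℝ≥0) (q : ℕ) (ω : ℕ → StepNoise N) :
    List (Interaction N) :=
  (List.range {k : ℕ | (stage lam T q ω (k + 1)).time < ⊤}.ncard).reverse.map fun k =>
    (((T : ℝ) - (stage lam T q ω (k + 1)).time.toReal).toNNReal,
      (stage lam T q ω k).chosenR (ω k), (stage lam T q ω k).chosenJ lam T (ω k))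

namespace ParticleModel

/-- The joint law of the number of loops `L_T` and of the trajectories `Z^1_{0:T}, …, Z^q_{0:T}`
of the first `q` particles of the backward system. -/
def backwardLaw (M : ParticleModel d) (q N : ℕ) [NeZero N] (hqN : q ≤ N) (T : ℝ≥0) :
    Measure (ℕ × (Fin q → PathOn T d)) :=
  (noiseLaw N).bind fun ω =>
    (M.trajectories T (backwardInteractions M.rate T q ω)).map fun z =>
      (loops M.rate T q ω, fun i => z (Fin.castLE hqN i))

/-- The measure `F ↦ E(F(Z^1_{0:T}, …, Z^q_{0:T}) | L_T ∈ S) P(L_T ∈ S)`. -/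
def conditioned (M : ParticleModel d) (q N : ℕ) [NeZero N] (hqN : q ≤ N) (T : ℝ≥0) (S : Set ℕ) :
    Measure (Fin q → PathOn T d) :=
  (M.backwardLaw q N hqN T (Prod.fst ⁻¹' S)) •
    ((M.backwardLaw q N hqN T)[|Prod.fst ⁻¹' S]).map Prod.snd

/-- `Δ^{N,l}_{q,T}(F) = E(F(Z^1_{0:T}, …, Z^q_{0:T}) | L_T = l) P(L_T = l) (N-1)^l`. -/
def Delta (M : ParticleModel d) (q N : ℕ) [NeZero N] (hqN : q ≤ N) (T : ℝ≥0) (l : ℕ) :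
    Measure (Fin q → PathOn T d) :=
  ((N - 1 : ℕ) : ℝ≥0∞) ^ l • M.conditioned q N hqN T {l}

/-- `Δ̄^{N,l}_{q,T}(F) = E(F(Z^1_{0:T}, …, Z^q_{0:T}) | L_T ≥ l) P(L_T ≥ l) (N-1)^l`. -/
def DeltaBar (M : ParticleModel d) (q N : ℕ) [NeZero N] (hqN : q ≤ N) (T : ℝ≥0) (l : ℕ) :
    Measure (Fin q → PathOn T d) :=
  ((N - 1 : ℕ) : ℝ≥0∞) ^ l • M.conditioned q N hqN T (Ici l)

end ParticleModel

/-! ### Yule processes -/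

/-- The Yule process of parameter `lam` at time `t`: it starts from `1` and stays at the height
`k` during the time `ξ_{k-1} / (lam * k)`, which is exponential of parameter `lam * k`. -/
def yule (lam : ℝ) (ξ : ℕ → ℝ) (t : ℝ) : ℕ :=
  1 + {n : ℕ | ∑ k ∈ Finset.range (n + 1), ξ k / (lam * (k + 1)) ≤ t}.ncard

/-- `E((K̃_t)^m)`, where `K̃` is the sum of `q` independent Yule processes of parameter `lam`. -/
def yuleSumMoment (lam : ℝ) (q : ℕ) (t : ℝ) (m : ℕ) : ℝ≥0∞ :=
  ∫⁻ ξ : Fin q × ℕ → ℝ, ((∑ i : Fin q, yule lam (fun k => ξ (i, k)) t : ℕ) : ℝ≥0∞) ^ m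
    ∂(Measure.infinitePi fun _ : Fin q × ℕ => expMeasure 1)

end BirdNanbu

end

/-!
The particle system is compared with the backward system by looking at the interactions in reverse
chronological order. Write `λ` for the rate `M.rate` and `c = λ / (2 (N - 1))`, so that every
ordered pair of particles interacts at rate `c`.

*Equality in law.* Let `C₀` be a set of particles. Going back in time from `T`, the interactions
found so far determine the set `C` of the ancestors of `C₀`. An interaction none of whose
particles is in `C` does not affect the law of the paths of `C₀`, by the Markov property of the
free motion, and may be deleted (`lintegral_trajectories_prune`); the order of the two particles of
an interaction is irrelevant (`trajectories_swap`). Decomposing the Poisson processes at their last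
point (`lintegral_interactions_last`) therefore shows that the expectation of a functional of the
paths of `C₀`, as a function of the remaining time, of `C` and of the list of the interactions
already found, solves a linear integral equation (`forwardValue_eq`): its operator `exploreGen`
makes a particle of `C` meet a particle outside `C`, which then joins `C`, or another particle of
`C`, which is a loop, and these are the rates of the backward system. Decomposing the backward
system at its first step, which is a competition of two exponential clocks, gives the same equation
(`exp_mul_exploreValue_eq`). Iterating the equation `n` times leaves a remainder of order
`(R t) ^ n / n!`, whence a comparison principle (`le_of_exploreGen`) and the uniqueness of bounded
solutions. As the system is exchangeable (`lintegral_trajectories_relabel`), the trajectories of any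
`q` of its particles have the law of those of the first `q` particles of the backward system
(`systemLaw_map_eq`).

*Expansion.* Averaging over the choices of `q` particles, the mean of the U-statistic is the mean
of `F` for the backward system (`integral_uStatistic`); the expansion is the partition of the latter
according to the number of loops (`integral_conditioned_univ_eq`).

*Bounds.* The mass to be bounded is `(N - 1) ^ l` times the probability of at least `l` loops.
With `K` explored particles, births occur at rate at most `λ K`, the rate of a Yule process, and
loops at rate `c K (K - 1)`, which, multiplied by `N - 1`, is at most `λ K ^ 2`. Let `K̃` be a
Yule process started from `K`. When `j` more loops are needed, `(λ t) ^ j / j!` times the moment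
of order `2 j` of `K̃` at time `t`, suitably normalised, is a supersolution of the equation of the
exploration (`loopWeight_supersolution`): the derivative of `(λ t) ^ j / j!` pays for the loops,
because `K ≤ K̃`, and the backward equation of the Yule process pays for the births. The
comparison principle gives the bound (`pow_mul_noiseLaw_loops_le`). A sum of `q` Yule processes
started from `1` is a Yule process started from `q`, whose law is shifted negative binomial
(`yuleSumMoment_eq`), so that its moments are finite (`yuleMean_pow_lt_top`).
-/

noncomputable section

namespace BirdNanbu

variable {d : ℕ}

/-! ### The measurable space of finite lists -/

/-- The σ-algebra of the disjoint union of the powers `α ^ n` on the lists. -/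
instance listMeasurableSpace {α : Type*} [MeasurableSpace α] : MeasurableSpace (List α) :=
  ⨅ n : ℕ, MeasurableSpace.map (fun x : Fin n → α => List.ofFn x) inferInstance

section Lists

variable {α β γ : Type*} [MeasurableSpace α] [MeasurableSpace β] [MeasurableSpace γ]

lemma measurable_ofFn (n : ℕ) : Measurable fun x : Fin n → α => List.ofFn x := by
  intro s hs
  exact (MeasurableSpace.measurableSet_iInf.1 hs n)

lemma measurable_list_iff {h : List α → β} :
    Measurable h ↔ ∀ n, Measurable fun x : Fin n → α => h (List.ofFn x) := by
  refine ⟨fun hh n => hh.comp (measurable_ofFn n), fun hh s hs => ?_⟩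
  exact MeasurableSpace.measurableSet_iInf.2 fun n => hh n hs

lemma measurable_length : Measurable (fun l : List α => l.length) := by
  rw [measurable_list_iff]; intro n; simp only [List.length_ofFn]; exact measurable_const

lemma measurable_getD (i : ℕ) (a : α) : Measurable (fun l : List α => l.getD i a) := by
  rw [measurable_list_iff]; intro n
  by_cases h : i < n
  · have : (fun x : Fin n → α => (List.ofFn x).getD i a) = fun x => x ⟨i, h⟩ := by
      funext x; simp [List.getD, h]
    rw [this]; exact measurable_pi_apply _
  · have : (fun x : Fin n → α => (List.ofFn x).getD i a) = fun _ => a := by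
      funext x; simp [List.getD, h]
    rw [this]; exact measurable_const

/-- Measurability of a function of a list and a parameter can be checked on the lists of each
length: there are countably many lengths. -/
lemma measurable_prod_list [Nonempty α] {h : γ × List α → β}
    (hh : ∀ n, Measurable fun p : γ × (Fin n → α) => h (p.1, List.ofFn p.2)) : Measurable h := by
  intro s hs
  let a : α := Classical.arbitrary α
  have : h ⁻¹' s = ⋃ n : ℕ, ({p : γ × List α | p.2.length = n} ∩
      (fun p : γ × List α => (p.1, fun i : Fin n => p.2.getD i a)) ⁻¹'
        ((fun p : γ × (Fin n → α) => h (p.1, List.ofFn p.2)) ⁻¹' s)) := by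
    ext ⟨c, l⟩
    have key : (List.ofFn fun i : Fin l.length => l.getD i a) = l := by
      apply List.ext_getElem <;> simp
    simp only [mem_preimage, mem_iUnion, mem_inter_iff, mem_ofPred_eq, exists_eq_left', key]
  rw [this]
  refine MeasurableSet.iUnion fun n => MeasurableSet.inter ?_ ?_
  · exact (measurable_length.comp measurable_snd) (measurableSet_singleton n)
  · refine Measurable.prodMk measurable_fst ?_ (hh n hs)
    exact measurable_pi_lambda _ fun i => (measurable_getD _ a).comp measurable_snd

lemma measurable_cons [Nonempty α] : Measurable fun p : α × List α => p.1 :: p.2 := by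
  refine measurable_prod_list fun n => ?_
  have : (fun p : α × (Fin n → α) => p.1 :: List.ofFn p.2) =
      fun p => List.ofFn (Fin.cons p.1 p.2 : Fin (n + 1) → α) := by
    funext p; simp [List.ofFn_succ]
  rw [this]
  refine (measurable_ofFn (n + 1)).comp (measurable_pi_lambda _ fun i => ?_)
  refine Fin.cases ?_ (fun j => ?_) i
  · simpa using measurable_fst
  · simp only [Fin.cons_succ]
    exact (measurable_pi_apply j).comp measurable_snd

lemma Measurable.list_cons [Nonempty α] {f : γ → α} {g : γ → List α} (hf : Measurable f)
    (hg : Measurable g) : Measurable fun c => f c :: g c :=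
  measurable_cons.comp (hf.prodMk hg)

lemma measurable_append [Nonempty α] : Measurable fun p : List α × List α => p.1 ++ p.2 := by
  have : Measurable fun p : List α × List α => p.2 ++ p.1 := by
    refine measurable_prod_list fun n => ?_
    induction n with
    | zero => simpa using measurable_fst
    | succ n ih =>
      simp only [List.ofFn_succ, List.cons_append]
      refine Measurable.list_cons ((measurable_pi_apply _).comp measurable_snd) ?_
      exact ih.comp (measurable_fst.prodMk
        (measurable_pi_lambda _ fun i => (measurable_pi_apply _).comp measurable_snd))
  exact this.comp measurable_swap

lemma Measurable.list_append [Nonempty α] {f g : γ → List α} (hf : Measurable f)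
    (hg : Measurable g) : Measurable fun c => f c ++ g c :=
  measurable_append.comp (hf.prodMk hg)

lemma measurable_list_map {f : α → β} (hf : Measurable f) : Measurable (List.map f) := by
  rw [measurable_list_iff]; intro n
  simp only [List.map_ofFn]
  exact (measurable_ofFn n).comp
    (measurable_pi_lambda _ fun i => hf.comp (measurable_pi_apply i))

lemma measurable_orderedInsert [Nonempty α] (r : α → α → Prop) [DecidableRel r]
    (hr : MeasurableSet {p : α × α | r p.1 p.2}) :
    Measurable fun p : α × List α => p.2.orderedInsert r p.1 := by
  refine measurable_prod_list fun n => ?_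
  induction n with
  | zero => simpa using Measurable.list_cons measurable_fst measurable_const
  | succ n ih =>
    simp only [List.ofFn_succ, List.orderedInsert]
    have h0 : Measurable fun p : α × (Fin (n + 1) → α) => p.2 0 :=
      (measurable_pi_apply _).comp measurable_snd
    have hs : Measurable fun p : α × (Fin (n + 1) → α) => (fun i : Fin n => p.2 i.succ) :=
      measurable_pi_lambda _ fun i => (measurable_pi_apply _).comp measurable_snd
    refine Measurable.ite (measurable_fst.prodMk h0 hr) ?_ ?_
    · exact Measurable.list_cons measurable_fst
        (Measurable.list_cons h0 ((measurable_ofFn n).comp hs))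
    · exact Measurable.list_cons h0 (ih.comp (measurable_fst.prodMk hs))

lemma measurable_insertionSort [Nonempty α] (r : α → α → Prop) [DecidableRel r]
    (hr : MeasurableSet {p : α × α | r p.1 p.2}) :
    Measurable fun l : List α => l.insertionSort r := by
  rw [measurable_list_iff]
  intro n
  induction n with
  | zero => simp
  | succ n ih =>
    simp only [List.ofFn_succ, List.insertionSort_cons]
    refine (measurable_orderedInsert r hr).comp
      (f := fun x : Fin (n + 1) → α =>
        (x 0, List.insertionSort r (List.ofFn fun i : Fin n => x i.succ))) ?_
    exact (measurable_pi_apply _).prodMk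
      (ih.comp (measurable_pi_lambda _ fun i => measurable_pi_apply _))

end Lists

/-! ### Measures depending measurably on a parameter -/

section Parameters

variable {α β γ : Type*} [MeasurableSpace α] [MeasurableSpace β] [MeasurableSpace γ]

lemma measurable_bind_param {κ : α → Measure β} (hκ : Measurable κ)
    (hp : ∀ a, IsProbabilityMeasure (κ a)) {η : α × β → Measure γ} (hη : Measurable η) :
    Measurable fun a => (κ a).bind fun b => η (a, b) := by
  refine Measure.measurable_of_measurable_coe _ fun s hs => ?_
  let K : Kernel α β := ⟨κ, hκ⟩
  have : IsMarkovKernel K := ⟨hp⟩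
  have h1 : ∀ a, ((κ a).bind fun b => η (a, b)) s = ∫⁻ b, η (a, b) s ∂(K a) := fun a => by
    have h3 : Measurable fun b => η (a, b) := hη.comp measurable_prodMk_left
    exact Measure.bind_apply hs h3.aemeasurable
  simp only [h1]
  have h2 : Measurable fun p : α × β => η p s := (Measure.measurable_coe hs).comp hη
  exact h2.lintegral_kernel_prod_right' (κ := K)

lemma measurable_lintegral_param {κ : α → Measure β} (hκ : Measurable κ)
    (hp : ∀ a, IsProbabilityMeasure (κ a)) {f : α × β → ℝ≥0∞} (hf : Measurable f) :
    Measurable fun a => ∫⁻ b, f (a, b) ∂(κ a) := by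
  let K : Kernel α β := ⟨κ, hκ⟩
  have : IsMarkovKernel K := ⟨hp⟩
  exact Measurable.lintegral_kernel_prod_right' (κ := K) hf

lemma measurable_map_param {κ : α → Measure β} (hκ : Measurable κ)
    (hp : ∀ a, IsProbabilityMeasure (κ a)) {g : α × β → γ} (hg : Measurable g) :
    Measurable fun a => (κ a).map fun b => g (a, b) := by
  have : (fun a => (κ a).map fun b => g (a, b)) =
      fun a => (κ a).bind fun b => Measure.dirac (g (a, b)) := by
    funext a
    exact (Measure.bind_dirac_eq_map _ (hg.comp measurable_prodMk_left)).symm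
  rw [this]
  exact measurable_bind_param (η := fun p => Measure.dirac (g p)) hκ hp
    (Measure.measurable_dirac.comp hg)

lemma isProbabilityMeasure_bind {m : Measure α} [IsProbabilityMeasure m] {κ : α → Measure β}
    (hκ : Measurable κ) (hp : ∀ a, IsProbabilityMeasure (κ a)) :
    IsProbabilityMeasure (m.bind κ) := by
  constructor
  rw [Measure.bind_apply MeasurableSet.univ hκ.aemeasurable]
  simp

/-- Three successive random choices, followed by a measurable map, all depending measurably on a
parameter. -/
lemma bind_bind_map_param {δ ε : Type*} [MeasurableSpace δ] [MeasurableSpace ε]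
    {κ₁ : α → Measure β} (h₁ : Measurable κ₁) (hp₁ : ∀ a, IsProbabilityMeasure (κ₁ a))
    {κ₂ : α × β → Measure γ} (h₂ : Measurable κ₂) (hp₂ : ∀ a, IsProbabilityMeasure (κ₂ a))
    {κ₃ : (α × β) × γ → Measure δ} (h₃ : Measurable κ₃) (hp₃ : ∀ a, IsProbabilityMeasure (κ₃ a))
    {g : ((α × β) × γ) × δ → ε} (hg : Measurable g) :
    (Measurable fun a => (κ₁ a).bind fun b => (κ₂ (a, b)).bind fun c =>
      (κ₃ ((a, b), c)).map fun e => g (((a, b), c), e)) ∧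
    ∀ a, IsProbabilityMeasure ((κ₁ a).bind fun b => (κ₂ (a, b)).bind fun c =>
      (κ₃ ((a, b), c)).map fun e => g (((a, b), c), e)) := by
  obtain ⟨F₃, e₃⟩ : ∃ F : (α × β) × γ → Measure ε,
    ∀ p, F p = (κ₃ p).map fun e => g (p, e) := ⟨_, fun _ => rfl⟩
  have m₃ : Measurable F₃ := by
    rw [funext e₃]
    exact measurable_map_param h₃ hp₃ hg
  obtain ⟨F₂, e₂⟩ : ∃ F : α × β → Measure ε,
    ∀ p, F p = (κ₂ p).bind fun c => F₃ (p, c) := ⟨_, fun _ => rfl⟩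
  have m₂ : Measurable F₂ := by
    rw [funext e₂]
    exact measurable_bind_param h₂ hp₂ m₃
  simp only [← e₃, ← e₂]
  refine ⟨measurable_bind_param h₁ hp₁ m₂, fun a => ?_⟩
  have := hp₁ a
  have n₂ : Measurable fun b => F₂ (a, b) := m₂.comp measurable_prodMk_left
  refine isProbabilityMeasure_bind n₂ fun b => ?_
  have := hp₂ (a, b)
  have n₃ : Measurable fun c => F₃ ((a, b), c) := m₃.comp measurable_prodMk_left
  rw [e₂]
  refine isProbabilityMeasure_bind n₃ fun c => ?_
  have := hp₃ ((a, b), c)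
  rw [e₃]
  have n₄ : Measurable fun e => g (((a, b), c), e) := hg.comp measurable_prodMk_left
  exact Measure.isProbabilityMeasure_map n₄.aemeasurable

lemma measurable_pi_measure {ι : Type*} [Fintype ι] {κ : ι → α → Measure β}
    (hκ : ∀ i, Measurable (κ i)) (hp : ∀ i a, IsProbabilityMeasure (κ i a)) :
    Measurable fun a => Measure.pi fun i => κ i a := by
  refine Measurable.measure_of_isPiSystem_of_isProbabilityMeasure generateFrom_pi.symm
    isPiSystem_pi ?_
  rintro s ⟨t, ht, rfl⟩
  simp only [Measure.pi_pi]
  exact Finset.measurable_prod _ fun i _ =>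
    (Measure.measurable_coe (ht i (mem_univ i))).comp (hκ i)

/-- The lower integral of a function of some of the coordinates against a product of probability
measures depends on these factors only. -/
lemma lintegral_pi_congr_of_dependsOn {ι : Type*} [Fintype ι] [Nonempty β]
    {μ ν : ι → Measure β} (hμ : ∀ i, IsProbabilityMeasure (μ i))
    (hν : ∀ i, IsProbabilityMeasure (ν i)) {C : Finset ι} (h : ∀ i ∈ C, μ i = ν i)
    {f : (ι → β) → ℝ≥0∞} (hf : Measurable f)
    (hd : ∀ x y, (∀ i ∈ C, x i = y i) → f x = f y) :
    ∫⁻ x, f x ∂(Measure.pi μ) = ∫⁻ x, f x ∂(Measure.pi ν) := by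
  classical
  let b : β := Classical.arbitrary β
  let e : (∀ _ : C, β) → ι → β := fun y i => if hi : i ∈ C then y ⟨i, hi⟩ else b
  have he : Measurable e := measurable_pi_lambda _ fun i => by
    by_cases hi : i ∈ C
    · simpa [e, hi] using measurable_pi_apply _
    · simp [e, hi]
  have key : ∀ (μ : ι → Measure β) [∀ i, IsProbabilityMeasure (μ i)],
      ∫⁻ x, f x ∂(Measure.pi μ) = ∫⁻ y, f (e y) ∂(Measure.pi fun i : C => μ i) := by
    intro μ _
    rw [← Measure.infinitePi_eq_pi, ← Measure.infinitePi_map_restrict μ (I := C),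
      lintegral_map (f := fun y => f (e y)) (hf.comp he) (Finset.measurable_restrict C)]
    refine lintegral_congr fun x => hd _ _ fun i hi => ?_
    simp [e, hi]
  rw [key μ, key ν]
  congr 2
  funext i
  exact h i i.2

lemma lintegral_pi_prod {ι : Type*} [Fintype ι] {μ : ι → Measure β}
    [∀ i, IsProbabilityMeasure (μ i)] {f : ι → β → ℝ≥0∞} (hf : ∀ i, Measurable (f i)) :
    ∫⁻ x, ∏ i, f i (x i) ∂(Measure.pi μ) = ∏ i, ∫⁻ b, f i b ∂(μ i) := by
  rw [lintegral_prod_eq_prod_lintegral_of_indepFun Finset.univ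
    (fun i (x : ι → β) => f i (x i))
    (iIndepFun_pi fun i => (hf i).aemeasurable) fun i => (hf i).comp (measurable_pi_apply i)]
  refine Finset.prod_congr rfl fun i _ => ?_
  exact (measurePreserving_eval μ i).lintegral_comp (hf i)

end Parameters

/-! ### Measurability of the operations on paths -/

section Paths

lemma measurable_path_apply (u : ℝ≥0) : Measurable fun x : Path d => x u :=
  (measurable_pi_apply u).comp measurable_subtype_coe

/-- The evaluation is jointly measurable, as right-continuity makes it a limit of evaluations at
times with countably many values. -/
lemma measurable_path_eval : Measurable fun p : Path d × ℝ≥0 => p.1 p.2 := by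
  let a : ℕ → ℝ≥0 → ℝ≥0 := fun n t => (⌊t * (n + 1)⌋₊ + 1) / (n + 1)
  have ha : ∀ n t, t < a n t := fun n t => by
    rw [lt_div_iff₀ (by positivity)]; exact Nat.lt_floor_add_one _
  have ha' : ∀ n t, a n t ≤ t + 1 / ((n : ℝ≥0) + 1) := fun n t => by
    have : (⌊t * ((n : ℝ≥0) + 1)⌋₊ : ℝ≥0) ≤ t * (n + 1) := Nat.floor_le (by positivity)
    rw [div_le_iff₀ (by positivity), add_mul, div_mul_cancel₀ _ (by positivity)]
    gcongr
  have hlim : ∀ t, Tendsto (fun n => a n t) atTop (𝓝 t) := fun t => by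
    refine tendsto_of_tendsto_of_tendsto_of_le_of_le tendsto_const_nhds ?_
      (fun n => (ha n t).le) (fun n => ha' n t)
    simpa using tendsto_const_nhds.add (tendsto_one_div_add_atTop_nhds_zero_nat (𝕜 := ℝ≥0))
  refine measurable_of_tendsto_metrizable (f := fun n (p : Path d × ℝ≥0) => p.1 (a n p.2)) ?_ ?_
  · intro n
    have h1 : Measurable fun p : Path d × ℕ => p.1 (((p.2 : ℝ≥0) + 1) / (n + 1)) :=
      measurable_from_prod_countable_left fun k =>
        measurable_path_apply (((k : ℝ≥0) + 1) / (n + 1))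
    have h2 : Measurable fun p : Path d × ℝ≥0 => (p.1, ⌊p.2 * (n + 1)⌋₊) :=
      measurable_fst.prodMk (Nat.measurable_floor.comp (measurable_snd.mul_const _))
    exact h1.comp h2
  · rw [tendsto_pi_nhds]
    rintro ⟨x, t⟩
    refine (x.2 t).1.tendsto.comp (tendsto_nhdsWithin_iff.2 ⟨hlim t, ?_⟩)
    exact Eventually.of_forall fun n => (ha n t).le

/-- The left limits are limits of evaluations at times from the left. At the time `0`, where
`Function.leftLim` is the value of the path, truncated subtraction makes the approximating times
equal to `0`. -/
lemma tendsto_leftLim_path (x : Path d) (t : ℝ≥0) :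
    Tendsto (fun n : ℕ => x (t - 1 / ((n : ℝ≥0) + 1))) atTop (𝓝 (Function.leftLim x.1 t)) := by
  rcases eq_or_ne t 0 with rfl | ht
  · have : Function.leftLim x.1 0 = x 0 := by
      apply leftLim_eq_of_eq_bot
      have : Iio (0 : ℝ≥0) = ∅ := by ext; simp
      rw [this, nhdsWithin_empty]
    simp [this]
  · obtain ⟨y, hy⟩ := (x.2 t).2
    have : (𝓝[<] t).NeBot := nhdsLT_neBot_of_exists_lt ⟨0, pos_iff_ne_zero.2 ht⟩
    rw [leftLim_eq_of_tendsto hy]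
    refine hy.comp (tendsto_nhdsWithin_iff.2 ⟨?_, Eventually.of_forall fun n => ?_⟩)
    · have h := (tendsto_const_nhds (x := t)).sub
        (tendsto_one_div_add_atTop_nhds_zero_nat (𝕜 := ℝ≥0))
      simpa using h
    · exact tsub_lt_self (pos_iff_ne_zero.2 ht) (by positivity)

lemma measurable_path_leftLim :
    Measurable fun p : Path d × ℝ≥0 => Function.leftLim p.1.1 p.2 := by
  refine measurable_of_tendsto_metrizable
    (f := fun n (p : Path d × ℝ≥0) => p.1 (p.2 - 1 / ((n : ℝ≥0) + 1))) (fun n => ?_) ?_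
  · exact measurable_path_eval.comp (measurable_fst.prodMk (measurable_snd.sub_const _))
  · rw [tendsto_pi_nhds]
    rintro ⟨x, t⟩
    exact tendsto_leftLim_path x t

lemma measurable_path_concat :
    Measurable fun p : ℝ≥0 × Path d × Path d => Path.concat p.1 p.2.1 p.2.2 := by
  refine Measurable.subtype_mk (measurable_pi_lambda _ fun u => ?_)
  refine Measurable.ite (measurableSet_lt measurable_const measurable_fst) ?_ ?_
  · exact (measurable_path_apply u).comp (measurable_fst.comp measurable_snd)
  · exact measurable_path_eval.comp ((measurable_snd.comp measurable_snd).prodMk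
      (measurable_const.sub measurable_fst))

lemma measurable_path_restrict (T : ℝ≥0) : Measurable fun x : Path d => x.restrict T :=
  Measurable.subtype_mk (measurable_pi_lambda _ fun _ => measurable_path_apply _)

lemma measurable_path_shift (s : ℝ≥0) : Measurable fun x : Path d => x.shift s :=
  Measurable.subtype_mk (measurable_pi_lambda _ fun _ => measurable_path_apply _)

instance : Nonempty (Path d) :=
  ⟨⟨fun _ => 0, fun _ => ⟨continuousWithinAt_const, 0, tendsto_const_nhds⟩⟩⟩

end Paths

/-! ### The interaction and the evolution as probability kernels -/

namespace ParticleModel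

variable (M : ParticleModel d) {N : ℕ}

instance isFiniteMeasure_muHat (p : E d × E d) : IsFiniteMeasure (M.muHat p) :=
  ⟨(M.bound p).trans_lt ENNReal.ofReal_lt_top⟩

instance isFiniteMeasure_mu (v w : E d) : IsFiniteMeasure (M.mu v w) := by
  unfold mu; infer_instance

lemma mu_univ (v w : E d) : M.mu v w univ = M.muHat (v, w) univ := by
  rw [mu, Measure.map_apply measurable_fst MeasurableSet.univ, preimage_univ]

lemma muHat_univ_swap (v w : E d) : M.muHat (w, v) univ = M.muHat (v, w) univ := by
  rw [M.symm v w, Measure.map_apply measurable_swap MeasurableSet.univ, preimage_univ]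

lemma displacement_swap (v w : E d) :
    (M.displacement v w).map Prod.swap = M.displacement w v := by
  unfold displacement
  cases M.kind with
  | bird => exact (M.symm w v).symm
  | nanbu =>
    simp only
    rw [Measure.map_add _ _ measurable_swap, Measure.prod_swap, Measure.prod_swap, add_comm]

lemma measurable_displacement :
    Measurable fun p : E d × E d => M.displacement p.1 p.2 := by
  unfold displacement
  cases M.kind with
  | bird => exact M.muHat.measurable
  | nanbu =>
    have h : Measurable fun p : E d × E d => M.mu p.1 p.2 :=
      (Measure.measurable_map _ measurable_fst).comp M.muHat.measurable
    have h' : Measurable fun p : E d × E d => M.mu p.2 p.1 := h.comp measurable_swap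
    have e1 : ∀ v w, (M.mu v w).prod (Measure.dirac (0 : E d)) =
        (M.mu v w).map fun x => (x, 0) := fun v w => Measure.prod_dirac _
    have e2 : ∀ v w, (Measure.dirac (0 : E d)).prod (M.mu v w) =
        (M.mu v w).map fun x => (0, x) := fun v w => Measure.dirac_prod _
    simp only [e1, e2]
    refine Measure.measurable_of_measurable_coe _ fun s hs => ?_
    simp only [Measure.add_apply]
    refine Measurable.add ?_ ?_
    · exact (Measure.measurable_coe hs).comp
        ((Measure.measurable_map _ measurable_prodMk_right).comp h)
    · exact (Measure.measurable_coe hs).comp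
        ((Measure.measurable_map _ measurable_prodMk_left).comp h')

lemma displacement_univ (v w : E d) :
    M.displacement v w univ = M.muHat (v, w) univ ∨
      M.displacement v w univ = 2 * M.muHat (v, w) univ := by
  unfold displacement
  cases M.kind with
  | bird => exact Or.inl rfl
  | nanbu =>
    right
    rw [Measure.add_apply, ← univ_prod_univ, Measure.prod_prod, Measure.prod_prod, mu_univ,
      mu_univ, M.muHat_univ_swap v w, measure_univ (μ := Measure.dirac (0 : E d)), one_mul, mul_one,
      univ_prod_univ, two_mul]

/-- If two particles may interact at all, the normalised law of their displacements is a probability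
measure, although the total mass is that of `muHat` in a Bird system and twice that in a Nanbu
system. -/
lemma displacement_normalised (v w : E d) :
    M.muHat (v, w) univ = 0 ∨
      ((M.displacement v w univ)⁻¹ • M.displacement v w) univ = 1 := by
  by_cases h : M.muHat (v, w) univ = 0
  · exact Or.inl h
  right
  have hf : M.muHat (v, w) univ ≠ ⊤ := measure_ne_top _ _
  rw [Measure.smul_apply, smul_eq_mul]
  rcases M.displacement_univ v w with e | e <;> rw [e]
  · exact ENNReal.inv_mul_cancel h hf
  · exact ENNReal.inv_mul_cancel (by simp [h]) (ENNReal.mul_ne_top (by simp) hf)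

lemma ratio_le_one (p : E d × E d) : M.muHat p univ / ENNReal.ofReal M.rate ≤ 1 :=
  ENNReal.div_le_of_le_mul (by simpa using M.bound p)

lemma measurable_update_displace (i j : Fin N) :
    Measurable fun p : ((Fin N → E d) × (Fin N → E d)) × (E d × E d) =>
      Function.update (Function.update p.1.2 i (p.1.1 i + p.2.1)) j (p.1.1 j + p.2.2) := by
  refine measurable_pi_lambda _ fun m => ?_
  simp only [Function.update_apply]
  split_ifs <;> fun_prop

instance isProbabilityMeasure_interact (i j : Fin N) (xl x : Fin N → E d) :
    IsProbabilityMeasure (M.interact i j xl x) := by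
  have hm : Measurable fun hk : E d × E d =>
      Function.update (Function.update x i (xl i + hk.1)) j (xl j + hk.2) :=
    (measurable_update_displace i j).comp (measurable_prodMk_left (x := (xl, x)))
  constructor
  unfold interact
  rw [Measure.add_apply, Measure.smul_apply, Measure.smul_apply,
    Measure.map_apply hm MeasurableSet.univ, preimage_univ, measure_univ (μ := Measure.dirac x),
    smul_eq_mul, smul_eq_mul, mul_one]
  rcases M.displacement_normalised (xl i) (xl j) with h | h
  · simp [h]
  · rw [h, mul_one, add_tsub_cancel_of_le (M.ratio_le_one _)]

lemma measurable_interact (i j : Fin N) :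
    Measurable fun p : (Fin N → E d) × (Fin N → E d) => M.interact i j p.1 p.2 := by
  refine Measure.measurable_of_measurable_coe _ fun s hs => ?_
  have hm : ∀ p : (Fin N → E d) × (Fin N → E d), Measurable fun hk : E d × E d =>
      Function.update (Function.update p.2 i (p.1 i + hk.1)) j (p.1 j + hk.2) := fun p =>
    (measurable_update_displace i j).comp (measurable_prodMk_left (x := p))
  have hpos : Measurable fun p : (Fin N → E d) × (Fin N → E d) => (p.1 i, p.1 j) := by fun_prop
  have hr : Measurable fun p : (Fin N → E d) × (Fin N → E d) =>
      M.muHat (p.1 i, p.1 j) univ / ENNReal.ofReal M.rate :=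
    ((M.muHat.measurable_coe MeasurableSet.univ).comp hpos).div_const _
  have hd : Measurable fun p : (Fin N → E d) × (Fin N → E d) =>
      M.displacement (p.1 i) (p.1 j) := M.measurable_displacement.comp hpos
  let K : Kernel ((Fin N → E d) × (Fin N → E d)) (E d × E d) :=
    ⟨fun p => M.displacement (p.1 i) (p.1 j), hd⟩
  have : IsFiniteKernel K := ⟨⟨2 * ENNReal.ofReal M.rate,
    ENNReal.mul_lt_top (by simp) ENNReal.ofReal_lt_top, fun p => by
      change M.displacement (p.1 i) (p.1 j) univ ≤ _
      rcases M.displacement_univ (p.1 i) (p.1 j) with e | e <;> rw [e]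
      · exact (M.bound _).trans (le_mul_of_one_le_left' (by simp))
      · gcongr; exact M.bound _⟩⟩
  have hK : Measurable fun p : (Fin N → E d) × (Fin N → E d) =>
      K p (Prod.mk p ⁻¹' ((fun q : ((Fin N → E d) × (Fin N → E d)) × (E d × E d) =>
        Function.update (Function.update q.1.2 i (q.1.1 i + q.2.1)) j (q.1.1 j + q.2.2)) ⁻¹' s)) :=
    Kernel.measurable_kernel_prodMk_left (measurable_update_displace i j hs)
  have hmeas : Measurable fun p : (Fin N → E d) × (Fin N → E d) =>
      (M.muHat (p.1 i, p.1 j) univ / ENNReal.ofReal M.rate) *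
        ((M.displacement (p.1 i) (p.1 j) univ)⁻¹ *
          K p (Prod.mk p ⁻¹' ((fun q : ((Fin N → E d) × (Fin N → E d)) × (E d × E d) =>
            Function.update (Function.update q.1.2 i (q.1.1 i + q.2.1)) j (q.1.1 j + q.2.2))
              ⁻¹' s))) +
        (1 - M.muHat (p.1 i, p.1 j) univ / ENNReal.ofReal M.rate) * s.indicator 1 p.2 := by
    refine (hr.mul ((((Measure.measurable_coe MeasurableSet.univ).comp hd).inv).mul hK)).add ?_
    exact (measurable_const.sub hr).mul ((measurable_one.indicator hs).comp measurable_snd)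
  convert hmeas using 2 with p
  unfold interact
  rw [Measure.add_apply, Measure.smul_apply, Measure.smul_apply,
    Measure.map_apply (hm p) hs, Measure.dirac_apply' _ hs, smul_eq_mul, smul_eq_mul,
    Measure.smul_apply, smul_eq_mul]
  rfl

lemma measurable_interact_apply {α : Type*} [MeasurableSpace α] {i j : α → Fin N}
    {xl x : α → Fin N → E d} (hi : Measurable i) (hj : Measurable j) (hxl : Measurable xl)
    (hx : Measurable x) : Measurable fun a => M.interact (i a) (j a) (xl a) (x a) := by
  have h : Measurable fun p : ((Fin N → E d) × (Fin N → E d)) × (Fin N × Fin N) =>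
      M.interact p.2.1 p.2.2 p.1.1 p.1.2 := by
    refine measurable_from_prod_countable_left fun ij => ?_
    have := M.measurable_interact ij.1 ij.2
    exact this
  have h2 : Measurable fun a => ((xl a, x a), (i a, j a)) :=
    (hxl.prodMk hx).prodMk (hi.prodMk hj)
  have h3 := Measurable.comp h h2
  exact h3

lemma measurable_pi_law :
    Measurable fun z : Fin N → E d => Measure.pi fun m => M.motion.law (z m) :=
  measurable_pi_measure (κ := fun m (z : Fin N → E d) => M.motion.law (z m))
    (fun m => M.motion.law.measurable.comp (measurable_pi_apply m)) fun _ _ => inferInstance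

/-- The configuration of the paths, of which the `m`-th follows `X m` up to the time `τ`. -/
def concatAll (τ : ℝ≥0) (X Y : Fin N → Path d) : Fin N → Path d := fun m =>
  Path.concat τ (X m) (Y m)

lemma measurable_concatAll : Measurable fun p : ℝ≥0 × (Fin N → Path d) × (Fin N → Path d) =>
    concatAll p.1 p.2.1 p.2.2 :=
  measurable_pi_lambda _ fun m => by
    have h : Measurable fun p : ℝ≥0 × (Fin N → Path d) × (Fin N → Path d) =>
      (p.1, p.2.1 m, p.2.2 m) := by fun_prop
    exact measurable_path_concat.comp h

/-- The configuration of the left limits at time `τ`. -/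
def leftAll (X : Fin N → Path d) (τ : ℝ≥0) : Fin N → E d := fun m => Function.leftLim (X m) τ

/-- The configuration at time `τ`. -/
def evalAll (X : Fin N → Path d) (τ : ℝ≥0) : Fin N → E d := fun m => X m τ

lemma measurable_leftAll : Measurable fun p : (Fin N → Path d) × ℝ≥0 => leftAll p.1 p.2 :=
  measurable_pi_lambda _ fun m => by
    have h : Measurable fun p : (Fin N → Path d) × ℝ≥0 => (p.1 m, p.2) := by fun_prop
    exact measurable_path_leftLim.comp h

lemma measurable_evalAll : Measurable fun p : (Fin N → Path d) × ℝ≥0 => evalAll p.1 p.2 :=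
  measurable_pi_lambda _ fun m => by
    have h : Measurable fun p : (Fin N → Path d) × ℝ≥0 => (p.1 m, p.2) := by fun_prop
    exact measurable_path_eval.comp h

lemma evolve_nil (s : ℝ≥0) (z : Fin N → E d) :
    M.evolve s [] z = Measure.pi fun m => M.motion.law (z m) := rfl

lemma evolve_cons (s : ℝ≥0) (t : ℝ≥0) (i j : Fin N) (es : List (Interaction N))
    (z : Fin N → E d) :
    M.evolve s ((t, i, j) :: es) z = (Measure.pi fun m => M.motion.law (z m)).bind fun X =>
      (M.interact i j (leftAll X (t - s)) (evalAll X (t - s))).bind fun z' =>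
        (M.evolve t es z').map (concatAll (t - s) X) := rfl

/-- The law of the evolution is a probability measure that depends measurably on the starting
time, the interactions and the starting point. Both facts go together in the induction, because
a measurable dependence of the integrals requires the finiteness of the measures. -/
lemma measurable_evolve_aux [NeZero N] (n : ℕ) :
    (Measurable fun p : (ℝ≥0 × (Fin N → E d)) × (Fin n → Interaction N) =>
      M.evolve p.1.1 (List.ofFn p.2) p.1.2) ∧
    ∀ p : (ℝ≥0 × (Fin N → E d)) × (Fin n → Interaction N),
      IsProbabilityMeasure (M.evolve p.1.1 (List.ofFn p.2) p.1.2) := by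
  induction n with
  | zero =>
    simp only [List.ofFn_zero, evolve_nil]
    exact ⟨M.measurable_pi_law.comp (measurable_snd.comp measurable_fst), fun p => inferInstance⟩
  | succ n ih =>
    obtain ⟨ih1, ih2⟩ := ih
    let A := (ℝ≥0 × (Fin N → E d)) × (Fin (n + 1) → Interaction N)
    have e : ∀ p : A, M.evolve p.1.1 (List.ofFn p.2) p.1.2 =
        (Measure.pi fun m => M.motion.law (p.1.2 m)).bind fun X =>
          (M.interact (p.2 0).2.1 (p.2 0).2.2 (leftAll X ((p.2 0).1 - p.1.1))
            (evalAll X ((p.2 0).1 - p.1.1))).bind fun z' =>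
              (M.evolve (p.2 0).1 (List.ofFn fun i : Fin n => p.2 i.succ) z').map
                (concatAll ((p.2 0).1 - p.1.1) X) := fun p => by
      rw [List.ofFn_succ]; rfl
    have hhead : Measurable fun p : A => p.2 0 := (measurable_pi_apply 0).comp measurable_snd
    have hdiff : Measurable fun p : A => (p.2 0).1 - p.1.1 :=
      (measurable_fst.comp hhead).sub (measurable_fst.comp measurable_fst)
    -- the law of the motion after the interaction, as a function of all the previous variables
    let μ₃ : (A × (Fin N → Path d)) × (Fin N → E d) → Measure (Fin N → Path d) := fun p =>
      M.evolve (p.1.1.2 0).1 (List.ofFn fun i : Fin n => p.1.1.2 i.succ) p.2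
    have hμ₃ : Measurable μ₃ := by
      refine ih1.comp (f := fun p : (A × (Fin N → Path d)) × (Fin N → E d) =>
        (((p.1.1.2 0).1, p.2), fun i : Fin n => p.1.1.2 i.succ)) ?_
      refine ((measurable_fst.comp (hhead.comp (measurable_fst.comp measurable_fst))).prodMk
        measurable_snd).prodMk (measurable_pi_lambda _ fun i => ?_)
      exact (measurable_pi_apply _).comp
        (measurable_snd.comp (measurable_fst.comp measurable_fst))
    have hp₃ : ∀ p, IsProbabilityMeasure (μ₃ p) := fun p =>
      ih2 (((p.1.1.2 0).1, p.2), fun i : Fin n => p.1.1.2 i.succ)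
    have hg : Measurable fun p : ((A × (Fin N → Path d)) × (Fin N → E d)) × (Fin N → Path d) =>
        concatAll ((p.1.1.1.2 0).1 - p.1.1.1.1.1) p.1.1.2 p.2 :=
      measurable_concatAll.comp ((hdiff.comp (measurable_fst.comp
        (measurable_fst.comp measurable_fst))).prodMk
        ((measurable_snd.comp (measurable_fst.comp measurable_fst)).prodMk measurable_snd))
    let μ₂ : A × (Fin N → Path d) → Measure (Fin N → E d) := fun p =>
      M.interact (p.1.2 0).2.1 (p.1.2 0).2.2 (leftAll p.2 ((p.1.2 0).1 - p.1.1.1))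
        (evalAll p.2 ((p.1.2 0).1 - p.1.1.1))
    have hμ₂ : Measurable μ₂ := by
      have hpair : Measurable fun p : A × (Fin N → Path d) =>
          (p.2, (p.1.2 0).1 - p.1.1.1) := measurable_snd.prodMk (hdiff.comp measurable_fst)
      refine M.measurable_interact_apply ?_ ?_ (measurable_leftAll.comp hpair)
        (measurable_evalAll.comp hpair)
      · exact measurable_fst.comp (measurable_snd.comp (hhead.comp measurable_fst))
      · exact measurable_snd.comp (measurable_snd.comp (hhead.comp measurable_fst))
    have hp₂ : ∀ p, IsProbabilityMeasure (μ₂ p) := fun p => isProbabilityMeasure_interact M _ _ _ _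
    have hμ₁ : Measurable fun p : A => Measure.pi fun m => M.motion.law (p.1.2 m) :=
      M.measurable_pi_law.comp (measurable_snd.comp measurable_fst)
    have h := bind_bind_map_param hμ₁ (fun p => inferInstance) hμ₂ hp₂ hμ₃ hp₃ hg
    exact ⟨(funext e : _ = _) ▸ h.1, fun p => (e p) ▸ h.2 p⟩

instance isProbabilityMeasure_evolve [NeZero N] (s : ℝ≥0) (es : List (Interaction N))
    (z : Fin N → E d) : IsProbabilityMeasure (M.evolve s es z) := by
  have := (M.measurable_evolve_aux es.length).2 ((s, z), es.get)
  simpa using this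

lemma measurable_evolve [NeZero N] :
    Measurable fun p : (ℝ≥0 × (Fin N → E d)) × List (Interaction N) =>
      M.evolve p.1.1 p.2 p.1.2 :=
  measurable_prod_list fun n => (M.measurable_evolve_aux n).1

lemma measurable_evolve_start [NeZero N] (s : ℝ≥0) (es : List (Interaction N)) :
    Measurable (M.evolve s es) :=
  M.measurable_evolve.comp (f := fun z : Fin N → E d => ((s, z), es)) (by fun_prop)

lemma measurable_restrictAll (T : ℝ≥0) :
    Measurable fun (X : Fin N → Path d) m => (X m).restrict T :=
  measurable_pi_lambda _ fun m => (measurable_path_restrict T).comp (measurable_pi_apply m)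

instance isProbabilityMeasure_trajectories [NeZero N] (T : ℝ≥0) (es : List (Interaction N)) :
    IsProbabilityMeasure (M.trajectories T es) := by
  unfold trajectories
  have := isProbabilityMeasure_bind (m := Measure.pi fun _ : Fin N => M.init)
    (M.measurable_evolve_start 0 es) fun z => inferInstance
  exact Measure.isProbabilityMeasure_map (measurable_restrictAll T).aemeasurable

lemma measurable_trajectories [NeZero N] (T : ℝ≥0) :
    Measurable fun es : List (Interaction N) => M.trajectories T es := by
  unfold trajectories
  refine (Measure.measurable_map _ (measurable_restrictAll T)).comp ?_
  refine measurable_bind_param (κ := fun _ : List (Interaction N) =>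
    Measure.pi fun _ : Fin N => M.init) measurable_const (fun _ => inferInstance)
    (η := fun p => M.evolve 0 p.1 p.2) ?_
  exact M.measurable_evolve.comp
    (f := fun p : List (Interaction N) × (Fin N → E d) => ((0, p.2), p.1)) (by fun_prop)

end ParticleModel

/-! ### The Markov property of the free motion -/

section Markov

lemma concat_shift (s : ℝ≥0) (x y : Path d) : (Path.concat s x y).shift s = y := by
  apply Subtype.ext
  funext u
  change (if s + u < s then x (s + u) else y (s + u - s)) = y u
  simp

lemma concat_apply_of_lt {s u : ℝ≥0} (h : u < s) (x y : Path d) : Path.concat s x y u = x u :=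
  if_pos h

lemma concat_apply_of_le {s u : ℝ≥0} (h : s ≤ u) (x y : Path d) :
    Path.concat s x y u = y (u - s) := if_neg (not_lt.2 h)

lemma concat_concat {a b : ℝ≥0} (h : a ≤ b) (x y w : Path d) :
    Path.concat b (Path.concat a x y) w = Path.concat a x (Path.concat (b - a) y w) := by
  apply Subtype.ext
  funext u
  rcases lt_or_ge u a with hu | hu
  · rw [concat_apply_of_lt (hu.trans_le h), concat_apply_of_lt hu, concat_apply_of_lt hu]
  · rw [concat_apply_of_le hu]
    rcases lt_or_ge u b with hb | hb
    · rw [concat_apply_of_lt hb, concat_apply_of_le hu,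
        concat_apply_of_lt (tsub_lt_tsub_right_of_le hu hb)]
    · rw [concat_apply_of_le hb, concat_apply_of_le (tsub_le_tsub_right hb a)]
      rw [tsub_tsub_tsub_cancel_right h]

lemma leftLim_concat {a b : ℝ≥0} (h : a < b) (x y : Path d) :
    Function.leftLim (Path.concat a x y).1 b = Function.leftLim y.1 (b - a) := by
  refine tendsto_nhds_unique (tendsto_leftLim_path (Path.concat a x y) b) ?_
  refine (tendsto_leftLim_path y (b - a)).congr' ?_
  have h0 : Tendsto (fun n : ℕ => b - 1 / ((n : ℝ≥0) + 1)) atTop (𝓝 b) := by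
    simpa using (tendsto_const_nhds (x := b)).sub
      (tendsto_one_div_add_atTop_nhds_zero_nat (𝕜 := ℝ≥0))
  filter_upwards [h0.eventually (lt_mem_nhds h)] with n hn
  rw [concat_apply_of_le hn.le, tsub_right_comm]

/-- The σ-algebra of the evaluations up to the time `s`. -/
abbrev pastSpace (s : ℝ≥0) : MeasurableSpace (Path d) :=
  MeasurableSpace.comap (fun (w : Path d) (u : Iic s) => w u.1) inferInstance

lemma pastSpace_le (s : ℝ≥0) :
    pastSpace s ≤ (Subtype.instMeasurableSpace : MeasurableSpace (Path d)) := by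
  have : Measurable fun (w : Path d) (u : Iic s) => w u.1 :=
    measurable_pi_lambda _ fun u => measurable_path_apply u.1
  exact this.comap_le

variable (P : MarkovMotion d)

/-- The Markov property at a fixed time: continuing the path from its position at time `s` by an
independent path of the motion does not change the law. -/
lemma MarkovMotion.law_eq_bind (x : E d) (s : ℝ≥0) :
    P.law x = (P.law x).bind fun w => (P.law (w s)).map (Path.concat s w) := by
  have hκ : Measurable fun w : Path d => P.law (w s) :=
    P.law.measurable.comp (measurable_path_apply s)
  have hc : Measurable fun p : Path d × Path d => Path.concat s p.1 p.2 :=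
    measurable_path_concat.comp (measurable_const.prodMk measurable_id)
  have hc' : ∀ w : Path d, Measurable (Path.concat s w) := fun w =>
    hc.comp (measurable_prodMk_left (x := w))
  have hb : Measurable fun w : Path d => (P.law (w s)).map (Path.concat s w) :=
    measurable_map_param hκ (fun _ => inferInstance) hc
  have hprob := isProbabilityMeasure_bind (m := P.law x) hb
    fun w => Measure.isProbabilityMeasure_map (hc' w).aemeasurable
  let 𝒞 : Set (Set (Path d)) :=
    {S | ∃ A B, MeasurableSet[pastSpace s] A ∧ MeasurableSet B ∧ S = A ∩ Path.shift s ⁻¹' B}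
  refine ext_of_generate_finite 𝒞 ?_ ?_ ?_ (by simp)
  · apply le_antisymm
    · have h1 : ∀ u : ℝ≥0, Measurable[MeasurableSpace.generateFrom 𝒞] fun w : Path d => w u := by
        intro u S hS
        apply MeasurableSpace.measurableSet_generateFrom
        rcases le_or_gt u s with hu | hu
        · refine ⟨(fun w : Path d => w u) ⁻¹' S, univ, ?_, MeasurableSet.univ, by simp⟩
          exact ⟨(fun f : Iic s → E d => f ⟨u, hu⟩) ⁻¹' S, measurable_pi_apply _ hS, rfl⟩
        · refine ⟨univ, (fun w : Path d => w (u - s)) ⁻¹' S, MeasurableSet.univ,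
            measurable_path_apply _ hS, ?_⟩
          ext w
          have : (Path.shift s w) (u - s) = w u := by
            change w (s + (u - s)) = w u
            rw [add_tsub_cancel_of_le hu.le]
          simp [this]
      have h2 : Measurable[MeasurableSpace.generateFrom 𝒞]
          (Subtype.val : Path d → ℝ≥0 → E d) :=
        @measurable_pi_lambda _ _ _ (MeasurableSpace.generateFrom 𝒞) _ _ fun u => h1 u
      exact h2.comap_le
    · refine MeasurableSpace.generateFrom_le ?_
      rintro S ⟨A, B, hA, hB, rfl⟩
      exact (pastSpace_le s _ hA).inter (measurable_path_shift s hB)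
  · rintro S ⟨A, B, hA, hB, rfl⟩ S' ⟨A', B', hA', hB', rfl⟩ _
    refine ⟨A ∩ A', B ∩ B', hA.inter hA', hB.inter hB', ?_⟩
    ext w; simp only [mem_inter_iff, mem_preimage]; tauto
  · rintro S ⟨A, B, hA, hB, rfl⟩
    have hS : MeasurableSet (A ∩ Path.shift s ⁻¹' B) :=
      (pastSpace_le s _ hA).inter (measurable_path_shift s hB)
    rw [Measure.bind_apply hS hb.aemeasurable, P.markov x s A B hA hB,
      ← lintegral_indicator (pastSpace_le s _ hA)]
    refine lintegral_congr fun w => ?_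
    rw [Measure.map_apply (hc' w) hS]
    obtain ⟨A', hA', rfl⟩ := hA
    have key : (Path.concat s w ⁻¹' ((fun (w : Path d) (u : Iic s) => w u.1) ⁻¹' A' ∩
        Path.shift s ⁻¹' B) : Set (Path d)) =ᵐ[P.law (w s)]
        {y | (fun u : Iic s => w u.1) ∈ A' ∧ y ∈ B} := by
      filter_upwards [P.start (w s)] with y hy
      have : (fun u : Iic s => Path.concat s w y u.1) = fun u : Iic s => w u.1 := by
        funext ⟨u, hu⟩
        rcases (mem_Iic.1 hu).lt_or_eq with h | rfl
        · exact concat_apply_of_lt h _ _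
        · rw [concat_apply_of_le le_rfl, tsub_self, hy]
      apply propext
      change ((fun u : Iic s => Path.concat s w y u.1) ∈ A' ∧
        (Path.concat s w y).shift s ∈ B) ↔ _
      rw [this, concat_shift]
      rfl
    rw [measure_congr key]
    by_cases hw : (fun u : Iic s => w u.1) ∈ A'
    · rw [indicator_of_mem (show w ∈ (fun (w : Path d) (u : Iic s) => w u.1) ⁻¹' A' from hw)]
      congr 1
      ext y
      simp [hw]
    · rw [indicator_of_notMem (show w ∉ (fun (w : Path d) (u : Iic s) => w u.1) ⁻¹' A' from hw)]
      simp [hw]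

end Markov

namespace ParticleModel

variable (M : ParticleModel d) {N : ℕ}

/-- The law of `N` independent free motions started from the configuration `z`. -/
abbrev freeLaw (z : Fin N → E d) : Measure (Fin N → Path d) :=
  Measure.pi fun m => M.motion.law (z m)

lemma measurable_concatAll_left (τ : ℝ≥0) (X : Fin N → Path d) : Measurable (concatAll τ X) :=
  measurable_concatAll.comp (f := fun Y : Fin N → Path d => (τ, X, Y)) (by fun_prop)

/-- The Markov property at a fixed time of `N` independent free motions. -/
lemma lintegral_freeLaw_concat (τ : ℝ≥0) (z : Fin N → E d) {G : (Fin N → Path d) → ℝ≥0∞}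
    (hG : Measurable G) :
    ∫⁻ X, ∫⁻ Y, G (concatAll τ X Y) ∂M.freeLaw (evalAll X τ) ∂M.freeLaw z =
      ∫⁻ X, G X ∂M.freeLaw z := by
  have hev : Measurable fun X : Fin N → Path d => evalAll X τ :=
    measurable_evalAll.comp (f := fun X : Fin N → Path d => (X, τ)) (by fun_prop)
  have hκ : Measurable fun X : Fin N → Path d => M.freeLaw (evalAll X τ) :=
    M.measurable_pi_law.comp hev
  have hg : Measurable fun p : (Fin N → Path d) × (Fin N → Path d) => concatAll τ p.1 p.2 :=
    measurable_concatAll.comp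
      (f := fun p : (Fin N → Path d) × (Fin N → Path d) => (τ, p.1, p.2)) (by fun_prop)
  have hb : Measurable fun X : Fin N → Path d =>
      (M.freeLaw (evalAll X τ)).map (concatAll τ X) :=
    measurable_map_param hκ (fun _ => inferInstance) hg
  have key : M.freeLaw z =
      (M.freeLaw z).bind fun X => (M.freeLaw (evalAll X τ)).map (concatAll τ X) := by
    refine Measure.pi_eq fun B hB => ?_
    rw [Measure.bind_apply (MeasurableSet.univ_pi hB) hb.aemeasurable]
    have h1 : ∀ X : Fin N → Path d, (M.freeLaw (evalAll X τ)).map (concatAll τ X) (univ.pi B) =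
        ∏ m, M.motion.law (X m τ) (Path.concat τ (X m) ⁻¹' B m) := fun X => by
      rw [Measure.map_apply (measurable_concatAll_left τ X) (MeasurableSet.univ_pi hB)]
      have : concatAll τ X ⁻¹' univ.pi B = univ.pi fun m => Path.concat τ (X m) ⁻¹' B m := by
        ext Y; simp [concatAll]
      rw [this, Measure.pi_pi]
      rfl
    simp only [h1]
    have hc : Measurable fun p : Path d × Path d => Path.concat τ p.1 p.2 :=
      measurable_path_concat.comp (measurable_const.prodMk measurable_id)
    have hκ1 : Measurable fun w : Path d => M.motion.law (w τ) :=
      M.motion.law.measurable.comp (measurable_path_apply τ)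
    have hb1 : Measurable fun w : Path d => (M.motion.law (w τ)).map (Path.concat τ w) :=
      measurable_map_param hκ1 (fun _ => inferInstance) hc
    have hf : ∀ m, Measurable fun w : Path d =>
        M.motion.law (w τ) (Path.concat τ w ⁻¹' B m) := fun m => by
      have h2 : Measurable fun w : Path d =>
          (M.motion.law (w τ)).map (Path.concat τ w) (B m) :=
        (Measure.measurable_coe (hB m)).comp hb1
      convert h2 using 2 with w
      exact (Measure.map_apply (hc.comp (measurable_prodMk_left (x := w))) (hB m)).symm
    rw [lintegral_pi_prod (μ := fun m => M.motion.law (z m))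
      (f := fun m (w : Path d) => M.motion.law (w τ) (Path.concat τ w ⁻¹' B m)) hf]
    refine Finset.prod_congr rfl fun m _ => ?_
    conv_rhs => rw [M.motion.law_eq_bind (z m) τ, Measure.bind_apply (hB m) hb1.aemeasurable]
    refine lintegral_congr fun w => ?_
    exact (Measure.map_apply (hc.comp (measurable_prodMk_left (x := w))) (hB m)).symm
  conv_rhs => rw [key, Measure.lintegral_bind hb.aemeasurable hG.aemeasurable]
  refine lintegral_congr fun X => ?_
  rw [lintegral_map hG (measurable_concatAll_left τ X)]

end ParticleModel

/-! ### Pruning, symmetry and equivariance of the evolution -/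

/-- The particles at time `s` that may influence those of `C` later on, if `es` is the
chronological list of the interactions after time `s`. -/
def ancestors {N : ℕ} (C : Finset (Fin N)) : List (Interaction N) → Finset (Fin N)
  | [] => C
  | (_, i, j) :: es =>
      if i ∈ ancestors C es ∨ j ∈ ancestors C es then insert i (insert j (ancestors C es))
      else ancestors C es

lemma subset_ancestors {N : ℕ} (C : Finset (Fin N)) (es : List (Interaction N)) :
    C ⊆ ancestors C es := by
  induction es with
  | nil => exact Finset.Subset.refl C
  | cons e es ih =>
    obtain ⟨t, i, j⟩ := e
    unfold ancestors
    split_ifs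
    · exact ih.trans ((Finset.subset_insert _ _).trans (Finset.subset_insert _ _))
    · exact ih

lemma ancestors_subset_cons {N : ℕ} (C : Finset (Fin N)) (e : Interaction N)
    (es : List (Interaction N)) : ancestors C es ⊆ ancestors C (e :: es) := by
  obtain ⟨t, i, j⟩ := e
  conv_rhs => unfold ancestors
  split_ifs
  · exact (Finset.subset_insert _ _).trans (Finset.subset_insert _ _)
  · exact Finset.Subset.refl _

/-- The interaction in which the particles have been renamed by `σ`. -/
def relabel {N : ℕ} (σ : Equiv.Perm (Fin N)) (e : Interaction N) : Interaction N :=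
  (e.1, σ e.2.1, σ e.2.2)

namespace ParticleModel

variable (M : ParticleModel d) {N : ℕ}

lemma lintegral_interact (i j : Fin N) (xl x : Fin N → E d) {h : (Fin N → E d) → ℝ≥0∞}
    (hh : Measurable h) :
    ∫⁻ z, h z ∂M.interact i j xl x =
      (M.muHat (xl i, xl j) univ / ENNReal.ofReal M.rate) *
        ∫⁻ hk, h (Function.update (Function.update x i (xl i + hk.1)) j (xl j + hk.2))
          ∂((M.displacement (xl i) (xl j) univ)⁻¹ • M.displacement (xl i) (xl j)) +
      (1 - M.muHat (xl i, xl j) univ / ENNReal.ofReal M.rate) * h x := by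
  have hm : Measurable fun hk : E d × E d =>
      Function.update (Function.update x i (xl i + hk.1)) j (xl j + hk.2) :=
    (measurable_update_displace i j).comp (measurable_prodMk_left (x := (xl, x)))
  unfold interact
  rw [lintegral_add_measure, lintegral_smul_measure, lintegral_smul_measure,
    lintegral_map hh hm, lintegral_dirac' _ hh, smul_eq_mul, smul_eq_mul]

/-- An interaction only changes the positions of the two particles involved. -/
lemma lintegral_interact_of_notMem {i j : Fin N} {C : Finset (Fin N)} (hi : i ∉ C) (hj : j ∉ C)
    (xl x : Fin N → E d) {h : (Fin N → E d) → ℝ≥0∞} (hh : Measurable h)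
    (hd : DependsOn h (C : Set (Fin N))) : ∫⁻ z, h z ∂M.interact i j xl x = h x := by
  have e : ∀ hk : E d × E d,
      h (Function.update (Function.update x i (xl i + hk.1)) j (xl j + hk.2)) = h x := fun hk =>
    hd fun m hm => by
      have hmj : m ≠ j := fun e => hj (by rwa [← e])
      have hmi : m ≠ i := fun e => hi (by rwa [← e])
      rw [Function.update_of_ne hmj, Function.update_of_ne hmi]
  rw [M.lintegral_interact i j xl x hh]
  simp only [e, lintegral_const]
  rcases M.displacement_normalised (xl i) (xl j) with h0 | h1
  · simp [h0]
  · rw [h1, mul_one, ← add_mul, add_tsub_cancel_of_le (M.ratio_le_one _), one_mul]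

lemma lintegral_interact_congr {i j : Fin N} {C : Finset (Fin N)} {xl xl' x x' : Fin N → E d}
    (hi : xl i = xl' i) (hj : xl j = xl' j) (hx : ∀ m ∈ C, x m = x' m)
    {h : (Fin N → E d) → ℝ≥0∞} (hh : Measurable h) (hd : DependsOn h (C : Set (Fin N))) :
    ∫⁻ z, h z ∂M.interact i j xl x = ∫⁻ z, h z ∂M.interact i j xl' x' := by
  rw [M.lintegral_interact i j xl x hh, M.lintegral_interact i j xl' x' hh, hi, hj,
    hd (fun m hm => hx m hm)]
  congr 2
  refine lintegral_congr fun hk => hd fun m hm => ?_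
  simp only [Function.update_apply]
  split_ifs
  · rfl
  · rfl
  · exact hx m hm

/-- The order of the two particles of an interaction is irrelevant, by the symmetry of `muHat`. -/
lemma interact_swap {i j : Fin N} (hij : i ≠ j) (xl x : Fin N → E d) :
    M.interact i j xl x = M.interact j i xl x := by
  refine Measure.ext_of_lintegral _ fun h hh => ?_
  rw [M.lintegral_interact i j xl x hh, M.lintegral_interact j i xl x hh,
    M.muHat_univ_swap (xl i) (xl j), ← M.displacement_swap (xl i) (xl j),
    Measure.map_apply measurable_swap MeasurableSet.univ, preimage_univ,
    ← Measure.map_smul, lintegral_map _ measurable_swap]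
  · congr 2
    refine lintegral_congr fun hk => ?_
    rw [Function.update_comm hij]
    rfl
  · exact hh.comp ((measurable_update_displace j i).comp (measurable_prodMk_left (x := (xl, x))))

lemma evolve_swap {i j : Fin N} (hij : i ≠ j) (t : ℝ≥0) (l es : List (Interaction N)) :
    ∀ s z, M.evolve s (l ++ (t, i, j) :: es) z = M.evolve s (l ++ (t, j, i) :: es) z := by
  induction l with
  | nil =>
    intro s z
    simp only [List.nil_append, evolve_cons, M.interact_swap hij]
  | cons e l ih =>
    intro s z
    obtain ⟨t', i', j'⟩ := e
    simp only [List.cons_append, evolve_cons, ih]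

lemma map_pi_perm {β : Type*} [MeasurableSpace β] {N : ℕ} (σ : Equiv.Perm (Fin N))
    (μ : Fin N → Measure β) [∀ m, IsProbabilityMeasure (μ m)] :
    (Measure.pi μ).map (fun X m => X (σ m)) = Measure.pi fun m => μ (σ m) := by
  have hm : Measurable fun (X : Fin N → β) m => X (σ m) := by fun_prop
  refine (Measure.pi_eq fun B hB => ?_).symm
  rw [Measure.map_apply hm (MeasurableSet.univ_pi hB)]
  have : (fun (X : Fin N → β) m => X (σ m)) ⁻¹' univ.pi B =
      univ.pi fun m => B (σ.symm m) := by
    ext X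
    simp only [mem_preimage, Set.mem_pi, mem_univ, true_implies]
    exact ⟨fun h m => by simpa using h (σ.symm m), fun h m => by simpa using h (σ m)⟩
  rw [this, Measure.pi_pi]
  exact (Fintype.prod_equiv σ _ _ fun m => by simp).symm

lemma interact_comp_perm (σ : Equiv.Perm (Fin N)) (i j : Fin N) (xl x : Fin N → E d)
    {h : (Fin N → E d) → ℝ≥0∞} (hh : Measurable h) :
    ∫⁻ z, h z ∂M.interact i j (fun m => xl (σ m)) (fun m => x (σ m)) =
      ∫⁻ z, h (fun m => z (σ m)) ∂M.interact (σ i) (σ j) xl x := by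
  rw [M.lintegral_interact _ _ _ _ hh,
    M.lintegral_interact _ _ _ _ (h := fun z => h fun m => z (σ m)) (hh.comp (by fun_prop))]
  congr 2
  refine lintegral_congr fun hk => ?_
  congr 1
  funext m
  simp only [Function.update_apply, EmbeddingLike.apply_eq_iff_eq]

lemma trajectories_swap {i j : Fin N} (hij : i ≠ j) (T t : ℝ≥0) (l es : List (Interaction N)) :
    M.trajectories T (l ++ (t, i, j) :: es) = M.trajectories T (l ++ (t, j, i) :: es) := by
  unfold trajectories
  rw [funext (M.evolve_swap hij t l es 0)]

variable [NeZero N]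

lemma measurable_lintegral_evolve {α : Type*} [MeasurableSpace α]
    {s : α → ℝ≥0} (hs : Measurable s) (es : List (Interaction N))
    {G : α × (Fin N → Path d) → ℝ≥0∞} (hG : Measurable G) :
    Measurable fun p : α × (Fin N → E d) => ∫⁻ Y, G (p.1, Y) ∂M.evolve (s p.1) es p.2 := by
  have h1 : Measurable fun p : α × (Fin N → E d) => M.evolve (s p.1) es p.2 :=
    M.measurable_evolve.comp
      (f := fun p : α × (Fin N → E d) => ((s p.1, p.2), es)) (by fun_prop)
  exact measurable_lintegral_param h1 (fun p => inferInstance)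
    (f := fun q : (α × (Fin N → E d)) × (Fin N → Path d) => G (q.1.1, q.2))
    (hG.comp (by fun_prop))

lemma lintegral_evolve_cons (s t : ℝ≥0) (i j : Fin N) (es : List (Interaction N))
    (z : Fin N → E d) {G : (Fin N → Path d) → ℝ≥0∞} (hG : Measurable G) :
    ∫⁻ Y, G Y ∂M.evolve s ((t, i, j) :: es) z =
      ∫⁻ X, ∫⁻ z', ∫⁻ Y, G (concatAll (t - s) X Y) ∂M.evolve t es z'
        ∂M.interact i j (leftAll X (t - s)) (evalAll X (t - s)) ∂M.freeLaw z := by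
  have hc : Measurable fun p : (Fin N → Path d) × (Fin N → Path d) =>
      concatAll (t - s) p.1 p.2 :=
    measurable_concatAll.comp
      (f := fun p : (Fin N → Path d) × (Fin N → Path d) => (t - s, p.1, p.2)) (by fun_prop)
  obtain ⟨κ₃, e₃⟩ : ∃ κ : (Fin N → Path d) × (Fin N → E d) → Measure (Fin N → Path d),
      ∀ p, κ p = (M.evolve t es p.2).map (concatAll (t - s) p.1) := ⟨_, fun _ => rfl⟩
  have m₃ : Measurable κ₃ := by
    rw [funext e₃]
    exact measurable_map_param (κ := fun p : (Fin N → Path d) × (Fin N → E d) =>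
      M.evolve t es p.2) ((M.measurable_evolve_start t es).comp measurable_snd)
      (fun p => inferInstance) (g := fun q : ((Fin N → Path d) × (Fin N → E d)) ×
        (Fin N → Path d) => concatAll (t - s) q.1.1 q.2)
      (hc.comp (f := fun q : ((Fin N → Path d) × (Fin N → E d)) × (Fin N → Path d) =>
        (q.1.1, q.2)) (by fun_prop))
  obtain ⟨κ₂, e₂⟩ : ∃ κ : (Fin N → Path d) → Measure (Fin N → E d), ∀ X, κ X =
      M.interact i j (leftAll X (t - s)) (evalAll X (t - s)) := ⟨_, fun _ => rfl⟩
  have m₂ : Measurable κ₂ := by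
    rw [funext e₂]
    exact M.measurable_interact_apply measurable_const measurable_const
      (measurable_leftAll.comp (f := fun X : Fin N → Path d => (X, t - s)) (by fun_prop))
      (measurable_evalAll.comp (f := fun X : Fin N → Path d => (X, t - s)) (by fun_prop))
  have hp₂ : ∀ X, IsProbabilityMeasure (κ₂ X) := fun X => by rw [e₂]; infer_instance
  have m₁ : Measurable fun X => (κ₂ X).bind fun z' => κ₃ (X, z') :=
    measurable_bind_param m₂ hp₂ m₃
  have e : M.evolve s ((t, i, j) :: es) z =
      (M.freeLaw z).bind fun X => (κ₂ X).bind fun z' => κ₃ (X, z') := by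
    rw [evolve_cons]
    simp only [e₃, e₂]
  rw [e, Measure.lintegral_bind m₁.aemeasurable hG.aemeasurable]
  refine lintegral_congr fun X => ?_
  have n₃ : Measurable fun z' => κ₃ (X, z') := m₃.comp (measurable_prodMk_left (x := X))
  rw [Measure.lintegral_bind n₃.aemeasurable hG.aemeasurable, e₂]
  refine lintegral_congr fun z' => ?_
  rw [e₃]
  exact lintegral_map hG (measurable_concatAll_left _ X)

/-- The integrand of `lintegral_evolve_cons`, as a function of the free paths before the
interaction. -/
lemma measurable_lintegral_interact_evolve (a τ t : ℝ≥0) (i j : Fin N)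
    (es : List (Interaction N)) {G : (Fin N → Path d) → ℝ≥0∞} (hG : Measurable G) :
    Measurable fun X : Fin N → Path d => ∫⁻ z', ∫⁻ Y, G (concatAll τ X Y) ∂M.evolve t es z'
        ∂M.interact i j (leftAll X a) (evalAll X a) := by
  have hc : Measurable fun p : (Fin N → Path d) × (Fin N → Path d) =>
      G (concatAll τ p.1 p.2) :=
    hG.comp (measurable_concatAll.comp
      (f := fun p : (Fin N → Path d) × (Fin N → Path d) => (τ, p.1, p.2)) (by fun_prop))
  have m₂ : Measurable fun X : Fin N → Path d =>
      M.interact i j (leftAll X a) (evalAll X a) :=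
    M.measurable_interact_apply measurable_const measurable_const
      (measurable_leftAll.comp (f := fun X : Fin N → Path d => (X, a)) (by fun_prop))
      (measurable_evalAll.comp (f := fun X : Fin N → Path d => (X, a)) (by fun_prop))
  exact measurable_lintegral_param m₂ (fun X => inferInstance)
    (M.measurable_lintegral_evolve (s := fun _ : Fin N → Path d => t) measurable_const es hc)

/-- The law of the paths of the particles of `C` depends on the starting points of the ancestors
of `C` only. -/
lemma lintegral_evolve_congr {C : Finset (Fin N)} (es : List (Interaction N)) :
    ∀ (s : ℝ≥0) {z z' : Fin N → E d} {G : (Fin N → Path d) → ℝ≥0∞}, Measurable G →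
      DependsOn G (C : Set (Fin N)) → (∀ m ∈ ancestors C es, z m = z' m) →
      ∫⁻ Y, G Y ∂M.evolve s es z = ∫⁻ Y, G Y ∂M.evolve s es z' := by
  induction es with
  | nil =>
    intro s z z' G hG hd hz
    rw [evolve_nil, evolve_nil]
    exact lintegral_pi_congr_of_dependsOn (fun _ => inferInstance) (fun _ => inferInstance)
      (C := C) (fun m hm => by rw [hz m hm]) hG fun X Y h => hd h
  | cons e es ih =>
    intro s z z' G hG hd hz
    obtain ⟨t, i, j⟩ := e
    rw [M.lintegral_evolve_cons s t i j es z hG, M.lintegral_evolve_cons s t i j es z' hG]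
    refine lintegral_pi_congr_of_dependsOn (fun _ => inferInstance) (fun _ => inferInstance)
      (C := ancestors C ((t, i, j) :: es)) (fun m hm => by rw [hz m hm])
      (M.measurable_lintegral_interact_evolve (t - s) (t - s) t i j es hG) fun X X' hX => ?_
    have hsub := ancestors_subset_cons C (t, i, j) es
    have hGX : ∀ Y, G (concatAll (t - s) X Y) = G (concatAll (t - s) X' Y) := fun Y =>
      hd fun m hm => by
        unfold concatAll
        rw [hX m (hsub (subset_ancestors C es hm))]
    simp only [hGX]
    have hGm : Measurable fun Y => G (concatAll (t - s) X' Y) :=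
      hG.comp (measurable_concatAll_left _ _)
    have hGd : DependsOn (fun Y => G (concatAll (t - s) X' Y)) (C : Set (Fin N)) :=
      fun Y Y' h => hd fun m hm => by unfold concatAll; rw [h m hm]
    have hm : Measurable fun y => ∫⁻ Y, G (concatAll (t - s) X' Y) ∂M.evolve t es y :=
      (M.measurable_lintegral_evolve (s := fun _ : Unit => t) measurable_const es
        (G := fun p => G (concatAll (t - s) X' p.2)) (hGm.comp measurable_snd)).comp
        (measurable_prodMk_left (x := ()))
    have hd' : DependsOn (fun y => ∫⁻ Y, G (concatAll (t - s) X' Y) ∂M.evolve t es y)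
        (ancestors C es : Set (Fin N)) := fun y y' h => ih t hGm hGd h
    have hev : ∀ m ∈ ancestors C es, evalAll X (t - s) m = evalAll X' (t - s) m :=
      fun m hm => by unfold evalAll; rw [hX m (hsub hm)]
    by_cases hij : i ∈ ancestors C es ∨ j ∈ ancestors C es
    · have hanc : ancestors C ((t, i, j) :: es) = insert i (insert j (ancestors C es)) := by
        conv_lhs => unfold ancestors
        rw [if_pos hij]
      refine M.lintegral_interact_congr ?_ ?_ hev hm hd'
      · unfold leftAll; rw [hX i (by rw [hanc]; simp)]
      · unfold leftAll; rw [hX j (by rw [hanc]; simp)]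
    · push Not at hij
      rw [M.lintegral_interact_of_notMem hij.1 hij.2 _ _ hm hd',
        M.lintegral_interact_of_notMem hij.1 hij.2 _ _ hm hd']
      exact hd' hev

/-- The evolution may be interrupted at a time `t` at which no interaction takes place. -/
lemma lintegral_evolve_skip {s t : ℝ≥0} (hst : s ≤ t) {es : List (Interaction N)}
    (hes : ∀ e ∈ es, t < e.1) (z : Fin N → E d) {G : (Fin N → Path d) → ℝ≥0∞}
    (hG : Measurable G) :
    ∫⁻ X, ∫⁻ Y, G (concatAll (t - s) X Y) ∂M.evolve t es (evalAll X (t - s)) ∂M.freeLaw z =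
      ∫⁻ Y, G Y ∂M.evolve s es z := by
  cases es with
  | nil => exact M.lintegral_freeLaw_concat (t - s) z hG
  | cons e es =>
    obtain ⟨t', i, j⟩ := e
    have htt' : t < t' := hes (t', i, j) (by simp)
    have hlt : t - s < t' - s := tsub_lt_tsub_right_of_le hst htt'
    have hsub : t' - s - (t - s) = t' - t := tsub_tsub_tsub_cancel_right hst
    rw [M.lintegral_evolve_cons s t' i j es z hG, ← M.lintegral_freeLaw_concat (t - s) z
      (M.measurable_lintegral_interact_evolve (t' - s) (t' - s) t' i j es hG)]
    refine lintegral_congr fun X => ?_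
    rw [M.lintegral_evolve_cons t t' i j es _ (G := fun Y => G (concatAll (t - s) X Y))
      (hG.comp (measurable_concatAll_left (t - s) X))]
    refine lintegral_congr fun X' => ?_
    have h1 : leftAll (concatAll (t - s) X X') (t' - s) = leftAll X' (t' - t) := by
      funext m
      exact (leftLim_concat hlt (X m) (X' m)).trans (by rw [hsub]; rfl)
    have h2 : evalAll (concatAll (t - s) X X') (t' - s) = evalAll X' (t' - t) := by
      funext m
      exact (concat_apply_of_le hlt.le (X m) (X' m)).trans (by rw [hsub]; rfl)
    have h3 : ∀ Y, concatAll (t' - s) (concatAll (t - s) X X') Y =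
        concatAll (t - s) X (concatAll (t' - t) X' Y) := fun Y => by
      funext m
      exact (concat_concat hlt.le (X m) (X' m) (Y m)).trans (by rw [hsub]; rfl)
    rw [h1, h2]
    simp only [h3]

/-- An interaction that involves no ancestor of `C` does not influence the law of the paths of the
particles of `C`. -/
lemma lintegral_evolve_prune {C : Finset (Fin N)} {t : ℝ≥0} {i j : Fin N}
    {es : List (Interaction N)} (hi : i ∉ ancestors C es) (hj : j ∉ ancestors C es)
    (l : List (Interaction N)) :
    ∀ {s : ℝ≥0} (z : Fin N → E d) {G : (Fin N → Path d) → ℝ≥0∞}, Measurable G →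
      DependsOn G (C : Set (Fin N)) → (∀ e ∈ l ++ (t, i, j) :: es, s ≤ e.1) →
      (l ++ (t, i, j) :: es).Pairwise (fun a b => a.1 < b.1) →
      ∫⁻ Y, G Y ∂M.evolve s (l ++ (t, i, j) :: es) z = ∫⁻ Y, G Y ∂M.evolve s (l ++ es) z := by
  induction l with
  | nil =>
    intro s z G hG hd hs hsort
    rw [List.nil_append, List.nil_append] at *
    have hst : s ≤ t := hs (t, i, j) (by simp)
    have hes : ∀ e ∈ es, t < e.1 := fun e he => (List.pairwise_cons.1 hsort).1 e he
    rw [M.lintegral_evolve_cons s t i j es z hG, ← M.lintegral_evolve_skip hst hes z hG]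
    refine lintegral_congr fun X => ?_
    have hGm : Measurable fun Y => G (concatAll (t - s) X Y) :=
      hG.comp (measurable_concatAll_left _ _)
    have hGd : DependsOn (fun Y => G (concatAll (t - s) X Y)) (C : Set (Fin N)) :=
      fun Y Y' h => hd fun m hm => by unfold concatAll; rw [h m hm]
    have hm : Measurable fun y => ∫⁻ Y, G (concatAll (t - s) X Y) ∂M.evolve t es y :=
      (M.measurable_lintegral_evolve (s := fun _ : Unit => t) measurable_const es
        (G := fun p => G (concatAll (t - s) X p.2)) (hGm.comp measurable_snd)).comp
        (measurable_prodMk_left (x := ()))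
    exact M.lintegral_interact_of_notMem hi hj _ _ hm
      fun y y' h => M.lintegral_evolve_congr es t hGm hGd h
  | cons e l ih =>
    intro s z G hG hd hs hsort
    obtain ⟨t', i', j'⟩ := e
    rw [List.cons_append, List.cons_append, M.lintegral_evolve_cons s t' i' j' _ z hG,
      M.lintegral_evolve_cons s t' i' j' _ z hG]
    refine lintegral_congr fun X => lintegral_congr fun z' => ?_
    rw [List.cons_append, List.pairwise_cons] at hsort
    exact ih z' (hG.comp (measurable_concatAll_left _ _))
      (fun Y Y' h => hd fun m hm => by unfold concatAll; rw [h m hm])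
      (fun e he => (hsort.1 e he).le) hsort.2

/-- Exchangeability of the evolution: renaming the particles in the interactions and in the starting
configuration renames the paths. -/
lemma lintegral_evolve_relabel (σ : Equiv.Perm (Fin N)) (es : List (Interaction N)) :
    ∀ (s : ℝ≥0) (z : Fin N → E d) {G : (Fin N → Path d) → ℝ≥0∞}, Measurable G →
      ∫⁻ Y, G Y ∂M.evolve s (es.map (relabel σ)) z =
        ∫⁻ Y, G (fun m => Y (σ.symm m)) ∂M.evolve s es (fun m => z (σ m)) := by
  induction es with
  | nil =>
    intro s z G hG
    rw [List.map_nil, evolve_nil, evolve_nil,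
      ← map_pi_perm σ (fun m => M.motion.law (z m)),
      lintegral_map (f := fun Y : Fin N → Path d => G fun m => Y (σ.symm m))
        (hG.comp (by fun_prop)) (by fun_prop)]
    simp
  | cons e es ih =>
    intro s z G hG
    obtain ⟨t, i, j⟩ := e
    have hG' : Measurable fun Y : Fin N → Path d => G fun m => Y (σ.symm m) :=
      hG.comp (by fun_prop)
    have e1 : (List.map (relabel σ) ((t, i, j) :: es)) =
        (t, σ i, σ j) :: es.map (relabel σ) := rfl
    rw [e1, M.lintegral_evolve_cons s t _ _ _ z hG, M.lintegral_evolve_cons s t i j es _ hG',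
      freeLaw, freeLaw, ← map_pi_perm σ (fun m => M.motion.law (z m)),
      lintegral_map (M.measurable_lintegral_interact_evolve (t - s) (t - s) t i j es hG')
        (by fun_prop)]
    refine lintegral_congr fun X => ?_
    have hGX : Measurable fun Y : Fin N → Path d => G (concatAll (t - s) X Y) :=
      hG.comp (measurable_concatAll_left _ _)
    have hm : Measurable fun y => ∫⁻ Y, G (concatAll (t - s) X fun m => Y (σ.symm m))
        ∂M.evolve t es y :=
      (M.measurable_lintegral_evolve (s := fun _ : Unit => t) measurable_const es
        (G := fun p => G (concatAll (t - s) X fun m => p.2 (σ.symm m)))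
        (hGX.comp (by fun_prop))).comp (measurable_prodMk_left (x := ()))
    have e2 : ∀ y, ∫⁻ Y, G (concatAll (t - s) X Y) ∂M.evolve t (es.map (relabel σ)) y =
        ∫⁻ Y, G (concatAll (t - s) X fun m => Y (σ.symm m)) ∂M.evolve t es fun m => y (σ m) :=
      fun y => ih t y hGX
    have e3 : ∀ Y : Fin N → Path d, (fun m => concatAll (t - s) (fun m => X (σ m)) Y (σ.symm m)) =
        concatAll (t - s) X fun m => Y (σ.symm m) := fun Y => by
      funext m
      simp [concatAll]
    simp only [e2, e3]
    exact (M.interact_comp_perm σ i j (leftAll X (t - s)) (evalAll X (t - s)) hm).symm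

lemma lintegral_trajectories (T : ℝ≥0) (es : List (Interaction N))
    {F : (Fin N → PathOn T d) → ℝ≥0∞} (hF : Measurable F) :
    ∫⁻ z, F z ∂M.trajectories T es =
      ∫⁻ z₀, ∫⁻ X, F (fun m => (X m).restrict T) ∂M.evolve 0 es z₀
        ∂(Measure.pi fun _ : Fin N => M.init) := by
  unfold trajectories
  rw [lintegral_map hF (measurable_restrictAll T),
    Measure.lintegral_bind (M.measurable_evolve_start 0 es).aemeasurable
      (f := fun X : Fin N → Path d => F fun m => (X m).restrict T)
      (hF.comp (measurable_restrictAll T)).aemeasurable]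

/-- The last interaction before those of `es` may be deleted, for a functional of the paths of `C`,
if neither of its particles is an ancestor of `C`. -/
lemma lintegral_trajectories_prune {C : Finset (Fin N)} {T t : ℝ≥0} {i j : Fin N}
    {l es : List (Interaction N)} (hi : i ∉ ancestors C es) (hj : j ∉ ancestors C es)
    {F : (Fin N → PathOn T d) → ℝ≥0∞} (hF : Measurable F) (hd : DependsOn F (C : Set (Fin N)))
    (hs : (l ++ (t, i, j) :: es).Pairwise (fun a b => a.1 < b.1)) :
    ∫⁻ z, F z ∂M.trajectories T (l ++ (t, i, j) :: es) =
      ∫⁻ z, F z ∂M.trajectories T (l ++ es) := by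
  rw [M.lintegral_trajectories T _ hF, M.lintegral_trajectories T _ hF]
  refine lintegral_congr fun z₀ => ?_
  exact M.lintegral_evolve_prune hi hj l z₀ (hF.comp (measurable_restrictAll T))
    (fun X Y h => hd fun m hm => by rw [h m hm]) (fun _ _ => zero_le) hs

/-- Exchangeability: as the initial positions are i.i.d., renaming the particles in the interactions
amounts to renaming the trajectories. -/
lemma lintegral_trajectories_relabel (σ : Equiv.Perm (Fin N)) (T : ℝ≥0)
    (es : List (Interaction N)) {F : (Fin N → PathOn T d) → ℝ≥0∞} (hF : Measurable F) :
    ∫⁻ z, F z ∂M.trajectories T (es.map (relabel σ)) =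
      ∫⁻ z, F (fun m => z (σ.symm m)) ∂M.trajectories T es := by
  have hF' : Measurable fun z : Fin N → PathOn T d => F fun m => z (σ.symm m) :=
    hF.comp (by fun_prop)
  have hm : Measurable fun z₀ => ∫⁻ X, F (fun m => (X (σ.symm m)).restrict T)
      ∂M.evolve 0 es z₀ :=
    (M.measurable_lintegral_evolve (s := fun _ : Unit => 0) measurable_const es
        (G := fun p => F fun m => (p.2 (σ.symm m)).restrict T)
        ((hF'.comp (measurable_restrictAll T)).comp measurable_snd)).comp
        (measurable_prodMk_left (x := ()))
  rw [M.lintegral_trajectories T _ hF, M.lintegral_trajectories T _ hF']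
  conv_rhs => rw [← map_pi_perm σ (fun _ => M.init), lintegral_map hm (by fun_prop)]
  refine lintegral_congr fun z₀ => ?_
  exact M.lintegral_evolve_relabel σ es 0 z₀ (hF.comp (measurable_restrictAll T))

end ParticleModel

/-! ### The last point of a Poisson process -/

section Cube

/-- The Lebesgue measure of the cube `[0,t]^n`. -/
abbrev cube (t : ℝ) (n : ℕ) : Measure (Fin n → ℝ) :=
  Measure.pi fun _ => (volume : Measure ℝ).restrict (Icc 0 t)

lemma cube_eq (t : ℝ) (n : ℕ) :
    cube t n = (volume : Measure (Fin n → ℝ)).restrict (univ.pi fun _ => Icc 0 t) :=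
  (Measure.restrict_pi_pi (fun _ => (volume : Measure ℝ)) _).symm

lemma lintegral_cube_insertNth (t : ℝ) (n : ℕ) (i : Fin (n + 1))
    {h : (Fin (n + 1) → ℝ) → ℝ≥0∞} (hh : Measurable h) :
    ∫⁻ y, h y ∂cube t (n + 1) =
      ∫⁻ s in Icc 0 t, ∫⁻ y, h (i.insertNth s y : Fin (n + 1) → ℝ) ∂cube t n := by
  let e := MeasurableEquiv.piFinSuccAbove (fun _ : Fin (n + 1) => ℝ) i
  have he := measurePreserving_piFinSuccAbove
    (fun _ : Fin (n + 1) => (volume : Measure ℝ).restrict (Icc 0 t)) i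
  have h1 := he.symm.lintegral_comp_emb e.symm.measurableEmbedding h
  rw [← h1]
  exact lintegral_prod (fun p => h (e.symm p)) (hh.comp e.symm.measurable).aemeasurable

lemma ae_cube_ne (t : ℝ) (n : ℕ) (i : Fin n) (a : ℝ) : ∀ᵐ y ∂cube t n, y i ≠ a := by
  rw [ae_iff]
  simpa using Measure.pi_hyperplane (fun _ : Fin n => (volume : Measure ℝ).restrict (Icc 0 t)) i a

lemma ae_cube_mem (t : ℝ) (n : ℕ) : ∀ᵐ y ∂cube t n, ∀ i, y i ∈ Icc 0 t := by
  rw [cube_eq]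
  filter_upwards [ae_restrict_mem (MeasurableSet.univ_pi fun _ => measurableSet_Icc)] with y hy i
  exact hy i (mem_univ i)

lemma ae_cube_injective (t : ℝ) (n : ℕ) : ∀ᵐ y ∂cube t n, Function.Injective y := by
  have h : ∀ i k : Fin n, i ≠ k → ∀ᵐ y ∂cube t n, y i ≠ y k := by
    intro i k hik
    cases n with
    | zero => exact i.elim0
    | succ n =>
      obtain ⟨k', rfl⟩ := Fin.exists_succAbove_eq hik.symm
      have hS : MeasurableSet {y : Fin (n + 1) → ℝ | y i = y (i.succAbove k')} :=
        measurableSet_eq_fun (measurable_pi_apply _) (measurable_pi_apply _)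
      have : cube t (n + 1) {y | y i = y (i.succAbove k')} = 0 := by
        rw [← lintegral_indicator_one hS,
          lintegral_cube_insertNth t n i (measurable_one.indicator hS)]
        have h0 : ∀ s : ℝ, ∫⁻ y, {y : Fin (n + 1) → ℝ | y i = y (i.succAbove k')}.indicator 1
            (i.insertNth s y : Fin (n + 1) → ℝ) ∂cube t n = (0 : ℝ≥0∞) := fun s => by
          rw [← lintegral_zero (μ := cube t n)]
          refine lintegral_congr_ae ?_
          filter_upwards [ae_cube_ne t n k' s] with y hy
          refine indicator_of_notMem (fun hmem => hy ?_) _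
          have h2 : (i.insertNth s y : Fin (n + 1) → ℝ) i =
            (i.insertNth s y : Fin (n + 1) → ℝ) (i.succAbove k') := hmem
          simpa using h2.symm
        simp only [h0, lintegral_zero]
      rw [ae_iff]
      simpa using this
  have h' : ∀ᵐ y ∂cube t n, ∀ i k : Fin n, i ≠ k → y i ≠ y k := by
    simp only [ae_all_iff]
    exact h
  filter_upwards [h'] with y hy i k hik
  by_contra hne
  exact hy i k hne hik

/-- Restricting all the coordinates to be less than `s` turns `[0,t]^n` into `[0,s]^n`. -/
lemma lintegral_cube_indicator_lt {s t : ℝ} (hst : s ≤ t) (n : ℕ)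
    (h : (Fin n → ℝ) → ℝ≥0∞) :
    ∫⁻ y, (univ.pi fun _ : Fin n => Iio s).indicator h y ∂cube t n = ∫⁻ y, h y ∂cube s n := by
  rw [lintegral_indicator (MeasurableSet.univ_pi fun _ => measurableSet_Iio),
    Measure.restrict_pi_pi]
  have : (volume.restrict (Icc 0 t)).restrict (Iio s) =
      (volume : Measure ℝ).restrict (Icc 0 s) := by
    rw [Measure.restrict_restrict measurableSet_Iio]
    have h1 : Iio s ∩ Icc 0 t = Ico 0 s := by
      ext u; simp only [mem_inter_iff, mem_Iio, mem_Icc, mem_Ico]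
      constructor
      · rintro ⟨h1, h2, -⟩; exact ⟨h2, h1⟩
      · rintro ⟨h1, h2⟩; exact ⟨h2, h1, h2.le.trans hst⟩
    rw [h1]
    exact Measure.restrict_congr_set Ico_ae_eq_Icc
  simp only [this]

/-- The coordinates of almost every point of the cube have a unique strict maximum, and by symmetry
the maximal coordinate may be taken to be the first one. -/
lemma lintegral_cube_succ (t : ℝ) (n : ℕ) {h : (Fin (n + 1) → ℝ) → ℝ≥0∞} (hh : Measurable h)
    (hsymm : ∀ (i : Fin (n + 1)) (s : ℝ) (y : Fin n → ℝ),
      h (i.insertNth s y : Fin (n + 1) → ℝ) = h (Fin.cons s y : Fin (n + 1) → ℝ)) :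
    ∫⁻ y, h y ∂cube t (n + 1) =
      (n + 1) * ∫⁻ s in Icc 0 t, ∫⁻ y, h (Fin.cons s y : Fin (n + 1) → ℝ) ∂cube s n := by
  let S : Fin (n + 1) → Set (Fin (n + 1) → ℝ) := fun i => {y | ∀ k, y (i.succAbove k) < y i}
  have hS : ∀ i, MeasurableSet (S i) := fun i => by
    have : S i = ⋂ k, {y | y (i.succAbove k) < y i} := by ext y; simp [S]
    rw [this]
    exact MeasurableSet.iInter fun k =>
      measurableSet_lt (measurable_pi_apply _) (measurable_pi_apply _)
  have h1 : ∀ᵐ y ∂cube t (n + 1), h y = ∑ i, (S i).indicator h y := by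
    filter_upwards [ae_cube_injective t (n + 1)] with y hy
    obtain ⟨i, hi⟩ := Finite.exists_max y
    have hlt : ∀ k, k ≠ i → y k < y i := fun k hk => lt_of_le_of_ne (hi k) fun e => hk (hy e)
    rw [Finset.sum_eq_single i]
    · rw [indicator_of_mem]
      exact fun k => hlt _ (Fin.succAbove_ne i k)
    · intro k _ hk
      refine indicator_of_notMem (fun hmem => ?_) _
      obtain ⟨m, hm⟩ := Fin.exists_succAbove_eq hk.symm
      have := hmem m
      rw [hm] at this
      exact absurd this (not_lt.2 (hi k))
    · simp
  rw [lintegral_congr_ae h1, lintegral_finsetSum _ fun i _ => hh.indicator (hS i)]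
  have h2 : ∀ i, ∫⁻ y, (S i).indicator h y ∂cube t (n + 1) =
      ∫⁻ s in Icc 0 t, ∫⁻ y, h (Fin.cons s y : Fin (n + 1) → ℝ) ∂cube s n := fun i => by
    rw [lintegral_cube_insertNth t n i (hh.indicator (hS i))]
    refine setLIntegral_congr_fun measurableSet_Icc fun s hs => ?_
    rw [← lintegral_cube_indicator_lt hs.2]
    refine lintegral_congr fun y => ?_
    have hmem : ((i.insertNth s y : Fin (n + 1) → ℝ) ∈ S i) ↔
        y ∈ univ.pi fun _ : Fin n => Iio s := by
      simp [S]
    by_cases hy : y ∈ univ.pi fun _ : Fin n => Iio s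
    · rw [indicator_of_mem hy, indicator_of_mem (hmem.2 hy), hsymm]
    · rw [indicator_of_notMem hy, indicator_of_notMem (fun hc => hy (hmem.1 hc))]
  simp only [h2, Finset.sum_const, Finset.card_univ, Fintype.card_fin, nsmul_eq_mul]
  push_cast
  rfl

end Cube

section Poisson

/-- The law of a Poisson process of parameter `lam` on `[0,t]`, multiplied by `e ^ (lam * t)`. -/
def poissonRaw (lam : ℝ) (t : ℝ) : Measure Points :=
  Measure.sum fun n : ℕ => ENNReal.ofReal (lam ^ n / n.factorial) •
    (cube t n).map (Sigma.mk (β := fun n : ℕ => Fin n → ℝ) n)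

lemma measurable_sigmaMk (n : ℕ) : Measurable (Sigma.mk (β := fun n : ℕ => Fin n → ℝ) n) :=
  fun _ hs => MeasurableSpace.measurableSet_iInf.1 hs n

lemma measurable_points_iff {α : Type*} [MeasurableSpace α] {h : Points → α} :
    Measurable h ↔ ∀ n, Measurable fun y : Fin n → ℝ => h ⟨n, y⟩ := by
  refine ⟨fun hh n => hh.comp (measurable_sigmaMk n), fun hh s hs => ?_⟩
  exact MeasurableSpace.measurableSet_iInf.2 fun n => hh n hs

lemma lintegral_poissonRaw (lam t : ℝ) {h : Points → ℝ≥0∞} (hh : Measurable h) :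
    ∫⁻ ω, h ω ∂poissonRaw lam t =
      ∑' n : ℕ, ENNReal.ofReal (lam ^ n / n.factorial) * ∫⁻ y, h ⟨n, y⟩ ∂cube t n := by
  unfold poissonRaw
  rw [lintegral_sum_measure]
  refine tsum_congr fun n => ?_
  rw [lintegral_smul_measure, lintegral_map hh (measurable_sigmaMk n), smul_eq_mul]

lemma poissonProcess_eq (lam : ℝ) (T : ℝ≥0) :
    poissonProcess lam T = ENNReal.ofReal (Real.exp (-(lam * T))) • poissonRaw lam T := by
  ext S hS
  rw [poissonProcess, poissonRaw, Measure.smul_apply, Measure.sum_apply _ hS,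
    Measure.sum_apply _ hS, smul_eq_mul, ← ENNReal.tsum_mul_left]
  refine tsum_congr fun n => ?_
  rw [Measure.smul_apply, Measure.smul_apply, smul_eq_mul, smul_eq_mul, ← mul_assoc,
    ← ENNReal.ofReal_mul (Real.exp_pos _).le, mul_div_assoc]

lemma poissonRaw_univ {lam t : ℝ} (hlam : 0 ≤ lam) (ht : 0 ≤ t) :
    poissonRaw lam t univ = ENNReal.ofReal (Real.exp (lam * t)) := by
  rw [← lintegral_one, lintegral_poissonRaw lam t measurable_const]
  have : ∀ n : ℕ, ∫⁻ _, 1 ∂cube t n = ENNReal.ofReal (t ^ n) := fun n => by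
    simp only [lintegral_one, Measure.pi_univ, Measure.restrict_apply_univ,
      Real.volume_Icc, sub_zero, Finset.prod_const, Finset.card_univ, Fintype.card_fin]
    rw [ENNReal.ofReal_pow ht]
  simp only [this]
  have h2 : ∀ n : ℕ, ENNReal.ofReal (lam ^ n / n.factorial) * ENNReal.ofReal (t ^ n) =
      ENNReal.ofReal ((lam * t) ^ n / n.factorial) := fun n => by
    rw [← ENNReal.ofReal_mul (by positivity)]
    congr 1
    rw [mul_pow]; ring
  simp only [h2]
  rw [← ENNReal.ofReal_tsum_of_nonneg (fun n => by positivity)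
    (Real.summable_pow_div_factorial _), Real.exp_eq_exp_ℝ, NormedSpace.exp_eq_tsum_div]

lemma poissonRaw_neg {lam t : ℝ} (ht : t < 0) :
    poissonRaw lam t univ ≤ 1 := by
  rw [← lintegral_one, lintegral_poissonRaw lam t measurable_const, tsum_eq_single 0]
  · simp
  · intro n hn
    have : cube t n univ = 0 := by
      rw [Measure.pi_univ]
      exact Finset.prod_eq_zero (Finset.mem_univ ⟨0, Nat.pos_of_ne_zero hn⟩) (by simp [ht.le])
    rw [lintegral_one, this, mul_zero]

instance isFiniteMeasure_poissonRaw (lam : ℝ≥0) (t : ℝ) : IsFiniteMeasure (poissonRaw lam t) := by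
  constructor
  rcases lt_or_ge t 0 with h | h
  · exact (poissonRaw_neg h).trans_lt (by simp)
  · rw [poissonRaw_univ lam.coe_nonneg h]; exact ENNReal.ofReal_lt_top

/-- Adding a point to a configuration. -/
def insertPoint (s : ℝ) (ω : Points) : Points := ⟨ω.1 + 1, Fin.cons s ω.2⟩

/-- The empty configuration. -/
def noPoint : Points := ⟨0, Fin.elim0⟩

/-- The functions of a configuration that do not depend on the place at which a given point is
inserted. -/
def InsertInvariant {α : Type*} (h : Points → α) : Prop :=
  ∀ (n : ℕ) (i : Fin (n + 1)) (s : ℝ) (y : Fin n → ℝ),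
    h ⟨n + 1, i.insertNth s y⟩ = h ⟨n + 1, Fin.cons s y⟩

lemma measurable_prod_points {α β : Type*} [MeasurableSpace α] [MeasurableSpace β]
    {h : α × Points → β} (hh : ∀ n, Measurable fun p : α × (Fin n → ℝ) => h (p.1, ⟨n, p.2⟩)) :
    Measurable h := by
  intro S hS
  have hfst : Measurable fun ω : Points => ω.1 :=
    measurable_points_iff.2 fun n => measurable_const
  have hvec : ∀ n, Measurable fun ω : Points =>
      (fun i : Fin n => if h : i.1 < ω.1 then ω.2 ⟨i, h⟩ else 0) := fun n => by
    refine measurable_pi_lambda _ fun i => measurable_points_iff.2 fun m => ?_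
    by_cases him : i.1 < m
    · simpa only [him, dite_true] using measurable_pi_apply (⟨i.1, him⟩ : Fin m)
    · simp [him]
  have : h ⁻¹' S = ⋃ n : ℕ, ({p : α × Points | p.2.1 = n} ∩
      (fun p : α × Points =>
        (p.1, fun i : Fin n => if h : i.1 < p.2.1 then p.2.2 ⟨i, h⟩ else 0)) ⁻¹'
        ((fun p : α × (Fin n → ℝ) => h (p.1, ⟨n, p.2⟩)) ⁻¹' S)) := by
    ext ⟨a, n, y⟩
    simp
  rw [this]
  refine MeasurableSet.iUnion fun n => MeasurableSet.inter ?_ ?_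
  · exact (hfst.comp measurable_snd) (measurableSet_singleton n)
  · exact Measurable.prodMk measurable_fst ((hvec n).comp measurable_snd) (hh n hS)

lemma measurable_insertPoint : Measurable fun p : ℝ × Points => insertPoint p.1 p.2 := by
  refine measurable_prod_points fun n => ?_
  refine (measurable_sigmaMk (n + 1)).comp (measurable_pi_lambda _ fun i => ?_)
  refine Fin.cases ?_ (fun j => ?_) i
  · simpa using measurable_fst
  · simp only [Fin.cons_succ]
    exact (measurable_pi_apply j).comp measurable_snd

lemma measurable_lintegral_cube {α : Type*} [MeasurableSpace α] (n : ℕ) {τ : α → ℝ}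
    (hτ : Measurable τ) {f : α × (Fin n → ℝ) → ℝ≥0∞} (hf : Measurable f) :
    Measurable fun a => ∫⁻ y, f (a, y) ∂cube (τ a) n := by
  have hS : MeasurableSet {p : α × (Fin n → ℝ) | ∀ i, 0 ≤ p.2 i ∧ p.2 i ≤ τ p.1} := by
    have : {p : α × (Fin n → ℝ) | ∀ i, 0 ≤ p.2 i ∧ p.2 i ≤ τ p.1} =
        ⋂ i, ({p | 0 ≤ p.2 i} ∩ {p | p.2 i ≤ τ p.1}) := by ext p; simp
    rw [this]
    exact MeasurableSet.iInter fun i =>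
      (measurableSet_le measurable_const (by fun_prop)).inter
        (measurableSet_le (by fun_prop) (hτ.comp measurable_fst))
  have h1 : ∀ a, ∫⁻ y, f (a, y) ∂cube (τ a) n = ∫⁻ y : Fin n → ℝ,
      {p : α × (Fin n → ℝ) | ∀ i, 0 ≤ p.2 i ∧ p.2 i ≤ τ p.1}.indicator f (a, y) := fun a => by
    rw [cube_eq, ← lintegral_indicator (MeasurableSet.univ_pi fun _ => measurableSet_Icc)]
    refine lintegral_congr fun y => ?_
    have : (y ∈ univ.pi fun _ : Fin n => Icc 0 (τ a)) ↔
        (a, y) ∈ {p : α × (Fin n → ℝ) | ∀ i, 0 ≤ p.2 i ∧ p.2 i ≤ τ p.1} :=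
      ⟨fun hc i => hc i (mem_univ i), fun hc i _ => hc i⟩
    by_cases hy : y ∈ univ.pi fun _ : Fin n => Icc 0 (τ a)
    · rw [indicator_of_mem hy, indicator_of_mem (this.1 hy)]
    · rw [indicator_of_notMem hy, indicator_of_notMem (fun hc => hy (this.2 hc))]
  simp only [h1]
  exact (hf.indicator hS).lintegral_prod_right'

lemma measurable_lintegral_poissonRaw {α : Type*} [MeasurableSpace α] (lam : ℝ) {τ : α → ℝ}
    (hτ : Measurable τ) {f : α × Points → ℝ≥0∞} (hf : Measurable f) :
    Measurable fun a => ∫⁻ ω, f (a, ω) ∂poissonRaw lam (τ a) := by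
  have h1 : ∀ a, ∫⁻ ω, f (a, ω) ∂poissonRaw lam (τ a) = ∑' n : ℕ,
      ENNReal.ofReal (lam ^ n / n.factorial) * ∫⁻ y, f (a, ⟨n, y⟩) ∂cube (τ a) n := fun a =>
    lintegral_poissonRaw lam (τ a) (hf.comp (measurable_prodMk_left (x := a)))
  simp only [h1]
  refine Measurable.tsum fun n => Measurable.const_mul ?_ _
  refine measurable_lintegral_cube n hτ
    (f := fun p : α × (Fin n → ℝ) => f (p.1, ⟨n, p.2⟩)) ?_
  exact hf.comp (measurable_fst.prodMk ((measurable_sigmaMk n).comp measurable_snd))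

/-- Decomposition of a Poisson process according to its last point. -/
lemma lintegral_poissonRaw_last (lam : ℝ≥0) (t : ℝ) {h : Points → ℝ≥0∞} (hh : Measurable h)
    (hi : InsertInvariant h) :
    ∫⁻ ω, h ω ∂poissonRaw lam t = h noPoint +
      ∫⁻ s in Icc 0 t, lam * ∫⁻ ω, h (insertPoint s ω) ∂poissonRaw lam s := by
  rw [lintegral_poissonRaw _ _ hh, tsum_eq_zero_add' ENNReal.summable]
  congr 1
  · simp only [pow_zero, Nat.factorial_zero, Nat.cast_one, div_one, ENNReal.ofReal_one, one_mul]
    rw [cube, Measure.pi_of_empty _ Fin.elim0, lintegral_dirac]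
    rfl
  · have h1 : ∀ s : ℝ, ∫⁻ ω, h (insertPoint s ω) ∂poissonRaw lam s = ∑' n : ℕ,
        ENNReal.ofReal ((lam : ℝ) ^ n / n.factorial) *
          ∫⁻ y, h ⟨n + 1, Fin.cons s y⟩ ∂cube s n := fun s =>
      lintegral_poissonRaw _ _
        (hh.comp (measurable_insertPoint.comp (measurable_prodMk_left (x := s))))
    have hm : ∀ n : ℕ, Measurable fun s : ℝ => ∫⁻ y, h ⟨n + 1, Fin.cons s y⟩ ∂cube s n :=
      fun n => measurable_lintegral_cube n measurable_id
        (f := fun p : ℝ × (Fin n → ℝ) => h ⟨n + 1, Fin.cons p.1 p.2⟩)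
        (hh.comp (measurable_insertPoint.comp
          (measurable_fst.prodMk ((measurable_sigmaMk n).comp measurable_snd))))
    simp only [h1]
    simp only [← ENNReal.tsum_mul_left]
    rw [lintegral_tsum fun n => (((hm n).const_mul _).const_mul _).aemeasurable]
    refine tsum_congr fun n => ?_
    rw [lintegral_const_mul _ ((hm n).const_mul _), lintegral_const_mul _ (hm n),
      lintegral_cube_succ t n (h := fun y => h ⟨n + 1, y⟩) (hh.comp (measurable_sigmaMk (n + 1)))
        (fun i s y => hi n i s y), ← mul_assoc, ← mul_assoc]
    congr 1
    rw [← ENNReal.ofReal_coe_nnreal (p := lam), ← ENNReal.ofReal_mul lam.coe_nonneg]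
    have : ((n : ℝ≥0∞) + 1) = ENNReal.ofReal (n + 1) := by
      rw [ENNReal.ofReal_add (by positivity) zero_le_one]; simp
    rw [this, ← ENNReal.ofReal_mul (by positivity)]
    congr 1
    rw [pow_succ, Nat.factorial_succ]
    push_cast
    field_simp

end Poisson

/-! ### The last point of finitely many independent Poisson processes -/

lemma lintegral_triangle {t : ℝ} {c : ℝ × ℝ → ℝ≥0∞} (hc : Measurable c) :
    ∫⁻ s in Icc 0 t, ∫⁻ u in Ioc s t, c (s, u) = ∫⁻ u in Icc 0 t, ∫⁻ s in Icc 0 u, c (s, u) := by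
  have hS : MeasurableSet {p : ℝ × ℝ | p.1 < p.2} := measurableSet_lt measurable_fst measurable_snd
  have h1 : ∀ s ∈ Icc 0 t, ∫⁻ u in Ioc s t, c (s, u) =
      ∫⁻ u in Icc 0 t, {p : ℝ × ℝ | p.1 < p.2}.indicator c (s, u) := fun s hs => by
    have e : ∀ u, {p : ℝ × ℝ | p.1 < p.2}.indicator c (s, u) =
        (Ioi s).indicator (fun u => c (s, u)) u := fun u => rfl
    simp only [e]
    rw [lintegral_indicator measurableSet_Ioi, Measure.restrict_restrict measurableSet_Ioi]
    congr 2
    ext u; simp only [mem_Ioc, mem_inter_iff, mem_Ioi, mem_Icc]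
    exact ⟨fun h => ⟨h.1, hs.1.trans h.1.le, h.2⟩, fun h => ⟨h.1, h.2.2⟩⟩
  have h2 : ∀ u ∈ Icc 0 t, ∫⁻ s in Icc 0 u, c (s, u) =
      ∫⁻ s in Icc 0 t, {p : ℝ × ℝ | p.1 < p.2}.indicator c (s, u) := fun u hu => by
    have e : ∀ s, {p : ℝ × ℝ | p.1 < p.2}.indicator c (s, u) =
        (Iio u).indicator (fun s => c (s, u)) s := fun s => rfl
    simp only [e]
    rw [lintegral_indicator measurableSet_Iio, Measure.restrict_restrict measurableSet_Iio,
      ← Measure.restrict_congr_set (Ico_ae_eq_Icc (a := (0 : ℝ)) (b := u))]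
    congr 2
    ext s; simp only [mem_Ico, mem_inter_iff, mem_Iio, mem_Icc]
    exact ⟨fun h => ⟨h.2, h.1, h.2.le.trans hu.2⟩, fun h => ⟨h.2.1, h.1⟩⟩
  rw [setLIntegral_congr_fun measurableSet_Icc h1, setLIntegral_congr_fun measurableSet_Icc h2]
  exact lintegral_lintegral_swap (hc.indicator hS).aemeasurable

lemma lintegral_Icc_split {s t : ℝ} (hs : s ∈ Icc 0 t) (f : ℝ → ℝ≥0∞) :
    ∫⁻ u in Icc 0 t, f u = (∫⁻ u in Icc 0 s, f u) + ∫⁻ u in Ioc s t, f u := by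
  rw [← Icc_union_Ioc_eq_Icc hs.1 hs.2]
  refine lintegral_union measurableSet_Ioc ?_
  rw [disjoint_left]
  exact fun u hu hu' => not_lt.2 hu.2 hu'.1

section PoissonFamily

variable {P : Type*} [DecidableEq P]

/-- Adding a point to one of the configurations. -/
def insertAt (p : P) (s : ℝ) (ω : P → Points) : P → Points :=
  Function.update ω p (insertPoint s (ω p))

lemma measurable_insertAt (p : P) : Measurable fun q : ℝ × (P → Points) => insertAt p q.1 q.2 := by
  have h1 : Measurable fun q : ℝ × (P → Points) => (q.2, insertPoint q.1 (q.2 p)) :=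
    measurable_snd.prodMk (measurable_insertPoint.comp
      (f := fun q : ℝ × (P → Points) => (q.1, q.2 p)) (by fun_prop))
  exact measurable_update'.comp h1

lemma measurable_lmarginal_poissonRaw {α : Type*} [MeasurableSpace α] (lam : ℝ≥0) (A : Finset P)
    {τ : α → ℝ} (hτ : Measurable τ) {f : α × (P → Points) → ℝ≥0∞} (hf : Measurable f) :
    Measurable fun q : α × (P → Points) =>
      (∫⋯∫⁻_A, (fun ω => f (q.1, ω)) ∂fun _ : P => poissonRaw lam (τ q.1)) q.2 := by
  induction A using Finset.induction_on with
  | empty => simpa using hf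
  | insert p A hp ih =>
    have hm : ∀ a, Measurable fun ω => f (a, ω) := fun a => hf.comp measurable_prodMk_left
    simp only [fun q : α × (P → Points) => lmarginal_insert
      (μ := fun _ : P => poissonRaw lam (τ q.1)) _ (hm q.1) hp q.2]
    have h1 : Measurable fun r : (α × (P → Points)) × Points =>
        (r.1.1, Function.update r.1.2 p r.2) :=
      (measurable_fst.comp measurable_fst).prodMk (measurable_update'.comp
        (f := fun r : (α × (P → Points)) × Points => (r.1.2, r.2)) (by fun_prop))
    exact measurable_lintegral_poissonRaw lam (hτ.comp measurable_fst) (ih.comp h1)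

/-- Decomposition according to the last point of the processes indexed by `A`, by induction on `A`.
When an index `p` is added, let `s` be the last point of `p`. The points of `A` either all come
before `s`, or have a last point `u` in `(s, t]`; in the second case, integrating over `s` first
(`lintegral_triangle`) recomposes the process of index `p` on `[0, u]`. -/
lemma lintegral_lmarginal_last (lam : ℝ≥0) (A : Finset P) :
    ∀ {h : (P → Points) → ℝ≥0∞}, Measurable h →
      (∀ p ω, InsertInvariant fun y => h (Function.update ω p y)) → ∀ t ω,
      (∫⋯∫⁻_A, h ∂fun _ : P => poissonRaw lam t) ω =
        h (fun p => if p ∈ A then noPoint else ω p) +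
        ∫⁻ s in Icc 0 t, lam * ∑ p ∈ A,
          (∫⋯∫⁻_A, (fun ω => h (insertAt p s ω)) ∂fun _ : P => poissonRaw lam s) ω := by
  induction A using Finset.induction_on with
  | empty => intro h hh hi t ω; simp
  | insert p A hp ih =>
    intro h hh hi t ω
    -- the conditional expectation given the configuration of the index `p`
    obtain ⟨g, g_def⟩ : ∃ g : ℝ → Points → ℝ≥0∞, ∀ t y, g t y =
      (∫⋯∫⁻_A, h ∂fun _ : P => poissonRaw lam t) (Function.update ω p y) := ⟨_, fun _ _ => rfl⟩
    obtain ⟨K, K_def⟩ : ∃ K : ℝ → Points → ℝ≥0∞, ∀ s y, K s y = lam * ∑ p' ∈ A,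
      (∫⋯∫⁻_A, (fun ω => h (insertAt p' s ω)) ∂fun _ : P => poissonRaw lam s)
        (Function.update ω p y) := ⟨_, fun _ _ => rfl⟩
    have hupd : Measurable fun y : Points => Function.update ω p y := measurable_update _
    have hgm : Measurable fun q : ℝ × Points => g q.1 q.2 := by
      have := measurable_lmarginal_poissonRaw lam A (measurable_id (α := ℝ))
        (f := fun q => h q.2) (hh.comp measurable_snd)
      simp only [g_def]
      exact this.comp (f := fun q : ℝ × Points => (q.1, Function.update ω p q.2))
        (measurable_fst.prodMk (hupd.comp measurable_snd))
    have hmarg : ∀ p', Measurable fun q : ℝ × (P → Points) =>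
        (∫⋯∫⁻_A, (fun ω => h (insertAt p' q.1 ω)) ∂fun _ : P => poissonRaw lam q.1) q.2 :=
      fun p' => measurable_lmarginal_poissonRaw lam A (measurable_id (α := ℝ))
        (f := fun q => h (insertAt p' q.1 q.2)) (hh.comp (measurable_insertAt p'))
    have hKm : Measurable fun q : ℝ × Points => K q.1 q.2 := by
      simp only [K_def]
      refine Measurable.const_mul (Finset.measurable_sum _ fun p' _ => ?_) _
      exact (hmarg p').comp (f := fun q : ℝ × Points => (q.1, Function.update ω p q.2))
        (measurable_fst.prodMk (hupd.comp measurable_snd))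
    have hgi : ∀ t, InsertInvariant (g t) := fun t n i s y => by
      rw [g_def, g_def, lmarginal_update_of_notMem hh hp, lmarginal_update_of_notMem hh hp]
      exact congrArg (fun f => (∫⋯∫⁻_A, f ∂fun _ : P => poissonRaw lam t) ω)
        (funext fun ω' => hi p ω' n i s y)
    have hKi : ∀ s, InsertInvariant (K s) := fun u n i s y => by
      rw [K_def, K_def]
      refine congrArg (fun x => (lam : ℝ≥0∞) * x) (Finset.sum_congr rfl fun p' hp' => ?_)
      have hpp : p' ≠ p := fun e => hp (e ▸ hp')
      have hm' : Measurable fun ω => h (insertAt p' u ω) :=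
        hh.comp ((measurable_insertAt p').comp (measurable_prodMk_left (x := u)))
      rw [lmarginal_update_of_notMem hm' hp, lmarginal_update_of_notMem hm' hp]
      refine congrArg (fun f => (∫⋯∫⁻_A, f ∂fun _ : P => poissonRaw lam u) ω)
        (funext fun ω' => ?_)
      have e : ∀ y, insertAt p' u (Function.update ω' p y) =
          Function.update (insertAt p' u ω') p y := fun y => by
        unfold insertAt
        rw [Function.update_of_ne hpp, Function.update_comm hpp.symm]
      simp only [Function.comp_apply, e]
      exact hi p _ n i s y
    have hclear : ∀ y, (fun p' => if p' ∈ A then noPoint else Function.update ω p y p') =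
        Function.update (fun p' => if p' ∈ A then noPoint else ω p') p y := fun y => by
      funext p'
      by_cases e : p' = p
      · subst e; simp [hp]
      · simp [Function.update_of_ne e]
    have hg : ∀ t y, g t y = h (Function.update (fun p' => if p' ∈ A then noPoint else ω p') p y) +
        ∫⁻ s in Icc 0 t, K s y := fun t y => by
      rw [← hclear, g_def, ih hh hi t (Function.update ω p y)]
      simp only [K_def]
    have hgs : ∀ s ∈ Icc 0 t, ∀ y, g t y = g s y + ∫⁻ u in Ioc s t, K u y := fun s hs y => by
      rw [hg t y, hg s y, lintegral_Icc_split hs, add_assoc]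
    have hins : ∀ s : ℝ, Measurable fun y => insertPoint s y := fun s =>
      measurable_insertPoint.comp measurable_prodMk_left
    have e0 : (∫⋯∫⁻_insert p A, h ∂fun _ : P => poissonRaw lam t) ω =
        ∫⁻ y, g t y ∂poissonRaw lam t := by
      simp only [g_def]
      exact lmarginal_insert _ hh hp ω
    have e1 : (fun p' => if p' ∈ insert p A then noPoint else ω p') =
        Function.update (fun p' => if p' ∈ A then noPoint else ω p') p noPoint := by
      funext p'
      by_cases e : p' = p
      · subst e; simp
      · simp [e]
    have hgt : Measurable (g t) := hgm.comp (measurable_prodMk_left (x := t))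
    rw [e0, e1, lintegral_poissonRaw_last lam t hgt (hgi t), hg t noPoint, add_assoc]
    congr 1
    have hA : Measurable fun s : ℝ => ∫⁻ y, g s (insertPoint s y) ∂poissonRaw lam s :=
      measurable_lintegral_poissonRaw lam measurable_id
        (f := fun q : ℝ × Points => g q.1 (insertPoint q.1 q.2))
        (hgm.comp (measurable_fst.prodMk measurable_insertPoint))
    have hB : Measurable fun q : ℝ × ℝ =>
        ∫⁻ y, K q.2 (insertPoint q.1 y) ∂poissonRaw lam q.1 :=
      measurable_lintegral_poissonRaw lam measurable_fst
        (f := fun r : (ℝ × ℝ) × Points => K r.1.2 (insertPoint r.1.1 r.2))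
        (hKm.comp ((measurable_snd.comp measurable_fst).prodMk (measurable_insertPoint.comp
          ((measurable_fst.comp measurable_fst).prodMk measurable_snd))))
    have e2 : ∫⁻ s in Icc 0 t, lam * ∫⁻ y, g t (insertPoint s y) ∂poissonRaw lam s =
        (∫⁻ s in Icc 0 t, lam * ∫⁻ y, g s (insertPoint s y) ∂poissonRaw lam s) +
        ∫⁻ u in Icc 0 t, ∫⁻ s in Icc 0 u,
          lam * ∫⁻ y, K u (insertPoint s y) ∂poissonRaw lam s := by
      rw [← lintegral_triangle (t := t)
        (c := fun q => lam * ∫⁻ y, K q.2 (insertPoint q.1 y) ∂poissonRaw lam q.1)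
        (hB.const_mul _), ← lintegral_add_left (hA.const_mul _)]
      refine setLIntegral_congr_fun measurableSet_Icc fun s hs => ?_
      have hKs : Measurable fun q : Points × ℝ => K q.2 (insertPoint s q.1) :=
        hKm.comp (measurable_snd.prodMk ((hins s).comp measurable_fst))
      have hgs' : Measurable fun y => g s (insertPoint s y) :=
        (hgm.comp (measurable_prodMk_left (x := s))).comp (hins s)
      have hBs : Measurable fun u => ∫⁻ y, K u (insertPoint s y) ∂poissonRaw lam s :=
        measurable_lintegral_poissonRaw lam measurable_const
          (f := fun r : ℝ × Points => K r.1 (insertPoint s r.2))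
          (hKm.comp (measurable_fst.prodMk ((hins s).comp measurable_snd)))
      simp only [hgs s hs]
      rw [lintegral_add_left hgs', mul_add, lintegral_lintegral_swap hKs.aemeasurable,
        lintegral_const_mul _ hBs]
    have e3 : ∀ u, K u noPoint + ∫⁻ s in Icc 0 u,
        lam * ∫⁻ y, K u (insertPoint s y) ∂poissonRaw lam s = ∫⁻ y, K u y ∂poissonRaw lam u :=
      fun u => (lintegral_poissonRaw_last lam u
        (hKm.comp (measurable_prodMk_left (x := u))) (hKi u)).symm
    have hK0 : Measurable fun u => K u noPoint := hKm.comp (measurable_id.prodMk measurable_const)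
    rw [e2, add_left_comm, ← lintegral_add_left hK0]
    simp only [e3]
    rw [← lintegral_add_left (hA.const_mul _)]
    refine lintegral_congr fun s => ?_
    rw [Finset.sum_insert hp, mul_add]
    congr 1
    · have hm' : Measurable fun ω => h (insertAt p s ω) :=
        hh.comp ((measurable_insertAt p).comp (measurable_prodMk_left (x := s)))
      rw [lmarginal_insert _ hm' hp]
      congr 1
      refine lintegral_congr fun y => ?_
      rw [g_def, lmarginal_update_of_notMem hh hp, lmarginal_update_of_notMem hm' hp]
      refine congrArg (fun f => (∫⋯∫⁻_A, f ∂fun _ : P => poissonRaw lam s) ω)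
        (funext fun ω' => ?_)
      simp [insertAt]
    · have hm' : ∀ p', Measurable fun ω => h (insertAt p' s ω) := fun p' =>
        hh.comp ((measurable_insertAt p').comp (measurable_prodMk_left (x := s)))
      simp only [fun p' => lmarginal_insert (μ := fun _ : P => poissonRaw lam s) _ (hm' p') hp ω]
      have hmm : ∀ p', Measurable fun y =>
          (∫⋯∫⁻_A, (fun ω => h (insertAt p' s ω)) ∂fun _ : P => poissonRaw lam s)
            (Function.update ω p y) := fun p' =>
        (hmarg p').comp (f := fun y => (s, Function.update ω p y))
          (measurable_const.prodMk hupd)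
      rw [← lintegral_finsetSum _ fun p' _ => hmm p',
        ← lintegral_const_mul _ (Finset.measurable_sum _ fun p' _ => hmm p')]
      simp only [K_def]

variable [Fintype P]

/-- Decomposition of a finite family of independent Poisson processes according to their last
point. -/
lemma lintegral_pi_poissonRaw_last (lam : ℝ≥0) {h : (P → Points) → ℝ≥0∞} (hh : Measurable h)
    (hi : ∀ p ω, InsertInvariant fun y => h (Function.update ω p y)) (t : ℝ) :
    ∫⁻ ω, h ω ∂(Measure.pi fun _ : P => poissonRaw lam t) = h (fun _ => noPoint) +
      ∫⁻ s in Icc 0 t, lam * ∑ p,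
        ∫⁻ ω, h (insertAt p s ω) ∂(Measure.pi fun _ : P => poissonRaw lam s) := by
  have := lintegral_lmarginal_last lam Finset.univ hh hi t fun _ => noPoint
  simpa using this

end PoissonFamily

lemma pi_poissonProcess {P : Type*} [Fintype P] (lam : ℝ≥0) (T : ℝ≥0) :
    (Measure.pi fun _ : P => poissonProcess lam T) =
      ENNReal.ofReal (Real.exp (-(lam * T))) ^ Fintype.card P •
        Measure.pi fun _ : P => poissonRaw lam T := by
  have hfin : IsFiniteMeasure (poissonProcess lam T) := by
    refine ⟨?_⟩
    rw [poissonProcess_eq, Measure.smul_apply, smul_eq_mul]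
    exact ENNReal.mul_lt_top ENNReal.ofReal_lt_top (measure_lt_top _ _)
  refine Measure.pi_eq fun B hB => ?_
  rw [Measure.smul_apply, Measure.pi_pi, smul_eq_mul]
  simp only [poissonProcess_eq, Measure.smul_apply, smul_eq_mul, Finset.prod_mul_distrib,
    Finset.prod_const, Finset.card_univ]

/-! ### The last interaction of the particle system -/

section Forward

variable {N : ℕ}

/-- The interactions, ordered by the pairs of particles. -/
def interactionsByPair (ω : Pair N → Points) : List (Interaction N) :=
  (Finset.univ : Finset (Pair N)).toList.flatMap fun p =>
    List.ofFn fun m => (((ω p).2 m).toNNReal, p.1.1, p.1.2)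

lemma interactions_eq (ω : Pair N → Points) :
    interactions ω = (interactionsByPair ω).insertionSort fun a b => a.1 ≤ b.1 := rfl

instance [NeZero N] : Nonempty (Interaction N) := ⟨(0, 0, 0)⟩

lemma measurable_interactions [NeZero N] :
    Measurable (interactions : (Pair N → Points) → List (Interaction N)) := by
  have h1 : Measurable (interactionsByPair : (Pair N → Points) → List (Interaction N)) := by
    unfold interactionsByPair
    induction (Finset.univ : Finset (Pair N)).toList with
    | nil => simp
    | cons p l ih =>
      simp only [List.flatMap_cons]
      refine Measurable.list_append ?_ ih
      have h2 : Measurable fun y : Points =>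
          (List.ofFn fun m => ((y.2 m).toNNReal, p.1.1, p.1.2) : List (Interaction N)) :=
        measurable_points_iff.2 fun n => (measurable_ofFn n).comp
          (measurable_pi_lambda _ fun i => (by fun_prop :
            Measurable fun y : Fin n → ℝ => ((y i).toNNReal, p.1.1, p.1.2)))
      exact h2.comp (measurable_pi_apply p)
  have h2 : MeasurableSet {p : Interaction N × Interaction N | p.1.1 ≤ p.2.1} :=
    measurableSet_le (by fun_prop) (by fun_prop)
  exact (measurable_insertionSort _ h2).comp h1

/-- Chronological lists of interactions at distinct times. -/
abbrev StrictlySorted (l : List (Interaction N)) : Prop := l.Pairwise fun a b => a.1 < b.1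

lemma StrictlySorted.eq_of_perm {l l' : List (Interaction N)} (h : StrictlySorted l)
    (h' : StrictlySorted l') (hp : l.Perm l') : l = l' :=
  hp.eq_of_pairwise (fun _ _ _ _ h1 h2 => absurd h1 (not_lt.2 h2.le)) h h'

lemma strictlySorted_insertionSort {l : List (Interaction N)} (h : (l.map Prod.fst).Nodup) :
    StrictlySorted (l.insertionSort fun a b => a.1 ≤ b.1) := by
  have h1 : (l.insertionSort fun a b => a.1 ≤ b.1).Pairwise fun a b => a.1 ≤ b.1 := by
    have : Std.Total fun a b : Interaction N => a.1 ≤ b.1 := ⟨fun a b => le_total a.1 b.1⟩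
    have : IsTrans (Interaction N) fun a b => a.1 ≤ b.1 := ⟨fun a b c => le_trans⟩
    exact List.pairwise_insertionSort _ _
  have h2 : ((l.insertionSort fun a b => a.1 ≤ b.1).map Prod.fst).Nodup :=
    ((List.perm_insertionSort _ l).map _).nodup_iff.2 h
  rw [List.Nodup, List.pairwise_map] at h2
  exact (h1.and h2).imp fun h => lt_of_le_of_ne h.1 h.2

lemma StrictlySorted.nodup {l : List (Interaction N)} (h : StrictlySorted l) :
    (l.map Prod.fst).Nodup := by
  rw [List.Nodup, List.pairwise_map]
  exact h.imp fun h => h.ne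

lemma ofFn_insertNth_perm {α : Type*} (n : ℕ) (i : Fin (n + 1)) (f : ℝ → α) (s : ℝ)
    (y : Fin n → ℝ) :
    (List.ofFn fun m => f ((i.insertNth s y : Fin (n + 1) → ℝ) m)).Perm
      (f s :: List.ofFn fun m => f (y m)) := by
  rw [← Multiset.coe_eq_coe, ← Multiset.cons_coe, ← Fin.univ_val_map, ← Fin.univ_val_map,
    Fin.univ_succAbove n i, Finset.cons_val, Multiset.map_cons, Finset.map_val,
    Multiset.map_map]
  simp only [Fin.insertNth_apply_same, Multiset.cons_inj_right]
  exact Multiset.map_congr rfl fun m _ => by simp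

lemma interactionsByPair_insertAt (p : Pair N) (s : ℝ) (ω : Pair N → Points) :
    (interactionsByPair (insertAt p s ω)).Perm
      ((s.toNNReal, p.1.1, p.1.2) :: interactionsByPair ω) := by
  classical
  unfold interactionsByPair
  have hp : (Finset.univ : Finset (Pair N)).toList.Perm
      (p :: (Finset.univ.erase p : Finset (Pair N)).toList) := by
    have := Finset.toList_insert (Finset.notMem_erase p Finset.univ)
    rwa [Finset.insert_erase (Finset.mem_univ p)] at this
  refine (hp.flatMap_right _).trans (List.Perm.trans ?_
    ((hp.flatMap_right fun p => List.ofFn fun m =>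
      (((ω p).2 m).toNNReal, p.1.1, p.1.2)).symm.cons _))
  rw [List.flatMap_cons, List.flatMap_cons]
  have h1 : ((Finset.univ.erase p : Finset (Pair N)).toList.flatMap fun p' =>
      List.ofFn fun m => (((insertAt p s ω p').2 m).toNNReal, p'.1.1, p'.1.2)) =
      (Finset.univ.erase p : Finset (Pair N)).toList.flatMap fun p' =>
        List.ofFn fun m => (((ω p').2 m).toNNReal, p'.1.1, p'.1.2) := by
    refine List.flatMap_congr fun p' hp' => ?_
    have : p' ≠ p := by
      rw [Finset.mem_toList] at hp'
      exact (Finset.mem_erase.1 hp').1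
    unfold insertAt
    rw [Function.update_of_ne this]
  rw [h1, ← List.cons_append]
  refine List.Perm.append_right _ ?_
  unfold insertAt
  rw [Function.update_self]
  simp [insertPoint, List.ofFn_succ]

lemma interactionsByPair_insertNth (p : Pair N) (ω : Pair N → Points) (n : ℕ) (i : Fin (n + 1))
    (s : ℝ) (y : Fin n → ℝ) :
    (interactionsByPair (Function.update ω p ⟨n + 1, i.insertNth s y⟩)).Perm
      (interactionsByPair (Function.update ω p ⟨n + 1, Fin.cons s y⟩)) := by
  classical
  unfold interactionsByPair
  refine List.Perm.flatMap_left _ fun p' _ => ?_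
  by_cases h : p' = p
  · subst h
    rw [Function.update_self, Function.update_self]
    refine (ofFn_insertNth_perm n i (fun u => (u.toNNReal, p'.1.1, p'.1.2)) s y).trans ?_
    simp [List.ofFn_succ]
  · rw [Function.update_of_ne h, Function.update_of_ne h]

lemma ae_poissonRaw {lam t : ℝ} {p : Points → Prop} (hp : MeasurableSet {ω | p ω})
    (h : ∀ n, ∀ᵐ y ∂cube t n, p ⟨n, y⟩) : ∀ᵐ ω ∂poissonRaw lam t, p ω := by
  have hc : MeasurableSet {ω | ¬ p ω} := hp.compl
  rw [ae_iff, ← lintegral_indicator_one hc,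
    lintegral_poissonRaw _ _ (measurable_one.indicator hc)]
  refine ENNReal.tsum_eq_zero.2 fun n => ?_
  rw [mul_eq_zero]
  right
  rw [← lintegral_zero (μ := cube t n)]
  refine lintegral_congr_ae ?_
  filter_upwards [h n] with y hy
  exact indicator_of_notMem (fun hc : (⟨n, y⟩ : Points) ∈ {ω | ¬ p ω} => hc hy) _

lemma measurableSet_points {p : Points → Prop}
    (h : ∀ n, MeasurableSet {y : Fin n → ℝ | p ⟨n, y⟩}) : MeasurableSet {ω | p ω} :=
  MeasurableSpace.measurableSet_iInf.2 fun n => h n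

lemma ae_poissonRaw_ne (lam t a : ℝ) : ∀ᵐ ω ∂poissonRaw lam t, ∀ i, ω.2 i ≠ a := by
  refine ae_poissonRaw (measurableSet_points fun n => ?_) fun n => ?_
  · have : {y : Fin n → ℝ | ∀ i, y i ≠ a} = ⋂ i, {y | y i = a}ᶜ := by ext; simp
    rw [this]
    exact MeasurableSet.iInter fun i =>
      (measurableSet_eq_fun (measurable_pi_apply i) measurable_const).compl
  · exact ae_all_iff.2 fun i => ae_cube_ne t n i a

lemma ae_poissonRaw_mem (lam t : ℝ) : ∀ᵐ ω ∂poissonRaw lam t, ∀ i, ω.2 i ∈ Icc 0 t := by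
  refine ae_poissonRaw (measurableSet_points fun n => ?_) fun n => ae_cube_mem t n
  have : {y : Fin n → ℝ | ∀ i, y i ∈ Icc 0 t} = ⋂ i, (fun y => y i) ⁻¹' Icc 0 t := by ext; simp
  rw [this]
  exact MeasurableSet.iInter fun i => measurable_pi_apply i measurableSet_Icc

lemma ae_poissonRaw_injective (lam t : ℝ) : ∀ᵐ ω ∂poissonRaw lam t, Function.Injective ω.2 := by
  refine ae_poissonRaw (measurableSet_points fun n => ?_) fun n => ae_cube_injective t n
  have : {y : Fin n → ℝ | Function.Injective y} =
      ⋂ i, ⋂ k, {y | y i = y k}ᶜ ∪ {_y | i = k} := by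
    ext y
    simp only [mem_ofPred_eq, mem_iInter, mem_union, mem_compl_iff, Function.Injective]
    exact forall_congr' fun i => forall_congr' fun k => by tauto
  rw [this]
  exact MeasurableSet.iInter fun i => MeasurableSet.iInter fun k =>
    (measurableSet_eq_fun (measurable_pi_apply i) (measurable_pi_apply k)).compl.union
      (MeasurableSet.const _)

variable (N) in
/-- The jump times of the pairs of particles, up to a normalising factor. -/
abbrev pairsRaw (lam : ℝ) (t : ℝ) : Measure (Pair N → Points) :=
  Measure.pi fun _ => poissonRaw lam t

lemma ae_pairsRaw_of_ae (lam : ℝ≥0) {t : ℝ} {q : Points → Prop}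
    (h : ∀ᵐ ω ∂poissonRaw lam t, q ω) (p : Pair N) : ∀ᵐ ω ∂pairsRaw N lam t, q (ω p) :=
  (Measure.quasiMeasurePreserving_eval (fun _ : Pair N => poissonRaw lam t) p).ae h

lemma ae_pairsRaw_ne (lam : ℝ≥0) (t : ℝ) {p p' : Pair N} (hp : p ≠ p') :
    ∀ᵐ ω ∂pairsRaw N lam t, ∀ i k, (ω p).2 i ≠ (ω p').2 k := by
  have hm : MeasurableSet {q : Points × Points | ∀ i k, q.2.2 i ≠ q.1.2 k} := by
    have h0 : MeasurableSet {q : Points × Points | ∃ i k, q.2.2 i = q.1.2 k} := by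
      have key : Measurable fun q : Points × Points =>
          (open Classical in if ∃ i k, q.2.2 i = q.1.2 k then (1 : ℝ) else 0) := by
        refine measurable_prod_points fun n => ?_
        refine (measurable_prod_points (h := fun q : (Fin n → ℝ) × Points =>
          (open Classical in if ∃ i k, q.1 i = q.2.2 k then (1 : ℝ) else 0)) fun m => ?_).comp
          (f := fun q : Points × (Fin n → ℝ) => (q.2, q.1)) (by fun_prop)
        classical
        refine Measurable.ite ?_ measurable_const measurable_const
        have : {q : (Fin n → ℝ) × (Fin m → ℝ) | ∃ i k, q.1 i = q.2 k} =
            ⋃ i, ⋃ k, {q | q.1 i = q.2 k} := by ext; simp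
        rw [this]
        exact MeasurableSet.iUnion fun i => MeasurableSet.iUnion fun k =>
          measurableSet_eq_fun (by fun_prop) (by fun_prop)
      have : {q : Points × Points | ∃ i k, q.2.2 i = q.1.2 k} =
          (fun q : Points × Points =>
            (open Classical in if ∃ i k, q.2.2 i = q.1.2 k then (1 : ℝ) else 0)) ⁻¹' {1} := by
        ext q
        by_cases hq : ∃ i k, q.2.2 i = q.1.2 k
        · exact iff_of_true hq (if_pos hq)
        · exact iff_of_false hq fun h => zero_ne_one ((if_neg hq).symm.trans h)
      rw [this]
      exact key (measurableSet_singleton 1)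
    convert h0.compl using 1
    ext q; simp
  let S : Set (Pair N → Points) := {ω | ¬ ∀ i k, (ω p).2 i ≠ (ω p').2 k}
  have hS : MeasurableSet S := by
    have : Measurable fun ω : Pair N → Points => (ω p', ω p) := by fun_prop
    exact (this hm).compl
  rw [ae_iff, ← lintegral_indicator_one hS]
  have h1 : ∫⁻ ω, S.indicator 1 ω ∂pairsRaw N lam t =
      (∫⋯∫⁻_Finset.univ, S.indicator 1 ∂fun _ : Pair N => poissonRaw lam t) fun _ => noPoint := by
    rw [lmarginal_univ]
  rw [h1, lmarginal_erase' _ (measurable_one.indicator hS) (Finset.mem_univ p)]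
  have h2 : (fun ω => ∫⁻ y, S.indicator (1 : (Pair N → Points) → ℝ≥0∞) (Function.update ω p y)
      ∂poissonRaw lam t) = 0 := by
    funext ω
    rw [Pi.zero_apply, ← lintegral_zero (μ := poissonRaw lam t)]
    refine lintegral_congr_ae ?_
    have : ∀ᵐ y ∂poissonRaw lam t, ∀ k i, y.2 i ≠ (ω p').2 k :=
      ae_all_iff.2 fun k => ae_poissonRaw_ne lam t _
    filter_upwards [this] with y hy
    refine indicator_of_notMem (fun hc : Function.update ω p y ∈ S => hc ?_) _
    rw [Function.update_self, Function.update_of_ne hp.symm]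
    exact fun i k => hy k i
  rw [h2]
  simp [lmarginal]

/-- Almost surely, the interactions take place at distinct times before the end. -/
lemma ae_interactions (lam : ℝ≥0) (t : ℝ) : ∀ᵐ ω ∂pairsRaw N lam t,
    StrictlySorted (interactions ω) ∧ ∀ e ∈ interactions ω, e.1 < t.toNNReal := by
  have h1 : ∀ᵐ ω ∂pairsRaw N lam t, ∀ p : Pair N, ∀ i, (ω p).2 i ∈ Icc 0 t :=
    ae_all_iff.2 fun p => ae_pairsRaw_of_ae lam (ae_poissonRaw_mem lam t) p
  have h2 : ∀ᵐ ω ∂pairsRaw N lam t, ∀ p : Pair N, ∀ i, (ω p).2 i ≠ t :=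
    ae_all_iff.2 fun p => ae_pairsRaw_of_ae lam (ae_poissonRaw_ne lam t t) p
  have h3 : ∀ᵐ ω ∂pairsRaw N lam t, ∀ p : Pair N, Function.Injective (ω p).2 :=
    ae_all_iff.2 fun p => ae_pairsRaw_of_ae lam (ae_poissonRaw_injective lam t) p
  have h4 : ∀ᵐ ω ∂pairsRaw N lam t, ∀ p p' : Pair N, p ≠ p' →
      ∀ i k, (ω p).2 i ≠ (ω p').2 k := by
    simp only [ae_all_iff (ι := Pair N)]
    intro p p'
    by_cases hp : p = p'
    · exact Eventually.of_forall fun ω h => absurd hp h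
    · filter_upwards [ae_pairsRaw_ne lam t hp] with ω hω _ using hω
  filter_upwards [h1, h2, h3, h4] with ω h1 h2 h3 h4
  constructor
  · rw [interactions_eq]
    refine strictlySorted_insertionSort ?_
    rw [interactionsByPair, List.map_flatMap, List.nodup_flatMap]
    constructor
    · intro p _
      rw [List.map_ofFn, List.nodup_ofFn]
      intro i k hik
      exact h3 p ((Real.toNNReal_eq_toNNReal_iff (h1 p i).1 (h1 p k).1).1 hik)
    · refine (Finset.nodup_toList _).imp fun {p p'} hpp => ?_
      rw [Function.onFun, List.disjoint_left]
      intro a ha ha'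
      rw [List.map_ofFn, List.mem_ofFn] at ha ha'
      obtain ⟨i, rfl⟩ := ha
      obtain ⟨k, hk⟩ := ha'
      exact h4 p' p (Ne.symm hpp) k i
        ((Real.toNNReal_eq_toNNReal_iff (h1 p' k).1 (h1 p i).1).1 hk)
  · intro e he
    rw [interactions_eq, List.mem_insertionSort, interactionsByPair, List.mem_flatMap] at he
    obtain ⟨p, -, he⟩ := he
    rw [List.mem_ofFn] at he
    obtain ⟨i, rfl⟩ := he
    have hlt : (ω p).2 i < t := lt_of_le_of_ne (h1 p i).2 (h2 p i)
    exact (Real.toNNReal_lt_toNNReal_iff ((h1 p i).1.trans_lt hlt)).2 hlt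

/-- Decomposition of the particle system according to its last interaction. -/
lemma lintegral_interactions_last [NeZero N] (lam : ℝ≥0) (t : ℝ)
    {g : List (Interaction N) → ℝ≥0∞} (hg : Measurable g) :
    ∫⁻ ω, g (interactions ω) ∂pairsRaw N lam t = g [] +
      ∫⁻ s in Icc 0 t, lam * ∑ p : Pair N, ∫⁻ ω,
        g (interactions ω ++ [(s.toNNReal, p.1.1, p.1.2)]) ∂pairsRaw N lam s := by
  classical
  -- a version of `g` which does not see the order in which the points of a process are listed
  let D : Set (List (Interaction N)) := {l | (l.map Prod.fst).Nodup}
  have hD : MeasurableSet D := by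
    have : D = (fun l : List (Interaction N) => l.map Prod.fst) ⁻¹' {l | l.Nodup} := rfl
    rw [this]
    refine measurable_list_map measurable_fst (MeasurableSpace.measurableSet_iInf.2 fun n => ?_)
    change MeasurableSet {y : Fin n → ℝ≥0 | (List.ofFn y).Nodup}
    have : {y : Fin n → ℝ≥0 | (List.ofFn y).Nodup} =
        ⋂ i, ⋂ k, {y | y i = y k}ᶜ ∪ {_y | i = k} := by
      ext y
      simp only [mem_ofPred_eq, mem_iInter, mem_union, mem_compl_iff, List.nodup_ofFn,
        Function.Injective]
      exact forall_congr' fun i => forall_congr' fun k => by tauto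
    rw [this]
    exact MeasurableSet.iInter fun i => MeasurableSet.iInter fun k =>
      (measurableSet_eq_fun (measurable_pi_apply i) (measurable_pi_apply k)).compl.union
        (MeasurableSet.const _)
  let h : (Pair N → Points) → ℝ≥0∞ := fun ω => D.indicator g (interactions ω)
  have hh : Measurable h := (hg.indicator hD).comp measurable_interactions
  have hmem : ∀ ω, interactions ω ∈ D ↔ ((interactionsByPair ω).map Prod.fst).Nodup := fun ω =>
    ((List.perm_insertionSort _ (interactionsByPair ω)).map _).nodup_iff
  have hinv : ∀ p ω, InsertInvariant fun y => h (Function.update ω p y) := by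
    intro p ω n i s y
    have hperm := interactionsByPair_insertNth p ω n i s y
    have hiff := ((hperm.map Prod.fst).nodup_iff)
    by_cases hc : ((interactionsByPair
        (Function.update ω p ⟨n + 1, Fin.cons s y⟩)).map Prod.fst).Nodup
    · have e : interactions (Function.update ω p ⟨n + 1, i.insertNth s y⟩) =
          interactions (Function.update ω p ⟨n + 1, Fin.cons s y⟩) := by
        refine (strictlySorted_insertionSort (hiff.2 hc)).eq_of_perm
          (strictlySorted_insertionSort hc) ?_
        exact (List.perm_insertionSort _ _).trans (hperm.trans (List.perm_insertionSort _ _).symm)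
      simp only [h, e]
    · simp only [h]
      rw [indicator_of_notMem (fun hm => hc ((hmem _).1 hm)),
        indicator_of_notMem (fun hm => hc (hiff.1 ((hmem _).1 hm)))]
  have h1 : ∫⁻ ω, g (interactions ω) ∂pairsRaw N lam t = ∫⁻ ω, h ω ∂pairsRaw N lam t := by
    refine lintegral_congr_ae ?_
    filter_upwards [ae_interactions lam t] with ω hω
    exact (indicator_of_mem (show interactions ω ∈ D from hω.1.nodup) g).symm
  have h0 : h (fun _ => noPoint) = g [] := by
    have : interactions (fun _ : Pair N => noPoint) = [] := by
      rw [interactions_eq]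
      have : interactionsByPair (fun _ : Pair N => noPoint) = [] := by
        rw [interactionsByPair, List.flatMap_eq_nil_iff]
        intro p _
        exact List.ofFn_zero
      rw [this]; rfl
    simp only [h, this]
    exact indicator_of_mem (show [] ∈ D by simp [D]) g
  rw [h1, lintegral_pi_poissonRaw_last lam hh hinv t, h0]
  congr 1
  refine setLIntegral_congr_fun measurableSet_Icc fun s hs => ?_
  congr 1
  refine Finset.sum_congr rfl fun p _ => lintegral_congr_ae ?_
  filter_upwards [ae_interactions lam s] with ω hω
  have hsort : StrictlySorted (interactions ω ++ [(s.toNNReal, p.1.1, p.1.2)]) := by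
    rw [StrictlySorted, List.pairwise_append]
    refine ⟨hω.1, by simp, fun a ha b hb => ?_⟩
    rw [List.mem_singleton] at hb
    rw [hb]
    exact hω.2 a ha
  have hperm : (interactionsByPair (insertAt p s ω)).Perm
      (interactions ω ++ [(s.toNNReal, p.1.1, p.1.2)]) :=
    (interactionsByPair_insertAt p s ω).trans
      (((List.perm_insertionSort _ _).symm.cons _).trans (List.perm_append_singleton _ _).symm)
  have hnd : ((interactionsByPair (insertAt p s ω)).map Prod.fst).Nodup :=
    ((hperm.map _).nodup_iff).2 hsort.nodup
  have e : interactions (insertAt p s ω) = interactions ω ++ [(s.toNNReal, p.1.1, p.1.2)] :=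
    (strictlySorted_insertionSort hnd).eq_of_perm hsort
      ((List.perm_insertionSort _ _).trans hperm)
  simp only [h]
  rw [indicator_of_mem ((hmem _).2 hnd), e]

end Forward

/-! ### The integral equation of the particle system -/

section ForwardEquation

variable {N : ℕ}

/-- The rate at which the explored set `C` interacts, if all the pairs of particles interact at rate
`2 c`. -/
def exploreRate (c : ℝ≥0) (C : Finset (Fin N)) : ℝ≥0 :=
  c * (2 * (C.card * Cᶜ.card : ℕ) + (C.card * (C.card - 1) : ℕ))

/-- The generator of the exploration, all the pairs of particles interacting at rate `2 c` (so that
the ordered pairs do at rate `c`), applied to a function of the remaining time, the explored set,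
the list of the interactions found so far and the number of loops. In the last term the state
does not change: it makes the total rate equal to `R`. -/
def exploreGen (R c : ℝ≥0)
    (y : ℝ → Finset (Fin N) → List (Interaction N) → ℕ → ℝ≥0∞)
    (s : ℝ) (C : Finset (Fin N)) (es : List (Interaction N)) (k : ℕ) : ℝ≥0∞ :=
  c * (2 * ∑ i ∈ C, ∑ j ∈ Cᶜ, y s (insert j C) ((s.toNNReal, i, j) :: es) k +
    ∑ i ∈ C, ∑ j ∈ C.erase i, y s C ((s.toNNReal, i, j) :: es) (k + 1)) +
    (R - exploreRate c C : ℝ≥0) * y s C es k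

lemma sum_erase_const (C : Finset (Fin N)) (a : ℝ≥0∞) :
    ∑ i ∈ C, ∑ _j ∈ C.erase i, a = (C.card * (C.card - 1) : ℕ) * a := by
  rw [Finset.sum_congr rfl fun i hi => by
    rw [Finset.sum_const, Finset.card_erase_of_mem hi], Finset.sum_const, smul_smul, nsmul_eq_mul]

lemma exploreRate_add (c : ℝ≥0) (C : Finset (Fin N)) :
    exploreRate c C + c * (Cᶜ.card * (Cᶜ.card - 1) : ℕ) = c * (N * (N - 1) : ℕ) := by
  have h : C.card + Cᶜ.card = N := by simp
  rw [exploreRate, ← mul_add]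
  congr 1
  norm_cast
  generalize C.card = a at h
  generalize Cᶜ.card = b at h
  subst h
  rcases a with - | a
  · simp
  rcases b with - | b
  · simp
  have e : a + 1 + (b + 1) - 1 = a + b + 1 := by omega
  rw [e, Nat.add_sub_cancel, Nat.add_sub_cancel]
  ring

lemma exploreRate_le (c : ℝ≥0) (C : Finset (Fin N)) :
    exploreRate c C ≤ c * (N * (N - 1) : ℕ) := by
  rw [← exploreRate_add c C]
  exact le_self_add

/-- The ordered pairs of distinct particles, sorted according to the number of their elements in
`C`. -/
lemma sum_offDiag_eq {g : Fin N → Fin N → ℝ≥0∞} (hg : ∀ i j, i ≠ j → g i j = g j i)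
    (C : Finset (Fin N)) :
    ∑ i, ∑ j ∈ Finset.univ.erase i, g i j = 2 * ∑ i ∈ C, ∑ j ∈ Cᶜ, g i j +
      ∑ i ∈ C, ∑ j ∈ C.erase i, g i j + ∑ i ∈ Cᶜ, ∑ j ∈ Cᶜ.erase i, g i j := by
  have h1 : ∀ i ∈ C, ∑ j ∈ Finset.univ.erase i, g i j =
      ∑ j ∈ Cᶜ, g i j + ∑ j ∈ C.erase i, g i j := fun i hi => by
    rw [← Finset.sum_union]
    · refine Finset.sum_congr ?_ fun _ _ => rfl
      ext j
      simp only [Finset.mem_erase, Finset.mem_union, Finset.mem_compl, Finset.mem_univ, and_true]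
      by_cases hj : j ∈ C
      · simp [hj]
      · simp only [hj, not_false_eq_true, and_false, or_false, iff_true]
        exact fun h => hj (h ▸ hi)
    · rw [Finset.disjoint_left]
      exact fun j hj hj' => Finset.mem_compl.1 hj (Finset.mem_of_mem_erase hj')
  have h2 : ∀ i ∈ Cᶜ, ∑ j ∈ Finset.univ.erase i, g i j =
      ∑ j ∈ C, g i j + ∑ j ∈ Cᶜ.erase i, g i j := fun i hi => by
    rw [← Finset.sum_union]
    · refine Finset.sum_congr ?_ fun _ _ => rfl
      ext j
      simp only [Finset.mem_erase, Finset.mem_union, Finset.mem_compl, Finset.mem_univ, and_true]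
      by_cases hj : j ∈ C
      · simp only [hj, not_true_eq_false, and_false, or_false, iff_true]
        exact fun h => Finset.mem_compl.1 hi (h ▸ hj)
      · simp [hj]
    · rw [Finset.disjoint_left]
      exact fun j hj hj' => Finset.mem_compl.1 (Finset.mem_of_mem_erase hj') hj
  have h3 : ∑ i ∈ Cᶜ, ∑ j ∈ C, g i j = ∑ i ∈ C, ∑ j ∈ Cᶜ, g i j := by
    rw [Finset.sum_comm]
    refine Finset.sum_congr rfl fun i hi => Finset.sum_congr rfl fun j hj => hg j i ?_
    exact fun h => Finset.mem_compl.1 hj (h ▸ hi)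
  rw [← Finset.sum_add_sum_compl C, Finset.sum_congr rfl h1, Finset.sum_congr rfl h2,
    Finset.sum_add_distrib, Finset.sum_add_distrib, h3]
  ring

/-- A symmetric function is summed over the unordered pairs, renamed by `τ`, by summing it over the
ordered pairs. -/
lemma two_mul_sum_pair {g : Fin N → Fin N → ℝ≥0∞} (hg : ∀ i j, i ≠ j → g i j = g j i)
    (τ : Equiv.Perm (Fin N)) :
    2 * ∑ p : Pair N, g (τ p.1.1) (τ p.1.2) = ∑ i, ∑ j ∈ Finset.univ.erase i, g i j := by
  have h1 : ∀ h : Fin N → Fin N → ℝ≥0∞, ∑ p : Pair N, h p.1.1 p.1.2 =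
      ∑ i, ∑ j, if i < j then h i j else 0 := fun h => by
    rw [← Fintype.sum_prod_type' (f := fun i j => if i < j then h i j else 0),
      ← Finset.sum_filter]
    exact (Finset.sum_subtype _ (by simp) fun p : Fin N × Fin N => h p.1 p.2).symm
  have h2 : ∑ i, ∑ j ∈ Finset.univ.erase i, g i j =
      ∑ i, ∑ j, if i = j then 0 else g i j := by
    refine Finset.sum_congr rfl fun i _ => ?_
    rw [← Finset.sum_erase Finset.univ (a := i) (f := fun j => if i = j then 0 else g i j)
      (by simp)]
    exact Finset.sum_congr rfl fun j hj => (if_neg (Finset.ne_of_mem_erase hj).symm).symm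
  have h3 : ∑ i, ∑ j, (if i = j then 0 else g i j) =
      ∑ i, ∑ j, if i = j then 0 else g (τ i) (τ j) := by
    rw [← Equiv.sum_comp τ]
    refine Finset.sum_congr rfl fun i _ => ?_
    rw [← Equiv.sum_comp τ]
    exact Finset.sum_congr rfl fun j _ => by simp
  have h4 : ∀ i j, (if i = j then 0 else g (τ i) (τ j)) =
      (if i < j then g (τ i) (τ j) else 0) + if j < i then g (τ j) (τ i) else 0 := fun i j => by
    rcases lt_trichotomy i j with h | h | h
    · simp [h, h.ne, h.not_gt]
    · simp [h]
    · rw [hg _ _ (τ.injective.ne h.ne)]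
      simp [h, h.ne', h.not_gt]
  rw [h2, h3]
  simp only [h4, Finset.sum_add_distrib]
  rw [Finset.sum_comm (f := fun i j => if j < i then g (τ j) (τ i) else 0),
    h1 fun i j => g (τ i) (τ j), two_mul]

/-- The invariant of the exploration when the remaining time is `t`: the explored set consists of
the ancestors of `C₀`, and the interactions already found are in chronological order, after `t`. -/
def Explored (C₀ : Finset (Fin N)) (t : ℝ) (C : Finset (Fin N)) (es : List (Interaction N)) :
    Prop :=
  C = ancestors C₀ es ∧ StrictlySorted es ∧ ∀ e ∈ es, t.toNNReal ≤ e.1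

lemma Explored.mono {C₀ C : Finset (Fin N)} {s t : ℝ} {es : List (Interaction N)}
    (h : Explored C₀ t C es) (hst : s ≤ t) : Explored C₀ s C es :=
  ⟨h.1, h.2.1, fun e he => (Real.toNNReal_le_toNNReal hst).trans (h.2.2 e he)⟩

lemma Explored.cons {C₀ C : Finset (Fin N)} {s t : ℝ} {es : List (Interaction N)}
    (h : Explored C₀ t C es) (hs : 0 ≤ s) (hst : s < t) {i j : Fin N} (hi : i ∈ C) :
    Explored C₀ s (insert j C) ((s.toNNReal, i, j) :: es) := by
  have hlt : s.toNNReal < t.toNNReal := (Real.toNNReal_lt_toNNReal_iff (hs.trans_lt hst)).2 hst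
  refine ⟨?_, List.pairwise_cons.2 ⟨fun e he => hlt.trans_le (h.2.2 e he), h.2.1⟩,
    fun e he => ?_⟩
  · rw [ancestors, ← h.1, if_pos (Or.inl hi), Finset.insert_comm, Finset.insert_eq_of_mem hi]
  · rcases List.mem_cons.1 he with rfl | he
    · exact le_rfl
    · exact hlt.le.trans (h.2.2 e he)

lemma strictlySorted_map_relabel_append {σ : Equiv.Perm (Fin N)} {s : ℝ}
    {l es : List (Interaction N)} (hl : StrictlySorted l) (hls : ∀ e ∈ l, e.1 < s.toNNReal)
    (hes : StrictlySorted es) (hse : ∀ e ∈ es, s.toNNReal ≤ e.1) :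
    StrictlySorted (l.map (relabel σ) ++ es) := by
  rw [StrictlySorted, List.pairwise_append, List.pairwise_map]
  refine ⟨hl, hes, fun a ha b hb => ?_⟩
  obtain ⟨e, he, rfl⟩ := List.mem_map.1 ha
  exact (hls e he).trans_le (hse b hb)

/-- The expectation, up to a normalising factor, of `f` at the list of the interactions of the
particle system during a time `t`, relabelled by `σ` and followed by `es`. -/
def forwardValue (lam : ℝ≥0) (f : List (Interaction N) → ℝ≥0∞) (σ : Equiv.Perm (Fin N)) (t : ℝ)
    (es : List (Interaction N)) : ℝ≥0∞ :=
  ∫⁻ ω, f ((interactions ω).map (relabel σ) ++ es) ∂pairsRaw N lam t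

/-- The particle system satisfies the integral equation of the exploration: by symmetry, an
interaction with one particle in the explored set may be written with this particle first, and the
interactions out of the explored set are discarded. -/
lemma forwardValue_eq [NeZero N] {c : ℝ≥0} {f : List (Interaction N) → ℝ≥0∞} (hf : Measurable f)
    {C₀ : Finset (Fin N)}
    (hswap : ∀ (t : ℝ≥0) (i j : Fin N) (l es : List (Interaction N)), i ≠ j →
      f (l ++ (t, i, j) :: es) = f (l ++ (t, j, i) :: es))
    (hprune : ∀ (t : ℝ≥0) (i j : Fin N) (l es : List (Interaction N)), i ∉ ancestors C₀ es →
      j ∉ ancestors C₀ es → StrictlySorted (l ++ (t, i, j) :: es) →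
      f (l ++ (t, i, j) :: es) = f (l ++ es))
    (σ : Equiv.Perm (Fin N)) {t : ℝ} {C : Finset (Fin N)} {es : List (Interaction N)}
    (h : Explored C₀ t C es) (k : ℕ) :
    forwardValue (2 * c) f σ t es = f es +
      ∫⁻ s in Icc 0 t, exploreGen (c * (N * (N - 1) : ℕ)) c
        (fun s _ es _ => forwardValue (2 * c) f σ s es) s C es k := by
  have hm : Measurable fun l : List (Interaction N) => f (l.map (relabel σ) ++ es) := by
    have h1 : Measurable (relabel σ : Interaction N → Interaction N) := by
      unfold relabel; fun_prop
    exact hf.comp (Measurable.list_append (measurable_list_map h1) measurable_const)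
  have h0 := lintegral_interactions_last (2 * c) t hm
  simp only [List.map_nil, List.nil_append, List.map_append, List.map_cons, List.append_assoc,
    List.singleton_append] at h0
  unfold forwardValue
  rw [h0]
  congr 1
  -- the interactions take place at distinct times, as almost every `s` differs from `t`
  have hae : ∀ᵐ s : ℝ ∂volume.restrict (Icc 0 t), s ≠ t :=
    ae_restrict_of_ae (Measure.ae_ne volume t)
  refine lintegral_congr_ae ?_
  filter_upwards [hae, ae_restrict_mem measurableSet_Icc] with s hs hst
  have hlt : s < t := lt_of_le_of_ne hst.2 hs
  have hlt' : s.toNNReal < t.toNNReal :=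
    (Real.toNNReal_lt_toNNReal_iff (hst.1.trans_lt hlt)).2 hlt
  let g : Fin N → Fin N → ℝ≥0∞ := fun i j => ∫⁻ ω, f ((interactions ω).map (relabel σ) ++
    (s.toNNReal, i, j) :: es) ∂pairsRaw N ((2 * c : ℝ≥0) : ℝ) s
  have hg : ∀ i j, i ≠ j → g i j = g j i := fun i j hij =>
    lintegral_congr fun ω => hswap _ i j _ _ hij
  have key := (two_mul_sum_pair hg σ).trans (sum_offDiag_eq hg C)
  have e1 : ∀ p : Pair N, (relabel σ (s.toNNReal, p.1.1, p.1.2)) =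
      (s.toNNReal, σ p.1.1, σ p.1.2) := fun _ => rfl
  simp only [e1]
  rw [ENNReal.coe_mul, ENNReal.coe_ofNat, mul_comm (2 : ℝ≥0∞), mul_assoc, key, exploreGen]
  -- the pairs that do not meet `C` only contribute to the part of `exploreGen` without transition
  have hpr : ∀ i ∈ Cᶜ, ∀ j ∈ Cᶜ.erase i, g i j = forwardValue (2 * c) f σ s es := by
    intro i hi j hj
    refine lintegral_congr_ae ?_
    filter_upwards [ae_interactions (2 * c) s] with ω hω
    rw [h.1, Finset.mem_compl] at hi
    refine hprune _ i j _ _ hi ?_ ?_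
    · rw [← h.1]
      exact Finset.mem_compl.1 (Finset.mem_of_mem_erase hj)
    · refine strictlySorted_map_relabel_append hω.1 hω.2 (List.pairwise_cons.2
        ⟨fun e he => hlt'.trans_le (h.2.2 e he), h.2.1⟩) fun e he => ?_
      rcases List.mem_cons.1 he with rfl | he
      · exact le_rfl
      · exact hlt'.le.trans (h.2.2 e he)
  rw [Finset.sum_congr rfl fun i hi => Finset.sum_congr rfl (hpr i hi), sum_erase_const,
    tsub_eq_of_eq_add_rev (exploreRate_add c C).symm, mul_add, ENNReal.coe_mul,
    ENNReal.coe_natCast, mul_assoc]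
  rfl

end ForwardEquation

/-! ### Exponential clocks and uniform choices -/

section Noise

variable {N : ℕ}

lemma lintegral_uniformOn {α : Type*} [Fintype α] [MeasurableSpace α] [MeasurableSingletonClass α]
    (S : Finset α) (φ : α → ℝ≥0∞) :
    ∫⁻ x, φ x ∂uniformOn (S : Set α) = (S.card : ℝ≥0∞)⁻¹ * ∑ x ∈ S, φ x := by
  rw [uniformOn, ProbabilityTheory.cond, lintegral_smul_measure, Measure.count_apply_finset,
    smul_eq_mul, lintegral_finset]
  simp

lemma choiceLaw_eq_pi : choiceLaw N = Measure.pi fun S : Finset (Fin N) =>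
    uniformOn (((if S.Nonempty then S else Finset.univ : Finset (Fin N)) : Set (Fin N))) := by
  rw [← uniformOn_pi, choiceLaw]
  congr 1
  ext c
  simp only [choiceFunctions, mem_ofPred_eq, Set.mem_pi, mem_univ, true_implies, Finset.mem_coe]
  refine forall_congr' fun S => ?_
  by_cases h : S.Nonempty <;> simp [h]

/-- The value at `S` of a uniform choice function is uniform in `S`. -/
lemma lintegral_choiceLaw [NeZero N] {S : Finset (Fin N)} (hS : S.Nonempty) (φ : Fin N → ℝ≥0∞) :
    ∫⁻ c, φ (c S) ∂choiceLaw N = (S.card : ℝ≥0∞)⁻¹ * ∑ i ∈ S, φ i := by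
  have : ∀ S : Finset (Fin N), IsProbabilityMeasure
      (uniformOn (((if S.Nonempty then S else Finset.univ : Finset (Fin N)) : Set (Fin N)))) :=
    fun S => by
      refine isProbabilityMeasure_uniformOn (Set.toFinite _) ?_
      by_cases h : S.Nonempty
      · simp [h]
      · simp [h]
  rw [choiceLaw_eq_pi]
  have h := (measurePreserving_eval (fun S : Finset (Fin N) =>
    uniformOn (((if S.Nonempty then S else Finset.univ : Finset (Fin N)) : Set (Fin N)))) S)
  have e := h.lintegral_comp (f := φ) (measurable_of_finite φ)
  rw [if_pos hS, lintegral_uniformOn] at e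
  exact e

lemma lintegral_expMeasure {h : ℝ → ℝ≥0∞} (hh : Measurable h) :
    ∫⁻ x, h x ∂expMeasure 1 = ∫⁻ x in Ici 0, ENNReal.ofReal (Real.exp (-x)) * h x := by
  have e : expMeasure 1 = volume.withDensity (exponentialPDF 1) := rfl
  have hm : Measurable (exponentialPDF 1) := (measurable_exponentialPDFReal 1).ennreal_ofReal
  rw [e, lintegral_withDensity_eq_lintegral_mul _ hm hh, ← lintegral_indicator measurableSet_Ici]
  refine lintegral_congr fun x => ?_
  rw [Pi.mul_apply]
  by_cases hx : 0 ≤ x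
  · rw [indicator_of_mem (mem_Ici.2 hx), exponentialPDF_of_nonneg hx]; simp
  · rw [indicator_of_notMem (by simpa using hx), exponentialPDF_of_neg (not_le.1 hx), zero_mul]

lemma expMeasure_Ioi {x : ℝ} (hx : 0 ≤ x) :
    expMeasure 1 (Ioi x) = ENNReal.ofReal (Real.exp (-x)) := by
  have h := cdf_expMeasure_eq one_pos x
  rw [if_pos hx, one_mul] at h
  have h2 : expMeasure 1 (Iic x) = ENNReal.ofReal (1 - Real.exp (-x)) := by
    rw [← h, ProbabilityTheory.ofReal_cdf]
  rw [← compl_Iic, prob_compl_eq_one_sub measurableSet_Iic, h2, ← ENNReal.ofReal_one,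
    ← ENNReal.ofReal_sub _ (by simp [hx])]
  simp

lemma expMeasure_Iic_zero : expMeasure 1 (Iic 0) = 0 := by
  have h := expMeasure_Ioi le_rfl
  rw [neg_zero, Real.exp_zero, ENNReal.ofReal_one, ← compl_Iic,
    prob_compl_eq_one_iff measurableSet_Iic] at h
  exact h

lemma ae_expMeasure_pos : ∀ᵐ x ∂expMeasure 1, 0 < x := by
  rw [ae_iff]
  simp only [not_lt]
  exact expMeasure_Iic_zero

lemma ae_expMeasure_ne (a : ℝ) : ∀ᵐ x ∂expMeasure 1, x ≠ a := by
  have : expMeasure 1 ≪ volume := withDensity_absolutelyContinuous _ _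
  exact this (Measure.ae_ne volume a)

/-- The law of the exponential time `U / ρ`, on `[0,t]`. -/
lemma lintegral_expMeasure_scaled {ρ t : ℝ} (hρ : 0 ≤ ρ) {g : ℝ → ℝ≥0∞} (hg : Measurable g) :
    ∫⁻ U, (if 0 < ρ ∧ U ≤ ρ * t then g (U / ρ) else 0) ∂expMeasure 1 =
      ∫⁻ r in Icc 0 t, ENNReal.ofReal (ρ * Real.exp (-(ρ * r))) * g r := by
  rcases hρ.eq_or_lt with rfl | hρ
  · simp
  have hm : Measurable fun U : ℝ => if 0 < ρ ∧ U ≤ ρ * t then g (U / ρ) else 0 := by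
    refine Measurable.ite ?_ (hg.comp (by fun_prop)) measurable_const
    simp only [hρ, true_and]
    exact measurableSet_Iic
  obtain ⟨G, hG⟩ : ∃ G : ℝ → ℝ≥0∞, ∀ x, G x = (Ici 0).indicator (fun x =>
      ENNReal.ofReal (Real.exp (-x)) * if 0 < ρ ∧ x ≤ ρ * t then g (x / ρ) else 0) x :=
    ⟨_, fun _ => rfl⟩
  have hGm : Measurable G := by
    rw [funext hG]
    exact (Measurable.mul (by fun_prop) hm).indicator measurableSet_Ici
  have hv : ∫⁻ x, G x = ENNReal.ofReal |ρ| * ∫⁻ r, G (ρ * r) := by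
    conv_lhs => rw [← Real.smul_map_volume_mul_left hρ.ne']
    rw [lintegral_smul_measure, lintegral_map hGm (by fun_prop), smul_eq_mul]
  rw [lintegral_expMeasure hm, ← lintegral_indicator measurableSet_Ici, ← funext hG, hv,
    ← lintegral_indicator measurableSet_Icc,
    ← lintegral_const_mul _ (f := fun r => G (ρ * r)) (hGm.comp (measurable_const_mul ρ))]
  · refine lintegral_congr fun r => ?_
    rw [hG]
    by_cases hr : r ∈ Icc 0 t
    · rw [indicator_of_mem hr, indicator_of_mem (mem_Ici.2 (mul_nonneg hρ.le hr.1)),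
        if_pos ⟨hρ, mul_le_mul_of_nonneg_left hr.2 hρ.le⟩, mul_div_cancel_left₀ _ hρ.ne',
        ← mul_assoc, ← ENNReal.ofReal_mul (abs_nonneg _), abs_of_pos hρ]
    · rw [indicator_of_notMem hr]
      by_cases hr0 : 0 ≤ r
      · have : ¬ r ≤ t := fun h => hr ⟨hr0, h⟩
        rw [indicator_of_mem (mem_Ici.2 (mul_nonneg hρ.le hr0)), if_neg, mul_zero, mul_zero]
        exact fun h => this (le_of_mul_le_mul_left h.2 hρ)
      · rw [indicator_of_notMem, mul_zero]
        rw [mem_Ici, not_le]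
        exact mul_neg_of_pos_of_neg hρ (not_le.1 hr0)

/-- Two competing exponential clocks: the first one rings at time `r ≤ t`, before the second. -/
lemma lintegral_first_clock {ρ₁ ρ₂ t : ℝ} (h₁ : 0 ≤ ρ₁) (h₂ : 0 ≤ ρ₂) {g : ℝ → ℝ≥0∞}
    (hg : Measurable g) :
    ∫⁻ U, ∫⁻ V, (if (0 < ρ₁ ∧ U ≤ ρ₁ * t) ∧ ρ₂ * (U / ρ₁) < V then g (U / ρ₁) else 0)
        ∂expMeasure 1 ∂expMeasure 1 =
      ∫⁻ r in Icc 0 t, ENNReal.ofReal (ρ₁ * Real.exp (-((ρ₁ + ρ₂) * r))) * g r := by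
  have h1 : ∀ᵐ U ∂expMeasure 1,
      ∫⁻ V, (if (0 < ρ₁ ∧ U ≤ ρ₁ * t) ∧ ρ₂ * (U / ρ₁) < V then g (U / ρ₁) else 0) ∂expMeasure 1 =
      if 0 < ρ₁ ∧ U ≤ ρ₁ * t then
        ENNReal.ofReal (Real.exp (-(ρ₂ * (U / ρ₁)))) * g (U / ρ₁) else 0 := by
    filter_upwards [ae_expMeasure_pos] with U hU
    by_cases h : 0 < ρ₁ ∧ U ≤ ρ₁ * t
    · simp only [h, true_and, and_true, if_true]
      rw [← expMeasure_Ioi (mul_nonneg h₂ (div_nonneg hU.le h.1.le)), mul_comm (expMeasure 1 _),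
        ← lintegral_indicator_const measurableSet_Ioi]
      exact lintegral_congr fun V => rfl
    · simp [h]
  rw [lintegral_congr_ae h1, lintegral_expMeasure_scaled h₁
    (g := fun r => ENNReal.ofReal (Real.exp (-(ρ₂ * r))) * g r) (by fun_prop)]
  refine lintegral_congr fun r => ?_
  rw [← mul_assoc, ← ENNReal.ofReal_mul (mul_nonneg h₁ (Real.exp_nonneg _)), mul_assoc,
    ← Real.exp_add]
  congr 4
  ring

/-- Neither of two independent exponential clocks has rung. -/
lemma lintegral_no_clock {a b : ℝ} (ha : 0 ≤ a) (hb : 0 ≤ b) (x : ℝ≥0∞) :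
    ∫⁻ U, ∫⁻ V, (if a < U ∧ b < V then x else 0) ∂expMeasure 1 ∂expMeasure 1 =
      ENNReal.ofReal (Real.exp (-(a + b))) * x := by
  have h1 : ∀ U, ∫⁻ V, (if a < U ∧ b < V then x else 0) ∂expMeasure 1 =
      (Ioi a).indicator (fun _ => x * ENNReal.ofReal (Real.exp (-b))) U := fun U => by
    by_cases h : a < U
    · rw [indicator_of_mem (mem_Ioi.2 h), ← expMeasure_Ioi hb,
        ← lintegral_indicator_const measurableSet_Ioi]
      simp only [h, true_and]
      exact lintegral_congr fun V => rfl
    · rw [indicator_of_notMem (by simpa using h)]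
      simp [h]
  simp only [h1]
  rw [lintegral_indicator_const measurableSet_Ioi, expMeasure_Ioi ha, mul_assoc,
    ← ENNReal.ofReal_mul (Real.exp_nonneg _), ← Real.exp_add, mul_comm]
  congr 4
  ring

end Noise

/-! ### The backward exploration as a measurable function of the noise -/

section Exploration

variable {N : ℕ}

lemma clock_top (T : ℝ≥0) (ρ U : ℝ) : clock T ⊤ ρ U = ⊤ := by
  simp [clock]

/-- The time at which a clock rings, when it is started at a finite time. If the rate vanishes, the
quotient is `0` by convention, which is the right value for `U ≤ 0`. -/
lemma clock_coe (T : ℝ≥0) {τ ρ U : ℝ} (hρ : 0 ≤ ρ) : clock T τ ρ U =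
    if τ ≤ T ∧ (U ≤ 0 ∨ 0 < ρ ∧ U ≤ ρ * (T - τ)) then ((τ + max U 0 / ρ : ℝ) : EReal) else ⊤ := by
  have key : {s : ℝ | ((τ : ℝ) : EReal) ≤ (s : EReal) ∧ s ≤ T ∧ U ≤ (s - (τ : EReal).toReal) * ρ} =
      if τ ≤ T ∧ (U ≤ 0 ∨ 0 < ρ ∧ U ≤ ρ * (T - τ)) then Icc (τ + max U 0 / ρ) T else ∅ := by
    ext s
    simp only [EReal.coe_le_coe_iff, EReal.toReal_coe, mem_ofPred_eq]
    rcases hρ.eq_or_lt with rfl | hρ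
    · simp only [mul_zero, lt_self_iff_false, false_and, or_false, div_zero, add_zero]
      by_cases h : τ ≤ T ∧ U ≤ 0
      · rw [if_pos h, mem_Icc]
        exact ⟨fun hs => ⟨hs.1, hs.2.1⟩, fun hs => ⟨hs.1, hs.2, h.2⟩⟩
      · rw [if_neg h]
        exact ⟨fun hs => h ⟨hs.1.trans hs.2.1, hs.2.2⟩, fun hs => hs.elim⟩
    · by_cases h : τ ≤ T ∧ (U ≤ 0 ∨ 0 < ρ ∧ U ≤ ρ * (T - τ))
      · rw [if_pos h, mem_Icc, ← le_sub_iff_add_le', div_le_iff₀ hρ, max_le_iff]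
        constructor
        · exact fun hs => ⟨⟨hs.2.2, mul_nonneg (sub_nonneg.2 hs.1) hρ.le⟩, hs.2.1⟩
        · exact fun hs => ⟨sub_nonneg.1 (nonneg_of_mul_nonneg_left hs.1.2 hρ), hs.2, hs.1.1⟩
      · rw [if_neg h]
        refine ⟨fun hs => h ⟨hs.1.trans hs.2.1, Or.inr ⟨hρ, hs.2.2.trans ?_⟩⟩, fun hs => hs.elim⟩
        rw [mul_comm]
        exact mul_le_mul_of_nonneg_left (sub_le_sub_right hs.2.1 _) hρ.le
  rw [clock, key]
  by_cases h : τ ≤ T ∧ (U ≤ 0 ∨ 0 < ρ ∧ U ≤ ρ * (T - τ))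
  · rw [if_pos h, if_pos h]
    have hle : τ + max U 0 / ρ ≤ T := by
      rcases h.2 with hU | ⟨hρ', hU⟩
      · rw [max_eq_right hU, zero_div, add_zero]; exact h.1
      · rw [← le_sub_iff_add_le', div_le_iff₀ hρ', max_le_iff, mul_comm]
        exact ⟨hU, mul_nonneg hρ (sub_nonneg.2 h.1)⟩
    refine IsLeast.csInf_eq ⟨⟨_, left_mem_Icc.2 hle, rfl⟩, ?_⟩
    rintro _ ⟨s, hs, rfl⟩
    exact EReal.coe_le_coe_iff.2 hs.1
  · rw [if_neg h, if_neg h, image_empty, sInf_empty]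

lemma measurable_clock (T : ℝ≥0) {ρ : ℝ} (hρ : 0 ≤ ρ) :
    Measurable fun p : EReal × ℝ => clock T p.1 ρ p.2 := by
  have e : (fun p : EReal × ℝ => clock T p.1 ρ p.2) = fun p =>
      if p.1 = ⊤ then ⊤ else if p.1 = ⊥ then clock T ⊥ ρ p.2 else
        if p.1.toReal ≤ (T : ℝ) ∧ (p.2 ≤ 0 ∨ 0 < ρ ∧ p.2 ≤ ρ * (T - p.1.toReal)) then
          ((p.1.toReal + max p.2 0 / ρ : ℝ) : EReal) else ⊤ := by
    funext ⟨τ, U⟩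
    induction τ with
    | bot => simp
    | coe τ =>
      rw [if_neg (EReal.coe_ne_top τ), if_neg (EReal.coe_ne_bot τ), clock_coe T hρ]
      exact if_congr Iff.rfl rfl rfl
    | top => simp [clock_top]
  rw [e]
  have h1 : Measurable fun p : EReal × ℝ => p.1.toReal := measurable_fst.ereal_toReal
  have hmono : Monotone fun U : ℝ => clock T ⊥ ρ U := fun U U' h => by
    refine sInf_le_sInf (image_mono ?_)
    exact fun s hs => ⟨hs.1, hs.2.1, h.trans hs.2.2⟩
  refine Measurable.ite (measurable_fst (measurableSet_singleton ⊤)) measurable_const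
    (Measurable.ite (measurable_fst (measurableSet_singleton ⊥))
      (hmono.measurable.comp measurable_snd) (Measurable.ite ?_ ?_ measurable_const))
  · refine (measurableSet_le h1 measurable_const).inter
      ((measurableSet_le measurable_snd measurable_const).union ?_)
    exact (MeasurableSet.const _).inter (measurableSet_le measurable_snd (by fun_prop))
  · exact measurable_coe_real_ereal.comp (by fun_prop)

namespace Stage

/-- The σ-algebra generated by the time and the explored set. -/
instance : MeasurableSpace (Stage N) :=
  MeasurableSpace.comap (fun σ => (σ.time, σ.active)) inferInstance

lemma measurable_prodMk_time_active : Measurable fun σ : Stage N => (σ.time, σ.active) :=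
  comap_measurable _

lemma measurable_time : Measurable (time : Stage N → EReal) :=
  measurable_fst.comp measurable_prodMk_time_active

lemma measurable_active : Measurable (active : Stage N → Finset (Fin N)) :=
  measurable_snd.comp measurable_prodMk_time_active

lemma measurable_of_time_active {γ : Type*} [MeasurableSpace γ] {f : γ → Stage N}
    (h1 : Measurable fun c => (f c).time) (h2 : Measurable fun c => (f c).active) :
    Measurable f :=
  measurable_comap_iff.2 (h1.prodMk h2)

lemma measurable_prod {β γ : Type*} [MeasurableSpace β] [MeasurableSpace γ]
    {h : Stage N × β → γ}
    (hh : ∀ C : Finset (Fin N), Measurable fun p : EReal × β => h (⟨p.1, C⟩, p.2)) :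
    Measurable h := by
  have h1 : Measurable fun p : Finset (Fin N) × (EReal × β) => h (⟨p.2.1, p.1⟩, p.2.2) :=
    measurable_from_prod_countable_right hh
  exact h1.comp ((measurable_active.comp measurable_fst).prodMk
    ((measurable_time.comp measurable_fst).prodMk measurable_snd))

/-- The rate of the births, when `K` particles are active. -/
def birthRate (N : ℕ) (lam : ℝ) (K : ℕ) : ℝ := lam * K * max ((N : ℝ) - K) 0 / (N - 1)

/-- The rate of the loops, when `K` particles are active. -/
def loopRate (N : ℕ) (lam : ℝ) (K : ℕ) : ℝ := lam * K * ((K : ℝ) - 1) / (2 * (N - 1))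

variable {lam : ℝ} {T : ℝ≥0}

lemma birthRate_nonneg (hN : 1 ≤ N) (hlam : 0 ≤ lam) (K : ℕ) : 0 ≤ birthRate N lam K := by
  have : (1 : ℝ) ≤ N := by exact_mod_cast hN
  exact div_nonneg (mul_nonneg (by positivity) (le_max_right _ _)) (by linarith)

lemma loopRate_nonneg (hN : 1 ≤ N) (hlam : 0 ≤ lam) (K : ℕ) : 0 ≤ loopRate N lam K := by
  have : (1 : ℝ) ≤ N := by exact_mod_cast hN
  refine div_nonneg ?_ (by linarith)
  rcases Nat.eq_zero_or_pos K with rfl | hK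
  · simp
  · have : (1 : ℝ) ≤ K := by exact_mod_cast hK
    exact mul_nonneg (by positivity) (by linarith)

lemma birthTime_eq (σ : Stage N) (ν : StepNoise N) :
    σ.birthTime lam T ν = clock T σ.time (birthRate N lam σ.active.card) ν.1 := rfl

lemma loopTime_eq (σ : Stage N) (ν : StepNoise N) :
    σ.loopTime lam T ν = clock T σ.time (loopRate N lam σ.active.card) ν.2.1 := rfl

variable (T) in
lemma measurable_birthTime (hN : 1 ≤ N) (hlam : 0 ≤ lam) :
    Measurable fun p : Stage N × StepNoise N => p.1.birthTime lam T p.2 :=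
  measurable_prod fun C => (measurable_clock T (birthRate_nonneg hN hlam C.card)).comp
    (f := fun p : EReal × StepNoise N => (p.1, p.2.1)) (by fun_prop)

variable (T) in
lemma measurable_loopTime (hN : 1 ≤ N) (hlam : 0 ≤ lam) :
    Measurable fun p : Stage N × StepNoise N => p.1.loopTime lam T p.2 :=
  measurable_prod fun C => (measurable_clock T (loopRate_nonneg hN hlam C.card)).comp
    (f := fun p : EReal × StepNoise N => (p.1, p.2.2.1)) (by fun_prop)

variable (T) in
lemma measurable_nextTime (hN : 1 ≤ N) (hlam : 0 ≤ lam) :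
    Measurable fun p : Stage N × StepNoise N => p.1.nextTime lam T p.2 :=
  (measurable_birthTime T hN hlam).min (measurable_loopTime T hN hlam)

lemma measurable_chosenR : Measurable fun p : Stage N × StepNoise N => p.1.chosenR p.2 :=
  measurable_prod fun C => (measurable_pi_apply C).comp
    (f := fun p : EReal × StepNoise N => p.2.2.2.1) (by fun_prop)

variable (T) in
lemma measurable_chosenJ (hN : 1 ≤ N) (hlam : 0 ≤ lam) :
    Measurable fun p : Stage N × StepNoise N => p.1.chosenJ lam T p.2 := by
  unfold chosenJ
  refine Measurable.ite (measurableSet_eq_fun (measurable_nextTime T hN hlam)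
    (measurable_birthTime T hN hlam)) ?_ ?_
  · exact measurable_prod fun C => (measurable_pi_apply Cᶜ).comp
      (f := fun p : EReal × StepNoise N => p.2.2.2.2) (by fun_prop)
  · refine measurable_prod fun C => ?_
    have h : Measurable fun c : (Finset (Fin N) → Fin N) × (Finset (Fin N) → Fin N) =>
        c.2 (C.erase (c.1 C)) := Measurable.of_discrete
    exact h.comp (f := fun p : EReal × StepNoise N => p.2.2.2) (by fun_prop)

variable (T) in
lemma measurable_next (hN : 1 ≤ N) (hlam : 0 ≤ lam) :
    Measurable fun p : Stage N × StepNoise N => p.1.next lam T p.2 := by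
  refine measurable_of_time_active (measurable_nextTime T hN hlam) ?_
  refine Measurable.ite ((measurableSet_lt (measurable_nextTime T hN hlam) measurable_const).inter
    (measurableSet_eq_fun (measurable_nextTime T hN hlam) (measurable_birthTime T hN hlam))) ?_
    (measurable_active.comp measurable_fst)
  have h : Measurable fun p : Fin N × Finset (Fin N) => insert p.1 p.2 := Measurable.of_discrete
  exact h.comp ((measurable_chosenJ T hN hlam).prodMk (measurable_active.comp measurable_fst))

end Stage

/-- The exploration started from an arbitrary state. -/
def stageFrom (lam : ℝ) (T : ℝ≥0) (σ : Stage N) (ω : ℕ → StepNoise N) : ℕ → Stage N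
  | 0 => σ
  | k + 1 => (stageFrom lam T σ ω k).next lam T (ω k)

/-- The interaction found at the step `k + 1`. -/
def interactionAt (lam : ℝ) (T : ℝ≥0) (σ : Stage N) (ω : ℕ → StepNoise N) (k : ℕ) :
    Interaction N :=
  (((T : ℝ) - (stageFrom lam T σ ω (k + 1)).time.toReal).toNNReal,
    (stageFrom lam T σ ω k).chosenR (ω k), (stageFrom lam T σ ω k).chosenJ lam T (ω k))

/-- The indices `k` such that the step `k + 1` takes place before the horizon `T`. -/
def stepsFrom (lam : ℝ) (T : ℝ≥0) (σ : Stage N) (ω : ℕ → StepNoise N) : Set ℕ :=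
  {k | (stageFrom lam T σ ω (k + 1)).time < ⊤}

/-- The indices `k` such that the step `k + 1` takes place before the horizon and finds a loop. -/
def loopStepsFrom (lam : ℝ) (T : ℝ≥0) (σ : Stage N) (ω : ℕ → StepNoise N) : Set ℕ :=
  {k | (stageFrom lam T σ ω (k + 1)).time < ⊤ ∧
    (stageFrom lam T σ ω (k + 1)).time = (stageFrom lam T σ ω k).loopTime lam T (ω k)}

/-- The chronological list of the interactions found by the exploration: that of the first step
comes last. It is empty on the null event that there are infinitely many steps. -/
def exploredList (lam : ℝ) (T : ℝ≥0) (σ : Stage N) (ω : ℕ → StepNoise N) :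
    List (Interaction N) :=
  (List.range (stepsFrom lam T σ ω).ncard).reverse.map (interactionAt lam T σ ω)

lemma stageFrom_init (lam : ℝ) (T : ℝ≥0) (q : ℕ) (ω : ℕ → StepNoise N) (k : ℕ) :
    stageFrom lam T ⟨0, firstParticles q N⟩ ω k = stage lam T q ω k := by
  induction k with
  | zero => rfl
  | succ k ih => rw [stageFrom, stage, ih]

lemma exploredList_init (lam : ℝ) (T : ℝ≥0) (q : ℕ) (ω : ℕ → StepNoise N) :
    exploredList lam T ⟨0, firstParticles q N⟩ ω = backwardInteractions lam T q ω := by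
  have h : interactionAt lam T ⟨0, firstParticles q N⟩ ω = fun k =>
      (((T : ℝ) - (stage lam T q ω (k + 1)).time.toReal).toNNReal,
        (stage lam T q ω k).chosenR (ω k), (stage lam T q ω k).chosenJ lam T (ω k)) := by
    funext k
    simp only [interactionAt, stageFrom_init]
  simp only [exploredList, backwardInteractions, stepsFrom, h, stageFrom_init]

lemma ncard_loopStepsFrom_init (lam : ℝ) (T : ℝ≥0) (q : ℕ) (ω : ℕ → StepNoise N) :
    (loopStepsFrom lam T ⟨0, firstParticles q N⟩ ω).ncard = loops lam T q ω := by
  simp only [loops, loopStepsFrom, stageFrom_init]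

/-- The cardinality of a random set of integers, equal to `0` if the set is infinite, is measurable.
-/
lemma measurable_ncard {γ : Type*} [MeasurableSpace γ] {A : ℕ → γ → Prop}
    (hA : ∀ k, MeasurableSet {c | A k c}) : Measurable fun c => {k | A k c}.ncard := by
  have h1 : ∀ c, (({k | A k c}.encard : ℕ∞) : ℝ≥0∞) = ∑' k, {c | A k c}.indicator 1 c := fun c => by
    rw [← ENNReal.tsum_set_one, tsum_subtype {k | A k c} fun _ => (1 : ℝ≥0∞)]
    rfl
  have h2 : ∀ c, {k | A k c}.ncard = (∑' k, {c | A k c}.indicator (1 : γ → ℝ≥0∞) c).toReal.toNNReal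
      := fun c => by
    rw [← h1]
    rcases {k | A k c}.finite_or_infinite with h | h
    · rw [← h.cast_ncard_eq]; simp
    · rw [h.ncard, h.encard_eq]; simp
  have h3 : Measurable fun c => ({k | A k c}.ncard : ℝ≥0) := by
    simp only [h2]
    exact (Measurable.tsum fun k => measurable_one.indicator (hA k)).ennreal_toReal.real_toNNReal
  refine measurable_to_countable' fun n => ?_
  have : (fun c => {k | A k c}.ncard) ⁻¹' {n} = (fun c => ({k | A k c}.ncard : ℝ≥0)) ⁻¹' {(n : ℝ≥0)}
      := by ext c; simp
  rw [this]
  exact h3 (measurableSet_singleton _)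

variable {lam : ℝ} (T : ℝ≥0)

lemma measurable_stageFrom (hN : 1 ≤ N) (hlam : 0 ≤ lam) (k : ℕ) :
    Measurable fun p : Stage N × (ℕ → StepNoise N) => stageFrom lam T p.1 p.2 k := by
  induction k with
  | zero => exact measurable_fst
  | succ k ih =>
    exact (Stage.measurable_next T hN hlam).comp
      (ih.prodMk ((measurable_pi_apply k).comp measurable_snd))

lemma measurable_interactionAt (hN : 1 ≤ N) (hlam : 0 ≤ lam) (k : ℕ) :
    Measurable fun p : Stage N × (ℕ → StepNoise N) => interactionAt lam T p.1 p.2 k := by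
  have h1 : Measurable fun p : Stage N × (ℕ → StepNoise N) =>
      (stageFrom lam T p.1 p.2 (k + 1)).time.toReal :=
    (Stage.measurable_time.comp (measurable_stageFrom T hN hlam (k + 1))).ereal_toReal
  have h2 : Measurable fun p : Stage N × (ℕ → StepNoise N) => (stageFrom lam T p.1 p.2 k, p.2 k) :=
    (measurable_stageFrom T hN hlam k).prodMk ((measurable_pi_apply k).comp measurable_snd)
  have h3 : Measurable fun p : Stage N × (ℕ → StepNoise N) =>
      (stageFrom lam T p.1 p.2 k).chosenR (p.2 k) := Stage.measurable_chosenR.comp h2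
  have h4 : Measurable fun p : Stage N × (ℕ → StepNoise N) =>
      (stageFrom lam T p.1 p.2 k).chosenJ lam T (p.2 k) := by
    obtain ⟨g, hg⟩ : ∃ g : Stage N × StepNoise N → Fin N, ∀ σ ν, g (σ, ν) = σ.chosenJ lam T ν :=
      ⟨fun p => p.1.chosenJ lam T p.2, fun _ _ => rfl⟩
    have hgm : Measurable g := by
      have : g = fun p => p.1.chosenJ lam T p.2 := funext fun p => hg p.1 p.2
      rw [this]
      exact Stage.measurable_chosenJ T hN hlam
    simp only [← hg]
    exact hgm.comp h2
  unfold interactionAt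
  exact Measurable.prodMk (by fun_prop) (h3.prodMk h4)

lemma measurableSet_mem_stepsFrom (hN : 1 ≤ N) (hlam : 0 ≤ lam) (k : ℕ) :
    MeasurableSet {p : Stage N × (ℕ → StepNoise N) | k ∈ stepsFrom lam T p.1 p.2} :=
  measurableSet_lt (Stage.measurable_time.comp (measurable_stageFrom T hN hlam (k + 1)))
    measurable_const

lemma measurable_ncard_loopStepsFrom (hN : 1 ≤ N) (hlam : 0 ≤ lam) :
    Measurable fun p : Stage N × (ℕ → StepNoise N) => (loopStepsFrom lam T p.1 p.2).ncard := by
  refine measurable_ncard (A := fun k (p : Stage N × (ℕ → StepNoise N)) =>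
    k ∈ loopStepsFrom lam T p.1 p.2) fun k => ?_
  have h1 : Measurable fun p : Stage N × (ℕ → StepNoise N) =>
      (stageFrom lam T p.1 p.2 (k + 1)).time :=
    Stage.measurable_time.comp (measurable_stageFrom T hN hlam (k + 1))
  have h2 : Measurable fun p : Stage N × (ℕ → StepNoise N) =>
      (stageFrom lam T p.1 p.2 k).loopTime lam T (p.2 k) :=
    (Stage.measurable_loopTime T hN hlam).comp
      (f := fun p : Stage N × (ℕ → StepNoise N) => (stageFrom lam T p.1 p.2 k, p.2 k))
      ((measurable_stageFrom T hN hlam k).prodMk ((measurable_pi_apply k).comp measurable_snd))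
  exact (measurableSet_lt h1 measurable_const).inter (measurableSet_eq_fun h1 h2)

lemma measurable_exploredList [NeZero N] (hN : 1 ≤ N) (hlam : 0 ≤ lam) :
    Measurable fun p : Stage N × (ℕ → StepNoise N) => exploredList lam T p.1 p.2 := by
  have h1 : ∀ L : List ℕ, Measurable fun e : ℕ → Interaction N => L.map e := fun L => by
    induction L with
    | nil => exact measurable_const
    | cons k L ih => exact Measurable.list_cons (measurable_pi_apply k) ih
  have h2 : Measurable fun p : ℕ × (ℕ → Interaction N) => (List.range p.1).reverse.map p.2 :=
    measurable_from_prod_countable_right fun n =>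
      h1 (List.range n).reverse
  exact h2.comp (f := fun p : Stage N × (ℕ → StepNoise N) =>
    ((stepsFrom lam T p.1 p.2).ncard, interactionAt lam T p.1 p.2))
    ((measurable_ncard (measurableSet_mem_stepsFrom T hN hlam)).prodMk
      (measurable_pi_lambda _ (measurable_interactionAt T hN hlam)))

end Exploration

/-! ### The first step of the exploration -/

section FirstStep

variable {N : ℕ}

/-- Adding a first term to a sequence. -/
def consSeq {α : Type*} (a : α) (ω : ℕ → α) : ℕ → α
  | 0 => a
  | k + 1 => ω k

lemma measurable_consSeq {α : Type*} [MeasurableSpace α] :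
    Measurable fun p : α × (ℕ → α) => consSeq p.1 p.2 := by
  refine measurable_pi_lambda _ fun k => ?_
  cases k with
  | zero => exact measurable_fst
  | succ k => exact (measurable_pi_apply k).comp measurable_snd

lemma infinitePi_eq_map_consSeq {α : Type*} [MeasurableSpace α] (μ : Measure α)
    [IsProbabilityMeasure μ] : Measure.infinitePi (fun _ : ℕ => μ) =
      (μ.prod (Measure.infinitePi fun _ : ℕ => μ)).map fun p => consSeq p.1 p.2 := by
  symm
  refine Measure.eq_infinitePi _ fun s t ht => ?_
  classical
  -- the constraint on the term of index `k`, if any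
  let b : ℕ → Set α := fun k => if k ∈ s then t k else univ
  have hb : ∀ k, MeasurableSet (b k) := fun k => by
    by_cases h : k ∈ s
    · simp only [b, h, if_true]; exact ht k
    · simp only [b, h, if_false]; exact MeasurableSet.univ
  obtain ⟨n, hn⟩ : ∃ n, s ⊆ Finset.range (n + 1) :=
    ⟨s.sup id, fun k hk => Finset.mem_range_succ_iff.2 (Finset.le_sup (f := id) hk)⟩
  have hset : (fun p : α × (ℕ → α) => consSeq p.1 p.2) ⁻¹' Set.pi s t =
      b 0 ×ˢ Set.pi (Finset.range n : Set ℕ) fun k => b (k + 1) := by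
    ext ⟨a, ω⟩
    simp only [mem_preimage, Set.mem_pi, mem_prod, Finset.mem_coe, b]
    constructor
    · intro h
      refine ⟨?_, fun k _ => ?_⟩
      · by_cases h0 : 0 ∈ s
        · rw [if_pos h0]; exact h 0 h0
        · rw [if_neg h0]; trivial
      · by_cases h0 : k + 1 ∈ s
        · rw [if_pos h0]; exact h (k + 1) h0
        · rw [if_neg h0]; trivial
    · rintro ⟨h0, h1⟩ k hk
      cases k with
      | zero => rw [if_pos hk] at h0; exact h0
      | succ k =>
        have := h1 k (Finset.mem_range.2 (Nat.succ_lt_succ_iff.1 (Finset.mem_range.1 (hn hk))))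
        rw [if_pos hk] at this
        exact this
  rw [Measure.map_apply measurable_consSeq (MeasurableSet.pi s.countable_toSet fun k _ => ht k),
    hset, Measure.prod_prod, Measure.infinitePi_pi _ fun k _ => hb (k + 1), mul_comm,
    ← Finset.prod_range_succ' fun k => μ (b k)]
  rw [← Finset.prod_subset hn (f := fun k => μ (b k))]
  · exact Finset.prod_congr rfl fun k hk => by simp only [b, hk, if_true]
  · intro k _ hk
    simp only [b, hk, if_false, measure_univ]

lemma lintegral_noiseLaw [NeZero N] {h : (ℕ → StepNoise N) → ℝ≥0∞} (hh : Measurable h) :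
    ∫⁻ ω, h ω ∂noiseLaw N = ∫⁻ ν, ∫⁻ ω, h (consSeq ν ω) ∂noiseLaw N ∂stepLaw N := by
  have : IsProbabilityMeasure (noiseLaw N) := by unfold noiseLaw; infer_instance
  have e : noiseLaw N = ((stepLaw N).prod (noiseLaw N)).map fun p => consSeq p.1 p.2 :=
    infinitePi_eq_map_consSeq (stepLaw N)
  conv_lhs => rw [e]
  have hm : Measurable fun p : StepNoise N × (ℕ → StepNoise N) => h (consSeq p.1 p.2) :=
    hh.comp measurable_consSeq
  rw [lintegral_map hh measurable_consSeq, lintegral_prod _ hm.aemeasurable]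

lemma lintegral_stepLaw [NeZero N] {h : StepNoise N → ℝ≥0∞} (hh : Measurable h) :
    ∫⁻ ν, h ν ∂stepLaw N = ∫⁻ U, ∫⁻ V, ∫⁻ c, ∫⁻ c', h (U, V, c, c') ∂choiceLaw N ∂choiceLaw N
      ∂expMeasure 1 ∂expMeasure 1 := by
  rw [stepLaw, lintegral_prod _ hh.aemeasurable]
  refine lintegral_congr fun U => ?_
  have h1 : Measurable fun y : ℝ × (Finset (Fin N) → Fin N) × (Finset (Fin N) → Fin N) =>
      h (U, y) := hh.comp measurable_prodMk_left
  rw [lintegral_prod _ h1.aemeasurable]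
  refine lintegral_congr fun V => ?_
  have h2 : Measurable fun y : (Finset (Fin N) → Fin N) × (Finset (Fin N) → Fin N) =>
      h (U, V, y) := h1.comp measurable_prodMk_left
  rw [lintegral_prod _ h2.aemeasurable]

/-- The mean of a function of the pair of particles chosen at a birth. -/
def birthMean (C : Finset (Fin N)) (g : Fin N → Fin N → ℝ≥0∞) : ℝ≥0∞ :=
  (C.card : ℝ≥0∞)⁻¹ * ∑ i ∈ C, (Cᶜ.card : ℝ≥0∞)⁻¹ * ∑ j ∈ Cᶜ, g i j

/-- The mean of a function of the pair of particles chosen at a loop. -/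
def loopMean (C : Finset (Fin N)) (g : Fin N → Fin N → ℝ≥0∞) : ℝ≥0∞ :=
  (C.card : ℝ≥0∞)⁻¹ * ∑ i ∈ C, ((C.erase i).card : ℝ≥0∞)⁻¹ * ∑ j ∈ C.erase i, g i j

variable {lam : ℝ} {T : ℝ≥0}

open Stage in
lemma birthRate_pos_iff (hN : 2 ≤ N) (hlam : 0 < lam) {C : Finset (Fin N)} (hC : C.Nonempty) :
    0 < birthRate N lam C.card ↔ Cᶜ.Nonempty := by
  have h2 : (2 : ℝ) ≤ N := by exact_mod_cast hN
  have h3 : (0 : ℝ) < C.card := by exact_mod_cast hC.card_pos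
  rw [← Finset.card_pos, Finset.card_compl, Fintype.card_fin, Nat.sub_pos_iff_lt, birthRate,
    div_pos_iff_of_pos_right (by linarith), mul_pos_iff_of_pos_left (by positivity), lt_max_iff,
    sub_pos, Nat.cast_lt]
  simp

open Stage in
lemma loopRate_pos_iff (hN : 2 ≤ N) (hlam : 0 < lam) {C : Finset (Fin N)} (hC : C.Nonempty) :
    0 < loopRate N lam C.card ↔ 1 < C.card := by
  have h2 : (2 : ℝ) ≤ N := by exact_mod_cast hN
  have h3 : (0 : ℝ) < C.card := by exact_mod_cast hC.card_pos
  rw [loopRate, div_pos_iff_of_pos_right (by linarith), mul_pos_iff_of_pos_left (by positivity),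
    sub_pos, Nat.one_lt_cast]

lemma measurable_birthMean {g : ℝ → Fin N → Fin N → ℝ≥0∞} (hg : ∀ i j, Measurable fun s => g s i j)
    (C : Finset (Fin N)) : Measurable fun s => birthMean C (g s) := by
  unfold birthMean
  exact (Finset.measurable_fun_sum _ fun i _ =>
    (Finset.measurable_fun_sum _ fun j _ => hg i j).const_mul _).const_mul _

lemma measurable_loopMean {g : ℝ → Fin N → Fin N → ℝ≥0∞} (hg : ∀ i j, Measurable fun s => g s i j)
    (C : Finset (Fin N)) : Measurable fun s => loopMean C (g s) := by
  unfold loopMean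
  exact (Finset.measurable_fun_sum _ fun i _ =>
    (Finset.measurable_fun_sum _ fun j _ => hg i j).const_mul _).const_mul _

lemma lintegral_birth_choice [NeZero N] {C : Finset (Fin N)} (hC : C.Nonempty)
    (hC' : Cᶜ.Nonempty) (g : Fin N → Fin N → ℝ≥0∞) :
    ∫⁻ c, ∫⁻ c', g (c C) (c' Cᶜ) ∂choiceLaw N ∂choiceLaw N = birthMean C g := by
  have h1 : ∀ c : Finset (Fin N) → Fin N, ∫⁻ c', g (c C) (c' Cᶜ) ∂choiceLaw N =
      (Cᶜ.card : ℝ≥0∞)⁻¹ * ∑ j ∈ Cᶜ, g (c C) j := fun c => lintegral_choiceLaw hC' _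
  simp only [h1]
  exact lintegral_choiceLaw hC fun i => (Cᶜ.card : ℝ≥0∞)⁻¹ * ∑ j ∈ Cᶜ, g i j

lemma lintegral_loop_choice [NeZero N] {C : Finset (Fin N)} (hC : 1 < C.card)
    (g : Fin N → Fin N → ℝ≥0∞) :
    ∫⁻ c, ∫⁻ c', g (c C) (c' (C.erase (c C))) ∂choiceLaw N ∂choiceLaw N = loopMean C g := by
  have hC0 : C.Nonempty := Finset.card_pos.1 (by omega)
  have h1 : ∀ c : Finset (Fin N) → Fin N, ∫⁻ c', g (c C) (c' (C.erase (c C))) ∂choiceLaw N =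
      ((C.erase (c C)).card : ℝ≥0∞)⁻¹ * ∑ j ∈ C.erase (c C), g (c C) j := fun c => by
    refine lintegral_choiceLaw (Finset.card_pos.1 ?_) (g (c C))
    have := Finset.pred_card_le_card_erase (s := C) (a := c C)
    omega
  simp only [h1]
  exact lintegral_choiceLaw hC0 fun i => ((C.erase i).card : ℝ≥0∞)⁻¹ * ∑ j ∈ C.erase i, g i j

/-- A clock with a positive threshold `U` rings before the horizon if and only if its rate `ρ` is
positive and `U` is at most `ρ` times the remaining time. -/
lemma clock_of_pos {τ ρ U : ℝ} (hρ : 0 ≤ ρ) (hτ : τ ≤ T) (hU : 0 < U) : clock T τ ρ U =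
    if 0 < ρ ∧ U ≤ ρ * (T - τ) then ((τ + U / ρ : ℝ) : EReal) else ⊤ := by
  rw [clock_coe T hρ, max_eq_left hU.le]
  refine if_congr ?_ rfl rfl
  simp [hτ, not_le.2 hU]

open Stage in
/-- Decomposition of an expectation according to the first step of the exploration. The remaining
time after a step that lasts `r` is `T - τ - r`; the value is `a` if no clock rings before the
horizon. -/
lemma lintegral_firstStep [NeZero N] (hN : 2 ≤ N) (hlam : 0 < lam) {τ : ℝ} (hτ : τ ≤ T)
    {C : Finset (Fin N)} (hC : C.Nonempty) (a : ℝ≥0∞) {G₁ G₂ : ℝ → Fin N → Fin N → ℝ≥0∞}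
    (hG₁ : ∀ i j, Measurable fun s => G₁ s i j) (hG₂ : ∀ i j, Measurable fun s => G₂ s i j)
    {H : StepNoise N → ℝ≥0∞} (hH : Measurable H)
    (h_end : ∀ ν, nextTime lam T ⟨τ, C⟩ ν = ⊤ → H ν = a)
    (h_birth : ∀ ν, nextTime lam T ⟨τ, C⟩ ν < ⊤ →
      birthTime lam T ⟨τ, C⟩ ν < loopTime lam T ⟨τ, C⟩ ν →
      H ν = G₁ (T - (nextTime lam T ⟨τ, C⟩ ν).toReal) (ν.2.2.1 C) (ν.2.2.2 Cᶜ))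
    (h_loop : ∀ ν, nextTime lam T ⟨τ, C⟩ ν < ⊤ →
      loopTime lam T ⟨τ, C⟩ ν < birthTime lam T ⟨τ, C⟩ ν →
      H ν = G₂ (T - (nextTime lam T ⟨τ, C⟩ ν).toReal) (ν.2.2.1 C)
        (ν.2.2.2 (C.erase (ν.2.2.1 C)))) :
    ∫⁻ ν, H ν ∂stepLaw N =
      ENNReal.ofReal
        (Real.exp (-((birthRate N lam C.card + loopRate N lam C.card) * (T - τ)))) * a +
      ∫⁻ r in Icc 0 (T - τ),
        ENNReal.ofReal (Real.exp (-((birthRate N lam C.card + loopRate N lam C.card) * r))) *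
          (ENNReal.ofReal (birthRate N lam C.card) * birthMean C (G₁ (T - τ - r)) +
            ENNReal.ofReal (loopRate N lam C.card) * loopMean C (G₂ (T - τ - r))) := by
  have hb : ∀ ν, birthTime lam T ⟨τ, C⟩ ν = clock T τ (birthRate N lam C.card) ν.1 :=
    fun ν => birthTime_eq _ ν
  have hl : ∀ ν, loopTime lam T ⟨τ, C⟩ ν = clock T τ (loopRate N lam C.card) ν.2.1 :=
    fun ν => loopTime_eq _ ν
  have hn : ∀ ν, nextTime lam T ⟨τ, C⟩ ν =
      min (birthTime lam T ⟨τ, C⟩ ν) (loopTime lam T ⟨τ, C⟩ ν) := fun ν => rfl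
  have hp₁ := birthRate_pos_iff hN hlam hC
  have hp₂ := loopRate_pos_iff hN hlam hC
  have h₁ : 0 ≤ birthRate N lam C.card := birthRate_nonneg (by omega) hlam.le _
  have h₂ : 0 ≤ loopRate N lam C.card := loopRate_nonneg (by omega) hlam.le _
  obtain ⟨t, ht⟩ : ∃ t : ℝ, t = T - τ := ⟨_, rfl⟩
  have ht0 : 0 ≤ t := by rw [ht]; exact sub_nonneg.2 hτ
  generalize birthRate N lam C.card = ρ₁ at *
  generalize loopRate N lam C.card = ρ₂ at *
  rw [← ht]
  have hsub : ∀ r : ℝ, (T : ℝ) - (τ + r) = t - r := fun r => by rw [ht]; ring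
  have hE₁ : ∀ {U : ℝ}, 0 < U → ¬ (0 < ρ₁ ∧ U ≤ ρ₁ * t) → ρ₁ * t < U := fun {U} hU h => by
    rcases h₁.eq_or_lt with h0 | h0
    · rw [← h0, zero_mul]; exact hU
    · exact not_le.1 fun hc => h ⟨h0, hc⟩
  have hE₂ : ∀ {V : ℝ}, 0 < V → ¬ (0 < ρ₂ ∧ V ≤ ρ₂ * t) → ρ₂ * t < V := fun {V} hV h => by
    rcases h₂.eq_or_lt with h0 | h0
    · rw [← h0, zero_mul]; exact hV
    · exact not_le.1 fun hc => h ⟨h0, hc⟩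
  -- the integral over the choices: a birth, a loop or no step, ties having probability zero
  have inner : ∀ᵐ U ∂expMeasure 1, ∀ᵐ V ∂expMeasure 1,
      ∫⁻ c, ∫⁻ c', H (U, V, c, c') ∂choiceLaw N ∂choiceLaw N =
        (if (0 < ρ₁ ∧ U ≤ ρ₁ * t) ∧ ρ₂ * (U / ρ₁) < V then birthMean C (G₁ (t - U / ρ₁)) else 0) +
        (if (0 < ρ₂ ∧ V ≤ ρ₂ * t) ∧ ρ₁ * (V / ρ₂) < U then loopMean C (G₂ (t - V / ρ₂)) else 0) +
        if ρ₁ * t < U ∧ ρ₂ * t < V then a else 0 := by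
    filter_upwards [ae_expMeasure_pos] with U hU
    filter_upwards [ae_expMeasure_pos, ae_expMeasure_ne (ρ₂ * (U / ρ₁))] with V hV hUV
    have hb' : ∀ c c', birthTime lam T ⟨τ, C⟩ (U, V, c, c') =
        if 0 < ρ₁ ∧ U ≤ ρ₁ * t then ((τ + U / ρ₁ : ℝ) : EReal) else ⊤ := fun c c' => by
      rw [hb, clock_of_pos h₁ hτ hU, ht]
    have hl' : ∀ c c', loopTime lam T ⟨τ, C⟩ (U, V, c, c') =
        if 0 < ρ₂ ∧ V ≤ ρ₂ * t then ((τ + V / ρ₂ : ℝ) : EReal) else ⊤ := fun c c' => by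
      rw [hl, clock_of_pos h₂ hτ hV, ht]
    have case_birth : 0 < ρ₁ ∧ U ≤ ρ₁ * t →
        (∀ c c', birthTime lam T ⟨τ, C⟩ (U, V, c, c') < loopTime lam T ⟨τ, C⟩ (U, V, c, c')) →
        ∫⁻ c, ∫⁻ c', H (U, V, c, c') ∂choiceLaw N ∂choiceLaw N =
          birthMean C (G₁ (t - U / ρ₁)) := fun hE hlt => by
      rw [← lintegral_birth_choice hC (hp₁.1 hE.1)]
      refine lintegral_congr fun c => lintegral_congr fun c' => ?_
      have e : nextTime lam T ⟨τ, C⟩ (U, V, c, c') = ((τ + U / ρ₁ : ℝ) : EReal) := by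
        rw [hn, min_eq_left (hlt c c').le, hb', if_pos hE]
      rw [h_birth _ (by rw [e]; exact EReal.coe_lt_top _) (hlt c c'), e, EReal.toReal_coe, hsub]
    have case_loop : 0 < ρ₂ ∧ V ≤ ρ₂ * t →
        (∀ c c', loopTime lam T ⟨τ, C⟩ (U, V, c, c') < birthTime lam T ⟨τ, C⟩ (U, V, c, c')) →
        ∫⁻ c, ∫⁻ c', H (U, V, c, c') ∂choiceLaw N ∂choiceLaw N =
          loopMean C (G₂ (t - V / ρ₂)) := fun hE hlt => by
      rw [← lintegral_loop_choice (hp₂.1 hE.1)]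
      refine lintegral_congr fun c => lintegral_congr fun c' => ?_
      have e : nextTime lam T ⟨τ, C⟩ (U, V, c, c') = ((τ + V / ρ₂ : ℝ) : EReal) := by
        rw [hn, min_eq_right (hlt c c').le, hl', if_pos hE]
      rw [h_loop _ (by rw [e]; exact EReal.coe_lt_top _) (hlt c c'), e, EReal.toReal_coe, hsub]
    by_cases hE : 0 < ρ₁ ∧ U ≤ ρ₁ * t
    · have hn3 : ¬ (ρ₁ * t < U ∧ ρ₂ * t < V) := fun h => not_lt.2 hE.2 h.1
      have hle : U / ρ₁ ≤ t := (div_le_iff₀' hE.1).2 hE.2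
      by_cases hF : 0 < ρ₂ ∧ V ≤ ρ₂ * t
      · rcases lt_or_gt_of_ne hUV with h | h
        · -- the loop comes first
          have h' : V / ρ₂ < U / ρ₁ := (div_lt_iff₀' hF.1).2 h
          have h'' : ρ₁ * (V / ρ₂) < U := by rwa [lt_div_iff₀' hE.1] at h'
          rw [if_neg (fun hc => lt_asymm h hc.2), if_pos ⟨hF, h''⟩, if_neg hn3, zero_add, add_zero]
          refine case_loop hF fun c c' => ?_
          rw [hb', hl', if_pos hE, if_pos hF, EReal.coe_lt_coe_iff]
          linarith
        · -- the birth comes first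
          have h' : U / ρ₁ < V / ρ₂ := (lt_div_iff₀' hF.1).2 h
          have h'' : U < ρ₁ * (V / ρ₂) := by rwa [div_lt_iff₀' hE.1] at h'
          rw [if_pos ⟨hE, h⟩, if_neg (fun hc => lt_asymm h'' hc.2), if_neg hn3, add_zero, add_zero]
          refine case_birth hE fun c c' => ?_
          rw [hb', hl', if_pos hE, if_pos hF, EReal.coe_lt_coe_iff]
          linarith
      · -- only the clock of the births rings before the horizon
        have h : ρ₂ * (U / ρ₁) < V := (mul_le_mul_of_nonneg_left hle h₂).trans_lt (hE₂ hV hF)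
        rw [if_pos ⟨hE, h⟩, if_neg (fun hc => hF hc.1), if_neg hn3, add_zero, add_zero]
        refine case_birth hE fun c c' => ?_
        rw [hb', hl', if_pos hE, if_neg hF]
        exact EReal.coe_lt_top _
    · by_cases hF : 0 < ρ₂ ∧ V ≤ ρ₂ * t
      · -- only the clock of the loops rings before the horizon
        have hn3 : ¬ (ρ₁ * t < U ∧ ρ₂ * t < V) := fun h => not_lt.2 hF.2 h.2
        have hle : V / ρ₂ ≤ t := (div_le_iff₀' hF.1).2 hF.2
        have h : ρ₁ * (V / ρ₂) < U := (mul_le_mul_of_nonneg_left hle h₁).trans_lt (hE₁ hU hE)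
        rw [if_neg (fun hc => hE hc.1), if_pos ⟨hF, h⟩, if_neg hn3, zero_add, add_zero]
        refine case_loop hF fun c c' => ?_
        rw [hb', hl', if_neg hE, if_pos hF]
        exact EReal.coe_lt_top _
      · rw [if_neg (fun hc => hE hc.1), if_neg (fun hc => hF hc.1),
          if_pos ⟨hE₁ hU hE, hE₂ hV hF⟩, zero_add, zero_add]
        have e : ∀ c c', H (U, V, c, c') = a := fun c c' => h_end _ (by
          rw [hn, hb', hl', if_neg hE, if_neg hF, min_self])
        simp [e]
  have hm₁ := measurable_birthMean hG₁ C
  have hm₂ := measurable_loopMean hG₂ C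
  have m₁ : Measurable fun p : ℝ × ℝ => if (0 < ρ₁ ∧ p.1 ≤ ρ₁ * t) ∧ ρ₂ * (p.1 / ρ₁) < p.2 then
      birthMean C (G₁ (t - p.1 / ρ₁)) else 0 := by
    refine Measurable.ite (((MeasurableSet.const _).inter (measurableSet_le measurable_fst
      measurable_const)).inter (measurableSet_lt (by fun_prop) measurable_snd))
      (hm₁.comp (by fun_prop)) measurable_const
  have m₂ : Measurable fun p : ℝ × ℝ => if (0 < ρ₂ ∧ p.2 ≤ ρ₂ * t) ∧ ρ₁ * (p.2 / ρ₂) < p.1 then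
      loopMean C (G₂ (t - p.2 / ρ₂)) else 0 := by
    refine Measurable.ite (((MeasurableSet.const _).inter (measurableSet_le measurable_snd
      measurable_const)).inter (measurableSet_lt (by fun_prop) measurable_fst))
      (hm₂.comp (by fun_prop)) measurable_const
  have m₁₂ : Measurable fun p : ℝ × ℝ =>
      (if (0 < ρ₁ ∧ p.1 ≤ ρ₁ * t) ∧ ρ₂ * (p.1 / ρ₁) < p.2 then
        birthMean C (G₁ (t - p.1 / ρ₁)) else 0) +
      if (0 < ρ₂ ∧ p.2 ≤ ρ₂ * t) ∧ ρ₁ * (p.2 / ρ₂) < p.1 then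
        loopMean C (G₂ (t - p.2 / ρ₂)) else 0 := m₁.add m₂
  have hp1 : ∀ {f : ℝ × ℝ → ℝ≥0∞}, Measurable f → ∀ U, Measurable fun V => f (U, V) :=
    fun hf U => hf.comp measurable_prodMk_left
  rw [lintegral_stepLaw hH, lintegral_congr_ae (inner.mono fun U hU => lintegral_congr_ae hU)]
  have e1 : ∀ U, ∫⁻ V, ((if (0 < ρ₁ ∧ U ≤ ρ₁ * t) ∧ ρ₂ * (U / ρ₁) < V then
        birthMean C (G₁ (t - U / ρ₁)) else 0) +
      (if (0 < ρ₂ ∧ V ≤ ρ₂ * t) ∧ ρ₁ * (V / ρ₂) < U then loopMean C (G₂ (t - V / ρ₂)) else 0) +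
      if ρ₁ * t < U ∧ ρ₂ * t < V then a else 0) ∂expMeasure 1 =
      (∫⁻ V, (if (0 < ρ₁ ∧ U ≤ ρ₁ * t) ∧ ρ₂ * (U / ρ₁) < V then
        birthMean C (G₁ (t - U / ρ₁)) else 0) ∂expMeasure 1) +
      (∫⁻ V, (if (0 < ρ₂ ∧ V ≤ ρ₂ * t) ∧ ρ₁ * (V / ρ₂) < U then
        loopMean C (G₂ (t - V / ρ₂)) else 0) ∂expMeasure 1) +
      ∫⁻ V, (if ρ₁ * t < U ∧ ρ₂ * t < V then a else 0) ∂expMeasure 1 := fun U => by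
    rw [lintegral_add_left (hp1 m₁₂ U), lintegral_add_left (hp1 m₁ U)]
  simp only [e1]
  have s1 : Measurable fun U => ∫⁻ V, (if (0 < ρ₁ ∧ U ≤ ρ₁ * t) ∧ ρ₂ * (U / ρ₁) < V then
        birthMean C (G₁ (t - U / ρ₁)) else 0) ∂expMeasure 1 := m₁.lintegral_prod_right'
  have s2 : Measurable fun U => ∫⁻ V, (if (0 < ρ₂ ∧ V ≤ ρ₂ * t) ∧ ρ₁ * (V / ρ₂) < U then
        loopMean C (G₂ (t - V / ρ₂)) else 0) ∂expMeasure 1 := m₂.lintegral_prod_right'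
  have s12 : Measurable fun U => (∫⁻ V, (if (0 < ρ₁ ∧ U ≤ ρ₁ * t) ∧ ρ₂ * (U / ρ₁) < V then
        birthMean C (G₁ (t - U / ρ₁)) else 0) ∂expMeasure 1) +
      ∫⁻ V, (if (0 < ρ₂ ∧ V ≤ ρ₂ * t) ∧ ρ₁ * (V / ρ₂) < U then
        loopMean C (G₂ (t - V / ρ₂)) else 0) ∂expMeasure 1 := s1.add s2
  have k₁ : Measurable fun s => birthMean C (G₁ (t - s)) := hm₁.comp (by fun_prop)
  have k₂ : Measurable fun s => loopMean C (G₂ (t - s)) := hm₂.comp (by fun_prop)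
  rw [lintegral_add_left s12, lintegral_add_left s1, lintegral_first_clock h₁ h₂ k₁,
    lintegral_no_clock (mul_nonneg h₁ ht0) (mul_nonneg h₂ ht0), ← add_mul, add_comm,
    lintegral_lintegral_swap m₂.aemeasurable,
    lintegral_first_clock h₂ h₁ k₂, add_comm ρ₂ ρ₁,
    ← lintegral_add_left (by fun_prop)]
  congr 1
  refine lintegral_congr fun r => ?_
  rw [ENNReal.ofReal_mul h₁, ENNReal.ofReal_mul h₂]
  ring

end FirstStep

/-! ### Integral equations -/

section IntegralEquation

lemma lintegral_Ioc_deriv {F F' : ℝ → ℝ} {u t : ℝ} (hut : u ≤ t)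
    (hF : ∀ s, HasDerivAt F (F' s) s) (hc : Continuous F') (h0 : ∀ s ∈ Ioc u t, 0 ≤ F' s) :
    ∫⁻ s in Ioc u t, ENNReal.ofReal (F' s) = ENNReal.ofReal (F t - F u) := by
  rw [← intervalIntegral.integral_eq_sub_of_hasDerivAt (fun s _ => hF s)
    (hc.intervalIntegrable u t), intervalIntegral.integral_of_le hut,
    ofReal_integral_eq_lintegral_ofReal]
  · exact (hc.intervalIntegrable u t).1
  · filter_upwards [ae_restrict_mem measurableSet_Ioc] with s hs using h0 s hs

lemma lintegral_Icc_eq_Ioc (u t : ℝ) (f : ℝ → ℝ≥0∞) :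
    ∫⁻ s in Icc u t, f s = ∫⁻ s in Ioc u t, f s :=
  setLIntegral_congr Ioc_ae_eq_Icc.symm

lemma lintegral_Icc_pow (R : ℝ≥0) {t : ℝ} (ht : 0 ≤ t) (n : ℕ) :
    ∫⁻ s in Icc 0 t, R * ENNReal.ofReal ((R * s) ^ n / n.factorial) =
      ENNReal.ofReal ((R * t) ^ (n + 1) / (n + 1).factorial) := by
  have h := lintegral_Ioc_deriv (F := fun s => ((R : ℝ) * s) ^ (n + 1) / (n + 1).factorial)
    (F' := fun s => R * (((R : ℝ) * s) ^ n / n.factorial)) ht (fun s => ?_) (by fun_prop)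
    (fun s hs => mul_nonneg R.2 (div_nonneg (pow_nonneg (mul_nonneg R.2 hs.1.le) _)
      (Nat.cast_nonneg _)))
  · simp only [mul_zero, ne_eq, Nat.add_eq_zero_iff, one_ne_zero, and_false, not_false_eq_true,
      zero_pow, zero_div, sub_zero] at h
    rw [lintegral_Icc_eq_Ioc, ← h]
    refine lintegral_congr fun s => ?_
    rw [ENNReal.ofReal_mul R.coe_nonneg, ENNReal.ofReal_coe_nnreal]
  · have h1 := (((hasDerivAt_id s).const_mul (R : ℝ)).pow (n + 1)).div_const
      ((n + 1).factorial : ℝ)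
    refine h1.congr_deriv ?_
    have : ((n.factorial : ℕ) : ℝ) ≠ 0 := by exact_mod_cast n.factorial_ne_zero
    have : (n : ℝ) + 1 ≠ 0 := by positivity
    simp only [id_eq, Nat.add_sub_cancel, Nat.factorial_succ, Nat.cast_mul, Nat.cast_add,
      Nat.cast_one, mul_one]
    field_simp

lemma lintegral_Icc_reflect (t : ℝ) (h : ℝ → ℝ≥0∞) :
    ∫⁻ r in Icc 0 t, h (t - r) = ∫⁻ s in Icc 0 t, h s := by
  rw [← lintegral_indicator measurableSet_Icc, ← lintegral_indicator measurableSet_Icc,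
    ← lintegral_sub_left_eq_self ((Icc 0 t).indicator h) t]
  refine lintegral_congr fun r => ?_
  have : t - r ∈ Icc 0 t ↔ r ∈ Icc 0 t := by
    simp only [mem_Icc]; constructor <;> rintro ⟨h1, h2⟩ <;> constructor <;> linarith
  by_cases hr : r ∈ Icc 0 t
  · rw [indicator_of_mem hr, indicator_of_mem (this.2 hr)]
  · rw [indicator_of_notMem hr, indicator_of_notMem (fun h => hr (this.1 h))]

lemma exp_eq_one_add_lintegral (r : ℝ≥0) {u t : ℝ} (hut : u ≤ t) :
    ENNReal.ofReal (Real.exp (r * (t - u))) =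
      1 + ∫⁻ s in Ioc u t, r * ENNReal.ofReal (Real.exp (r * (s - u))) := by
  have h := lintegral_Ioc_deriv (F := fun s => Real.exp (r * (s - u)))
    (F' := fun s => r * Real.exp (r * (s - u))) hut (fun s => ?_) (by fun_prop)
    (fun s _ => mul_nonneg r.2 (Real.exp_nonneg _))
  · have e : ∀ s : ℝ, (r : ℝ≥0∞) * ENNReal.ofReal (Real.exp (r * (s - u))) =
        ENNReal.ofReal (r * Real.exp (r * (s - u))) := fun s => by
      rw [ENNReal.ofReal_mul r.coe_nonneg, ENNReal.ofReal_coe_nnreal]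
    simp only [e, h, sub_self, mul_zero, Real.exp_zero]
    rw [← ENNReal.ofReal_one, ← ENNReal.ofReal_add zero_le_one]
    · congr 1; ring
    · rw [sub_nonneg]
      exact Real.one_le_exp (mul_nonneg r.2 (sub_nonneg.2 hut))
  · have h1 := (((hasDerivAt_id s).sub_const u).const_mul (r : ℝ)).exp
    refine h1.congr_deriv ?_
    simp only [id_eq]
    ring

/-- The variation of constants formula: `e^{r t} a + ∫_0^t e^{r (t - s)} b(s) ds` solves the
equation `y' = b + r y`. -/
lemma variation_of_constants (r : ℝ≥0) (a : ℝ≥0∞) {b : ℝ → ℝ≥0∞} (hb : Measurable b)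
    {y : ℝ → ℝ≥0∞} (hy : ∀ s, 0 ≤ s → y s = ENNReal.ofReal (Real.exp (r * s)) * a +
      ∫⁻ u in Icc 0 s, ENNReal.ofReal (Real.exp (r * (s - u))) * b u) {t : ℝ} (ht : 0 ≤ t) :
    y t = a + ∫⁻ s in Icc 0 t, (b s + r * y s) := by
  have hm : Measurable fun p : ℝ × ℝ =>
      (r : ℝ≥0∞) * (ENNReal.ofReal (Real.exp (r * (p.1 - p.2))) * b p.2) := by fun_prop
  have h1 : ∫⁻ s in Icc 0 t, r * y s =
      (∫⁻ s in Icc 0 t, r * ENNReal.ofReal (Real.exp (r * (s - 0)))) * a +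
      ∫⁻ u in Icc 0 t, (∫⁻ s in Ioc u t, r * ENNReal.ofReal (Real.exp (r * (s - u)))) * b u := by
    have e : ∀ s ∈ Icc 0 t, r * y s = r * ENNReal.ofReal (Real.exp (r * (s - 0))) * a +
        ∫⁻ u in Icc 0 s, r * (ENNReal.ofReal (Real.exp (r * (s - u))) * b u) := fun s hs => by
      rw [hy s hs.1, mul_add, ← mul_assoc, sub_zero, lintegral_const_mul _ (by fun_prop)]
    rw [setLIntegral_congr_fun measurableSet_Icc e, lintegral_add_left (by fun_prop),
      lintegral_mul_const _ (by fun_prop)]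
    congr 1
    rw [← lintegral_triangle (c := fun p => (r : ℝ≥0∞) *
      (ENNReal.ofReal (Real.exp (r * (p.2 - p.1))) * b p.1)) (by fun_prop)]
    refine lintegral_congr fun u => ?_
    rw [← lintegral_mul_const _ (by fun_prop)]
    exact lintegral_congr fun s => (mul_assoc _ _ _).symm
  have h2 : ∀ u ∈ Icc 0 t, ENNReal.ofReal (Real.exp (r * (t - u))) * b u = b u +
      (∫⁻ s in Ioc u t, r * ENNReal.ofReal (Real.exp (r * (s - u)))) * b u := fun u hu => by
    rw [exp_eq_one_add_lintegral r hu.2, add_mul, one_mul]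
  rw [hy t ht, setLIntegral_congr_fun measurableSet_Icc h2, lintegral_add_left hb,
    lintegral_add_left hb, h1, lintegral_Icc_eq_Ioc]
  have h3 := exp_eq_one_add_lintegral r ht
  rw [sub_zero] at h3
  rw [h3, add_mul, one_mul, lintegral_Icc_eq_Ioc 0 t fun s =>
    (r : ℝ≥0∞) * ENNReal.ofReal (Real.exp (r * (s - 0)))]
  ring

/-- Integration by parts. -/
lemma lintegral_mul_lintegral {f g : ℝ → ℝ≥0∞} (hf : Measurable f) (hg : Measurable g) (a : ℝ≥0∞)
    (t : ℝ) :
    (∫⁻ s in Icc 0 t, f s) * (a + ∫⁻ s in Icc 0 t, g s) =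
      ∫⁻ s in Icc 0 t, (f s * (a + ∫⁻ u in Icc 0 s, g u) + (∫⁻ u in Icc 0 s, f u) * g s) := by
  have hG : ∀ h : ℝ → ℝ≥0∞, Measurable fun s : ℝ => ∫⁻ u in Icc 0 s, h u := by
    intro h
    have hmono : Monotone fun s : ℝ => ∫⁻ u in Icc 0 s, h u := fun s s' hs =>
      lintegral_mono_set (Icc_subset_Icc_right hs)
    exact hmono.measurable
  have hfG : Measurable fun s => f s * (a + ∫⁻ u in Icc 0 s, g u) :=
    hf.mul ((hG g).const_add a)
  have h1 : ∫⁻ s in Icc 0 t, f s * (a + ∫⁻ u in Icc 0 s, g u) =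
      (∫⁻ s in Icc 0 t, f s) * a + ∫⁻ s in Icc 0 t, f s * ∫⁻ u in Icc 0 s, g u := by
    simp only [mul_add]
    rw [lintegral_add_left (hf.mul_const a), lintegral_mul_const _ hf]
  have h2 : ∫⁻ s in Icc 0 t, (∫⁻ u in Icc 0 s, f u) * g s =
      ∫⁻ s in Icc 0 t, f s * ∫⁻ u in Ioc s t, g u := by
    have := lintegral_triangle (t := t) (c := fun p => f p.1 * g p.2) (by fun_prop)
    simp only [lintegral_const_mul _ hg, lintegral_mul_const _ hf] at this
    exact this.symm
  have hfg : Measurable fun s => f s * ∫⁻ u in Icc 0 s, g u := hf.mul (hG g)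
  rw [lintegral_add_left hfG, h1, h2, mul_add, add_assoc, ← lintegral_add_left hfg,
    ← lintegral_mul_const (∫⁻ s in Icc 0 t, g s) hf]
  congr 1
  refine setLIntegral_congr_fun measurableSet_Icc fun s hs => ?_
  rw [lintegral_Icc_split hs, mul_add]

end IntegralEquation

/-! ### The integral equation of the exploration -/

section ExplorationEquation

variable {N : ℕ}

/-- The operator `exploreGen` has nonnegative coefficients, of total mass `R`. -/
lemma exploreGen_le {R c : ℝ≥0} {C : Finset (Fin N)} (hR : exploreRate c C ≤ R)
    {y z : ℝ → Finset (Fin N) → List (Interaction N) → ℕ → ℝ≥0∞} {s : ℝ}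
    {es : List (Interaction N)} {k : ℕ} {b : ℝ≥0∞}
    (h1 : ∀ i ∈ C, ∀ j ∈ Cᶜ, y s (insert j C) ((s.toNNReal, i, j) :: es) k ≤
      z s (insert j C) ((s.toNNReal, i, j) :: es) k + b)
    (h2 : ∀ i ∈ C, ∀ j ∈ C.erase i, y s C ((s.toNNReal, i, j) :: es) (k + 1) ≤
      z s C ((s.toNNReal, i, j) :: es) (k + 1) + b)
    (h3 : y s C es k ≤ z s C es k + b) :
    exploreGen R c y s C es k ≤ exploreGen R c z s C es k + R * b := by
  have e : (R : ℝ≥0∞) * b = c * (2 * ∑ i ∈ C, ∑ j ∈ Cᶜ, b + ∑ i ∈ C, ∑ j ∈ C.erase i, b) +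
      (R - exploreRate c C : ℝ≥0) * b := by
    conv_lhs => rw [← add_tsub_cancel_of_le hR]
    rw [ENNReal.coe_add, add_mul, sum_erase_const]
    simp only [Finset.sum_const, nsmul_eq_mul, exploreRate]
    push_cast
    ring
  rw [e, exploreGen, exploreGen]
  calc _ ≤ c * (2 * ∑ i ∈ C, ∑ j ∈ Cᶜ, (z s (insert j C) ((s.toNNReal, i, j) :: es) k + b) +
        ∑ i ∈ C, ∑ j ∈ C.erase i, (z s C ((s.toNNReal, i, j) :: es) (k + 1) + b)) +
        (R - exploreRate c C : ℝ≥0) * (z s C es k + b) := by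
        gcongr with i hi j hj i hi j hj
        · exact h1 i hi j hj
        · exact h2 i hi j hj
    _ = _ := by
        simp only [Finset.sum_add_distrib, mul_add]
        ring

/-- Comparison principle for the integral equation of the exploration: iterating the equation `n`
times, the difference is at most `M (R t)^n / n!`. -/
lemma le_of_exploreGen {R c : ℝ≥0} (hR : ∀ C : Finset (Fin N), exploreRate c C ≤ R)
    {Inv : ℝ → Finset (Fin N) → List (Interaction N) → Prop}
    (hmono : ∀ s t C es, Inv t C es → s ≤ t → Inv s C es)
    (hcons : ∀ s t C es i j, Inv t C es → 0 ≤ s → s < t → i ∈ C →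
      Inv s (insert j C) ((s.toNNReal, i, j) :: es))
    {f : List (Interaction N) → ℕ → ℝ≥0∞}
    {y z : ℝ → Finset (Fin N) → List (Interaction N) → ℕ → ℝ≥0∞} {t₀ : ℝ} {M : ℝ≥0∞} (hM : M ≠ ⊤)
    (hyM : ∀ t ∈ Icc 0 t₀, ∀ C es k, Inv t C es → y t C es k ≤ M)
    (hy : ∀ t ∈ Icc 0 t₀, ∀ C es k, Inv t C es →
      y t C es k ≤ f es k + ∫⁻ s in Icc 0 t, exploreGen R c y s C es k)
    (hz : ∀ t ∈ Icc 0 t₀, ∀ C es k, Inv t C es →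
      f es k + ∫⁻ s in Icc 0 t, exploreGen R c z s C es k ≤ z t C es k)
    {t : ℝ} (ht : t ∈ Icc 0 t₀) {C : Finset (Fin N)} {es : List (Interaction N)} (k : ℕ)
    (h : Inv t C es) : y t C es k ≤ z t C es k := by
  have key : ∀ n : ℕ, ∀ t ∈ Icc 0 t₀, ∀ C es k, Inv t C es →
      y t C es k ≤ z t C es k + M * ENNReal.ofReal ((R * t) ^ n / n.factorial) := by
    intro n
    induction n with
    | zero =>
      intro t ht C es k h
      simpa using (hyM t ht C es k h).trans le_add_self
    | succ n ih =>
      intro t ht C es k h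
      -- `Inv` is only preserved by transitions at times `s < t`
      have hae : ∀ᵐ s : ℝ ∂volume.restrict (Icc 0 t), s ≠ t :=
        ae_restrict_of_ae (Measure.ae_ne volume t)
      calc y t C es k ≤ f es k + ∫⁻ s in Icc 0 t, exploreGen R c y s C es k := hy t ht C es k h
        _ ≤ f es k + ∫⁻ s in Icc 0 t, (exploreGen R c z s C es k +
            R * (M * ENNReal.ofReal ((R * s) ^ n / n.factorial))) := by
          refine add_le_add_right (lintegral_mono_ae ?_) _
          filter_upwards [hae, ae_restrict_mem measurableSet_Icc] with s hs hst
          have hlt : s < t := lt_of_le_of_ne hst.2 hs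
          have hs0 : s ∈ Icc 0 t₀ := ⟨hst.1, hst.2.trans ht.2⟩
          refine exploreGen_le (hR C) (fun i hi j hj => ?_) (fun i hi j hj => ?_) ?_
          · exact ih s hs0 _ _ _ (hcons s t C es i j h hst.1 hlt hi)
          · have := hcons s t C es i j h hst.1 hlt hi
            rw [Finset.insert_eq_of_mem (Finset.mem_of_mem_erase hj)] at this
            exact ih s hs0 _ _ _ this
          · exact ih s hs0 _ _ _ (hmono s t C es h hlt.le)
        _ = f es k + (∫⁻ s in Icc 0 t, exploreGen R c z s C es k) +
            M * ENNReal.ofReal ((R * t) ^ (n + 1) / (n + 1).factorial) := by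
          rw [lintegral_add_right _ (by fun_prop), add_assoc, ← lintegral_Icc_pow R ht.1 n,
            ← lintegral_const_mul _ (by fun_prop)]
          congr 3
          funext s
          ring
        _ ≤ _ := add_le_add_left (hz t ht C es k h) _
  refine ge_of_tendsto' (x := atTop) (f := fun n : ℕ =>
    z t C es k + M * ENNReal.ofReal ((R * t) ^ n / n.factorial)) ?_
    fun n => key n t ht C es k h
  have h1 := ENNReal.tendsto_ofReal
    (FloorSemiring.tendsto_pow_div_factorial_atTop ((R : ℝ) * t))
  rw [ENNReal.ofReal_zero] at h1
  have h2 := (ENNReal.Tendsto.const_mul (a := M) h1 (Or.inr hM)).const_add (z t C es k)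
  rwa [mul_zero, add_zero] at h2

variable {lam : ℝ} {T : ℝ≥0}

lemma next_time_top {σ : Stage N} (h : σ.time = ⊤) (ν : StepNoise N) :
    (σ.next lam T ν).time = ⊤ := by
  change min (σ.birthTime lam T ν) (σ.loopTime lam T ν) = ⊤
  rw [Stage.birthTime_eq, Stage.loopTime_eq, h, clock_top, clock_top, min_self]

lemma stageFrom_time_top {σ : Stage N} {ω : ℕ → StepNoise N} {k m : ℕ} (hkm : k ≤ m)
    (h : (stageFrom lam T σ ω k).time = ⊤) : (stageFrom lam T σ ω m).time = ⊤ := by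
  induction hkm with
  | refl => exact h
  | step _ ih => exact next_time_top ih _

lemma stageFrom_consSeq (σ : Stage N) (ν : StepNoise N) (ω : ℕ → StepNoise N) (k : ℕ) :
    stageFrom lam T σ (consSeq ν ω) (k + 1) = stageFrom lam T (σ.next lam T ν) ω k := by
  induction k with
  | zero => rfl
  | succ k ih => rw [stageFrom, ih]; rfl

lemma stepsFrom_consSeq_of_top {σ : Stage N} {ν : StepNoise N}
    (h : (σ.next lam T ν).time = ⊤) (ω : ℕ → StepNoise N) :
    stepsFrom lam T σ (consSeq ν ω) = ∅ := by
  refine eq_empty_of_forall_notMem fun k hk => ?_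
  change (stageFrom lam T σ (consSeq ν ω) (k + 1)).time < ⊤ at hk
  rw [stageFrom_consSeq, stageFrom_time_top (σ := σ.next lam T ν) k.zero_le h] at hk
  exact lt_irrefl _ hk

lemma loopStepsFrom_subset (σ : Stage N) (ω : ℕ → StepNoise N) :
    loopStepsFrom lam T σ ω ⊆ stepsFrom lam T σ ω := fun _ h => h.1

lemma exploredList_consSeq_of_top {σ : Stage N} {ν : StepNoise N}
    (h : (σ.next lam T ν).time = ⊤) (ω : ℕ → StepNoise N) :
    exploredList lam T σ (consSeq ν ω) = [] := by
  rw [exploredList, stepsFrom_consSeq_of_top h]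
  simp

lemma ncard_loopStepsFrom_consSeq_of_top {σ : Stage N} {ν : StepNoise N}
    (h : (σ.next lam T ν).time = ⊤) (ω : ℕ → StepNoise N) :
    (loopStepsFrom lam T σ (consSeq ν ω)).ncard = 0 := by
  have := loopStepsFrom_subset (lam := lam) (T := T) σ (consSeq ν ω)
  rw [stepsFrom_consSeq_of_top h, subset_empty_iff] at this
  rw [this, ncard_empty]

lemma exploredList_consSeq {σ : Stage N} {ν : StepNoise N}
    (h : (σ.next lam T ν).time < ⊤) {ω : ℕ → StepNoise N}
    (hfin : (stepsFrom lam T (σ.next lam T ν) ω).Finite) :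
    exploredList lam T σ (consSeq ν ω) = exploredList lam T (σ.next lam T ν) ω ++
      [(((T : ℝ) - (σ.nextTime lam T ν).toReal).toNNReal, σ.chosenR ν, σ.chosenJ lam T ν)] := by
  have h1 : stepsFrom lam T σ (consSeq ν ω) =
      insert 0 (Nat.succ '' stepsFrom lam T (σ.next lam T ν) ω) := by
    ext k
    cases k with
    | zero => exact iff_of_true h (mem_insert _ _)
    | succ k =>
      rw [mem_insert_iff, Nat.succ_injective.mem_set_image]
      simp only [stepsFrom, mem_ofPred_eq, Nat.succ_ne_zero, false_or, stageFrom_consSeq]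
  have h2 : ∀ k, interactionAt lam T σ (consSeq ν ω) (k + 1) =
      interactionAt lam T (σ.next lam T ν) ω k := fun k => by
    simp only [interactionAt, stageFrom_consSeq]
    rfl
  rw [exploredList, h1, ncard_insert_of_notMem (by simp) (hfin.image _),
    ncard_image_of_injective _ Nat.succ_injective, List.range_succ_eq_map, List.reverse_cons,
    List.map_append, ← List.map_reverse, List.map_map]
  congr 1
  exact List.map_congr_left fun k _ => h2 k

open Classical in
lemma ncard_loopStepsFrom_consSeq {σ : Stage N} {ν : StepNoise N}
    (h : (σ.next lam T ν).time < ⊤) {ω : ℕ → StepNoise N}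
    (hfin : (stepsFrom lam T (σ.next lam T ν) ω).Finite) :
    (loopStepsFrom lam T σ (consSeq ν ω)).ncard =
      (loopStepsFrom lam T (σ.next lam T ν) ω).ncard +
        if σ.nextTime lam T ν = σ.loopTime lam T ν then 1 else 0 := by
  have h0 : 0 ∈ loopStepsFrom lam T σ (consSeq ν ω) ↔
      σ.nextTime lam T ν = σ.loopTime lam T ν := ⟨fun hk => hk.2, fun hk => ⟨h, hk⟩⟩
  have h2 : ∀ k, k + 1 ∈ loopStepsFrom lam T σ (consSeq ν ω) ↔
      k ∈ loopStepsFrom lam T (σ.next lam T ν) ω := fun k => by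
    simp only [loopStepsFrom, mem_ofPred_eq, stageFrom_consSeq]
    rfl
  have hfin' := (hfin.subset (loopStepsFrom_subset (σ.next lam T ν) ω)).image Nat.succ
  by_cases hl : σ.nextTime lam T ν = σ.loopTime lam T ν
  · have h1 : loopStepsFrom lam T σ (consSeq ν ω) =
        insert 0 (Nat.succ '' loopStepsFrom lam T (σ.next lam T ν) ω) := by
      ext k
      cases k with
      | zero => exact iff_of_true (h0.2 hl) (mem_insert _ _)
      | succ k =>
        rw [mem_insert_iff, Nat.succ_injective.mem_set_image, h2]
        simp
    rw [h1, ncard_insert_of_notMem (by simp) hfin', if_pos hl,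
      ncard_image_of_injective _ Nat.succ_injective]
  · have h1 : loopStepsFrom lam T σ (consSeq ν ω) =
        Nat.succ '' loopStepsFrom lam T (σ.next lam T ν) ω := by
      ext k
      cases k with
      | zero => exact iff_of_false (fun hk => hl (h0.1 hk)) (by simp)
      | succ k => rw [Nat.succ_injective.mem_set_image, h2]
    rw [h1, if_neg hl, add_zero, ncard_image_of_injective _ Nat.succ_injective]

lemma inv_card_mul_sum_le {S : Finset (Fin N)} {φ : Fin N → ℝ≥0∞} {b : ℝ≥0∞}
    (h : ∀ i ∈ S, φ i ≤ b) : (S.card : ℝ≥0∞)⁻¹ * ∑ i ∈ S, φ i ≤ b := by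
  refine (mul_le_mul_right (Finset.sum_le_card_nsmul S φ b h) _).trans ?_
  rw [nsmul_eq_mul, ← mul_assoc]
  exact mul_le_of_le_one_left' (ENNReal.inv_mul_le_one _)

lemma birthMean_le (C : Finset (Fin N)) {g : Fin N → Fin N → ℝ≥0∞} {b : ℝ≥0∞}
    (h : ∀ i ∈ C, ∀ j ∈ Cᶜ, g i j ≤ b) : birthMean C g ≤ b :=
  inv_card_mul_sum_le fun i hi => inv_card_mul_sum_le fun j hj => h i hi j hj

lemma loopMean_le (C : Finset (Fin N)) {g : Fin N → Fin N → ℝ≥0∞} {b : ℝ≥0∞}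
    (h : ∀ i ∈ C, ∀ j ∈ C.erase i, g i j ≤ b) : loopMean C g ≤ b :=
  inv_card_mul_sum_le fun i hi => inv_card_mul_sum_le fun j hj => h i hi j hj

section Rates

open Stage

variable {c : ℝ≥0}

lemma birthRate_eq (hN : 2 ≤ N) (hc : lam = 2 * c * (N - 1)) (C : Finset (Fin N)) :
    birthRate N lam C.card = (2 * c * (C.card * Cᶜ.card : ℕ) : ℝ≥0) := by
  have h2 : (2 : ℝ) ≤ N := by exact_mod_cast hN
  have h3 : (Cᶜ.card : ℝ) = N - C.card := by
    rw [Finset.card_compl, Fintype.card_fin, Nat.cast_sub]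
    simpa using Finset.card_le_univ C
  have h4 : (0 : ℝ) ≤ N - C.card := by rw [← h3]; positivity
  have h5 : (N : ℝ) - 1 ≠ 0 := by linarith
  rw [birthRate, max_eq_left h4, hc]
  push_cast
  rw [h3]
  field_simp

lemma loopRate_eq (hN : 2 ≤ N) (hc : lam = 2 * c * (N - 1)) (C : Finset (Fin N)) :
    loopRate N lam C.card = (c * (C.card * (C.card - 1) : ℕ) : ℝ≥0) := by
  have h2 : (2 : ℝ) ≤ N := by exact_mod_cast hN
  have h5 : (N : ℝ) - 1 ≠ 0 := by linarith
  have h6 : ((C.card * (C.card - 1) : ℕ) : ℝ) = C.card * (C.card - 1) := by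
    rcases Nat.eq_zero_or_pos C.card with h | h
    · simp [h]
    · rw [Nat.cast_mul, Nat.cast_pred h]
  rw [loopRate, hc, NNReal.coe_mul, NNReal.coe_natCast, h6]
  field_simp

lemma birthRate_add_loopRate (hN : 2 ≤ N) (hc : lam = 2 * c * (N - 1)) (C : Finset (Fin N)) :
    birthRate N lam C.card + loopRate N lam C.card = exploreRate c C := by
  rw [birthRate_eq hN hc, loopRate_eq hN hc, exploreRate]
  push_cast
  ring

lemma birthRate_mul_birthMean (hN : 2 ≤ N) (hc : lam = 2 * c * (N - 1)) {C : Finset (Fin N)}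
    (hC : C.Nonempty) (g : Fin N → Fin N → ℝ≥0∞) :
    ENNReal.ofReal (birthRate N lam C.card) * birthMean C g =
      c * (2 * ∑ i ∈ C, ∑ j ∈ Cᶜ, g i j) := by
  rw [birthRate_eq hN hc, ENNReal.ofReal_coe_nnreal, birthMean, ← Finset.mul_sum]
  rcases Cᶜ.eq_empty_or_nonempty with h | h
  · simp [h]
  have e : ∀ S : Finset (Fin N), S.Nonempty → (S.card : ℝ≥0∞) * (S.card : ℝ≥0∞)⁻¹ = 1 :=
    fun S hS => ENNReal.mul_inv_cancel (by exact_mod_cast hS.card_pos.ne')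
      (ENNReal.natCast_ne_top _)
  push_cast
  calc _ = 2 * c * (C.card * (C.card : ℝ≥0∞)⁻¹) * (Cᶜ.card * (Cᶜ.card : ℝ≥0∞)⁻¹) *
        ∑ i ∈ C, ∑ j ∈ Cᶜ, g i j := by ring
    _ = _ := by rw [e C hC, e _ h]; ring

lemma loopRate_mul_loopMean (hN : 2 ≤ N) (hc : lam = 2 * c * (N - 1)) {C : Finset (Fin N)}
    (hC : C.Nonempty) (g : Fin N → Fin N → ℝ≥0∞) :
    ENNReal.ofReal (loopRate N lam C.card) * loopMean C g =
      c * ∑ i ∈ C, ∑ j ∈ C.erase i, g i j := by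
  rw [loopRate_eq hN hc, ENNReal.ofReal_coe_nnreal, loopMean, Finset.sum_congr rfl fun i hi => by
    rw [Finset.card_erase_of_mem hi], ← Finset.mul_sum]
  have hC1 := hC.card_pos
  rcases Nat.eq_or_lt_of_le hC1 with h | h
  · obtain ⟨a, rfl⟩ := Finset.card_eq_one.1 h.symm
    simp
  have e : ∀ n : ℕ, 0 < n → (n : ℝ≥0∞) * (n : ℝ≥0∞)⁻¹ = 1 :=
    fun n hn => ENNReal.mul_inv_cancel (by exact_mod_cast hn.ne') (ENNReal.natCast_ne_top _)
  rw [ENNReal.coe_mul, ENNReal.coe_natCast, Nat.cast_mul]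
  calc _ = c * (C.card * (C.card : ℝ≥0∞)⁻¹) *
        ((C.card - 1 : ℕ) * ((C.card - 1 : ℕ) : ℝ≥0∞)⁻¹) *
        ∑ i ∈ C, ∑ j ∈ C.erase i, g i j := by ring
    _ = _ := by rw [e _ hC1, e _ (by omega)]; ring

end Rates

end ExplorationEquation

section ExplorationValue

variable {N : ℕ} {lam : ℝ} {T : ℝ≥0}

lemma measurable_stage_mk (T : ℝ≥0) (C : Finset (Fin N)) :
    Measurable fun s : ℝ => (⟨((T - s : ℝ) : EReal), C⟩ : Stage N) := by
  refine Stage.measurable_of_time_active ?_ measurable_const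
  exact measurable_coe_real_ereal.comp (f := fun s : ℝ => (T : ℝ) - s) (by fun_prop)

lemma measurable_next_left (hN : 2 ≤ N) (hlam : 0 < lam) (σ : Stage N) :
    Measurable fun ν => σ.next lam T ν := by
  obtain ⟨g, hg⟩ : ∃ g : Stage N × StepNoise N → Stage N, ∀ σ ν, g (σ, ν) = σ.next lam T ν :=
    ⟨fun p => p.1.next lam T p.2, fun _ _ => rfl⟩
  have hgm : Measurable g := by
    have : g = fun p => p.1.next lam T p.2 := funext fun p => hg p.1 p.2
    rw [this]
    exact Stage.measurable_next T (by omega) hlam.le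
  simp only [← hg]
  exact hgm.comp measurable_prodMk_left

lemma nextTime_eq_coe (hN : 2 ≤ N) (hlam : 0 < lam) {τ : ℝ} {C : Finset (Fin N)}
    {ν : StepNoise N} (h : Stage.nextTime lam T ⟨τ, C⟩ ν < ⊤) :
    ∃ s : ℝ, 0 ≤ s ∧ s ≤ T - τ ∧
      Stage.nextTime lam T ⟨τ, C⟩ ν = ((T - s : ℝ) : EReal) := by
  have key : ∀ {ρ U : ℝ}, 0 ≤ ρ → clock T τ ρ U < ⊤ →
      ∃ s : ℝ, 0 ≤ s ∧ s ≤ T - τ ∧ clock T τ ρ U = ((T - s : ℝ) : EReal) := by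
    intro ρ U hρ hlt
    rw [clock_coe T hρ] at hlt ⊢
    by_cases hc : τ ≤ T ∧ (U ≤ 0 ∨ 0 < ρ ∧ U ≤ ρ * (T - τ))
    · rw [if_pos hc]
      have h1 : 0 ≤ max U 0 / ρ := div_nonneg (le_max_right _ _) hρ
      refine ⟨T - (τ + max U 0 / ρ), ?_, by linarith, by rw [sub_sub_cancel]⟩
      rcases hc.2 with hU | ⟨hρ', hU⟩
      · rw [max_eq_right hU, zero_div]; linarith [hc.1]
      · have : max U 0 / ρ ≤ T - τ := by
          rw [div_le_iff₀' hρ', max_le_iff]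
          exact ⟨hU, mul_nonneg hρ (sub_nonneg.2 hc.1)⟩
        linarith
    · rw [if_neg hc] at hlt
      exact absurd hlt (lt_irrefl _)
  rcases le_total (Stage.birthTime lam T ⟨τ, C⟩ ν) (Stage.loopTime lam T ⟨τ, C⟩ ν) with hle | hle
  · have e : Stage.nextTime lam T ⟨τ, C⟩ ν = Stage.birthTime lam T ⟨τ, C⟩ ν := min_eq_left hle
    rw [e] at h ⊢
    exact key (Stage.birthRate_nonneg (by omega) hlam.le _) h
  · have e : Stage.nextTime lam T ⟨τ, C⟩ ν = Stage.loopTime lam T ⟨τ, C⟩ ν := min_eq_right hle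
    rw [e] at h ⊢
    exact key (Stage.loopRate_nonneg (by omega) hlam.le _) h

lemma next_of_birth {σ : Stage N} {ν : StepNoise N} (h : σ.nextTime lam T ν < ⊤)
    (h' : σ.birthTime lam T ν < σ.loopTime lam T ν) :
    σ.next lam T ν = ⟨σ.nextTime lam T ν, insert (ν.2.2.2 σ.activeᶜ) σ.active⟩ ∧
      σ.chosenJ lam T ν = ν.2.2.2 σ.activeᶜ := by
  have e : σ.nextTime lam T ν = σ.birthTime lam T ν := min_eq_left h'.le
  have hj : σ.chosenJ lam T ν = ν.2.2.2 σ.activeᶜ := if_pos e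
  refine ⟨?_, hj⟩
  rw [Stage.next, if_pos ⟨h, e⟩, hj]

lemma next_of_loop {σ : Stage N} {ν : StepNoise N}
    (h' : σ.loopTime lam T ν < σ.birthTime lam T ν) :
    σ.next lam T ν = ⟨σ.nextTime lam T ν, σ.active⟩ ∧
      σ.chosenJ lam T ν = ν.2.2.2 (σ.active.erase (ν.2.2.1 σ.active)) := by
  have e : σ.nextTime lam T ν ≠ σ.birthTime lam T ν := by
    change min _ _ ≠ _
    rw [min_eq_right h'.le]
    exact h'.ne
  exact ⟨by rw [Stage.next, if_neg fun hc => e hc.2], if_neg e⟩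

variable [NeZero N]

instance : IsProbabilityMeasure (noiseLaw N) := by unfold noiseLaw; infer_instance

/-- The probability that the exploration makes `n` steps is at most `(R t)^n / n!`. -/
lemma noiseLaw_stageFrom_lt_top_le (hN : 2 ≤ N) (hlam : 0 < lam) {c : ℝ≥0}
    (hc : lam = 2 * c * (N - 1)) {R : ℝ≥0} (hR : ∀ C : Finset (Fin N), exploreRate c C ≤ R)
    (n : ℕ) {t : ℝ} (ht : 0 ≤ t) {C : Finset (Fin N)} (hC : C.Nonempty) :
    noiseLaw N {ω | (stageFrom lam T ⟨((T - t : ℝ) : EReal), C⟩ ω n).time < ⊤} ≤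
      ENNReal.ofReal ((R * t) ^ n / n.factorial) := by
  have hms : ∀ n, MeasurableSet {p : Stage N × (ℕ → StepNoise N) |
      (stageFrom lam T p.1 p.2 n).time < ⊤} := fun n =>
    measurableSet_lt (Stage.measurable_time.comp (measurable_stageFrom T (by omega) hlam.le n))
      measurable_const
  have hms' : ∀ n (σ : Stage N), MeasurableSet {ω | (stageFrom lam T σ ω n).time < ⊤} :=
    fun n σ => measurable_prodMk_left (hms n)
  have hG : ∀ n, Measurable fun σ : Stage N =>
      noiseLaw N {ω | (stageFrom lam T σ ω n).time < ⊤} := fun n =>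
    measurable_measure_prodMk_left (hms n)
  -- after a first step at a rate at most `R`, `n` more steps have to be made
  induction n generalizing t C with
  | zero => simpa using prob_le_one
  | succ n ih =>
    obtain ⟨p, hp⟩ : ∃ p : Stage N → ℝ≥0∞, ∀ σ, p σ =
        noiseLaw N {ω | (stageFrom lam T σ ω n).time < ⊤} := ⟨_, fun _ => rfl⟩
    have hpm : Measurable p := by rw [funext hp]; exact hG n
    have hτ : (T : ℝ) - t ≤ T := by linarith
    have hpn : Measurable fun ν => p (Stage.next lam T ⟨((T - t : ℝ) : EReal), C⟩ ν) :=
      hpm.comp (measurable_next_left hN hlam _)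
    have hind : ∀ ν, ∫⁻ ω,
        {ω | (stageFrom lam T ⟨((T - t : ℝ) : EReal), C⟩ ω (n + 1)).time < ⊤}.indicator
        (1 : (ℕ → StepNoise N) → ℝ≥0∞) (consSeq ν ω) ∂noiseLaw N =
        p (Stage.next lam T ⟨((T - t : ℝ) : EReal), C⟩ ν) := fun ν => by
      rw [hp, ← lintegral_indicator_one (hms' n _)]
      refine lintegral_congr fun ω => ?_
      have := stageFrom_consSeq (lam := lam) (T := T) ⟨((T - t : ℝ) : EReal), C⟩ ν ω n
      simp only [indicator_apply, mem_ofPred_eq, this, Pi.one_apply]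
    rw [← lintegral_indicator_one (hms' _ _),
      lintegral_noiseLaw (measurable_one.indicator (hms' _ _)), lintegral_congr hind,
      lintegral_firstStep hN hlam hτ hC 0
        (G₁ := fun s _ j => p ⟨((T - s : ℝ) : EReal), insert j C⟩)
        (G₂ := fun s _ _ => p ⟨((T - s : ℝ) : EReal), C⟩)
        (fun i j => hpm.comp (measurable_stage_mk T _))
        (fun i j => hpm.comp (measurable_stage_mk T _))
        hpn]
    · rw [mul_zero, zero_add, sub_sub_cancel, ← lintegral_Icc_pow R ht n,
        ← lintegral_Icc_reflect t fun s => (R : ℝ≥0∞) * ENNReal.ofReal ((R * s) ^ n / n.factorial)]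
      refine setLIntegral_mono' measurableSet_Icc fun r hr => ?_
      have hle : ∀ D : Finset (Fin N), D.Nonempty → p ⟨((T - (t - r) : ℝ) : EReal), D⟩ ≤
          ENNReal.ofReal ((R * (t - r)) ^ n / n.factorial) := fun D hD => by
        rw [hp]
        exact ih (sub_nonneg.2 hr.2) hD
      have hb := birthMean_le C (g := fun _ j => p ⟨((T - (t - r) : ℝ) : EReal), insert j C⟩)
        fun i _ j _ => hle _ (Finset.insert_nonempty j C)
      have hl := loopMean_le C (g := fun _ _ => p ⟨((T - (t - r) : ℝ) : EReal), C⟩)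
        fun i _ j _ => hle _ hC
      have hκ := birthRate_add_loopRate hN hc C
      have h₁ := Stage.birthRate_nonneg (N := N) (by omega) hlam.le C.card
      have h₂ := Stage.loopRate_nonneg (N := N) (by omega) hlam.le C.card
      calc _ ≤ 1 * (ENNReal.ofReal (Stage.birthRate N lam C.card) *
            ENNReal.ofReal ((R * (t - r)) ^ n / n.factorial) +
            ENNReal.ofReal (Stage.loopRate N lam C.card) *
            ENNReal.ofReal ((R * (t - r)) ^ n / n.factorial)) := by
            refine mul_le_mul' ?_ (add_le_add (mul_le_mul_right hb _) (mul_le_mul_right hl _))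
            rw [← ENNReal.ofReal_one]
            refine ENNReal.ofReal_le_ofReal (Real.exp_le_one_iff.2 ?_)
            exact neg_nonpos.2 (mul_nonneg (add_nonneg h₁ h₂) hr.1)
        _ = exploreRate c C * ENNReal.ofReal ((R * (t - r)) ^ n / n.factorial) := by
            rw [one_mul, ← add_mul, ← ENNReal.ofReal_add h₁ h₂, hκ, ENNReal.ofReal_coe_nnreal]
        _ ≤ _ := mul_le_mul_left (by exact_mod_cast hR C) _
    · intro ν hν
      rw [hp]
      have : ∀ ω,
          ¬ (stageFrom lam T (Stage.next lam T ⟨((T - t : ℝ) : EReal), C⟩ ν) ω n).time < ⊤ :=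
        fun ω => by
          rw [stageFrom_time_top (σ := Stage.next lam T ⟨((T - t : ℝ) : EReal), C⟩ ν) n.zero_le hν]
          exact lt_irrefl _
      exact (congrArg _ (eq_empty_of_forall_notMem this)).trans measure_empty
    · intro ν hν hν'
      obtain ⟨s, -, -, hs⟩ := nextTime_eq_coe hN hlam hν
      rw [(next_of_birth hν hν').1, hs, EReal.toReal_coe, sub_sub_cancel]
    · intro ν hν hν'
      obtain ⟨s, -, -, hs⟩ := nextTime_eq_coe hN hlam hν
      rw [(next_of_loop hν').1, hs, EReal.toReal_coe, sub_sub_cancel]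

/-- Almost surely, the exploration has finitely many steps. -/
lemma ae_finite_stepsFrom (hN : 2 ≤ N) (hlam : 0 < lam) {c : ℝ≥0}
    (hc : lam = 2 * c * (N - 1)) {t : ℝ} (ht : 0 ≤ t) {C : Finset (Fin N)} (hC : C.Nonempty) :
    ∀ᵐ ω ∂noiseLaw N, (stepsFrom lam T ⟨((T - t : ℝ) : EReal), C⟩ ω).Finite := by
  rw [ae_iff]
  have h1 : ∀ n, noiseLaw N {ω | ¬ (stepsFrom lam T ⟨((T - t : ℝ) : EReal), C⟩ ω).Finite} ≤
      ENNReal.ofReal (((c * (N * (N - 1) : ℕ) : ℝ≥0) * t) ^ n / n.factorial) := fun n => by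
    refine (measure_mono fun ω hω => ?_).trans
      (noiseLaw_stageFrom_lt_top_le (T := T) hN hlam hc (exploreRate_le c) n ht hC)
    by_contra hn
    refine hω ((Set.finite_lt_nat n).subset fun k hk => ?_)
    by_contra hkn
    rw [mem_ofPred_eq, not_lt] at hkn
    refine (lt_irrefl (⊤ : EReal)) ?_
    conv_lhs => rw [← stageFrom_time_top (hkn.trans k.le_succ) (not_lt_top_iff.1 hn)]
    exact hk
  have h2 := ENNReal.tendsto_ofReal (FloorSemiring.tendsto_pow_div_factorial_atTop
    (((c * (N * (N - 1) : ℕ) : ℝ≥0) : ℝ) * t))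
  rw [ENNReal.ofReal_zero] at h2
  exact le_zero_iff.1 (ge_of_tendsto' h2 h1)

/-- The expectation of a function of the interactions found by the exploration during the remaining
time `t`, followed by `es`, and of the number of loops, `k` loops being already counted. -/
def exploreValue (lam : ℝ) (T : ℝ≥0) (f : List (Interaction N) → ℕ → ℝ≥0∞) (t : ℝ)
    (C : Finset (Fin N)) (es : List (Interaction N)) (k : ℕ) : ℝ≥0∞ :=
  ∫⁻ ω, f (exploredList lam T ⟨((T - t : ℝ) : EReal), C⟩ ω ++ es)
    ((loopStepsFrom lam T ⟨((T - t : ℝ) : EReal), C⟩ ω).ncard + k) ∂noiseLaw N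

lemma measurable_exploreValue_integrand (hN : 2 ≤ N) (hlam : 0 < lam)
    {f : List (Interaction N) → ℕ → ℝ≥0∞} (hf : ∀ k, Measurable fun es => f es k) :
    Measurable fun p : ((Stage N × ℕ) × List (Interaction N)) × (ℕ → StepNoise N) =>
      f (exploredList lam T p.1.1.1 p.2 ++ p.1.2)
        ((loopStepsFrom lam T p.1.1.1 p.2).ncard + p.1.1.2) := by
  have hf' : Measurable fun q : List (Interaction N) × ℕ => f q.1 q.2 :=
    measurable_from_prod_countable_left hf
  have h0 : Measurable fun p : ((Stage N × ℕ) × List (Interaction N)) × (ℕ → StepNoise N) =>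
      (p.1.1.1, p.2) := by fun_prop
  have h1 : Measurable fun p : ((Stage N × ℕ) × List (Interaction N)) × (ℕ → StepNoise N) =>
      exploredList lam T p.1.1.1 p.2 :=
    (measurable_exploredList T (by omega) hlam.le).comp
      (f := fun p : ((Stage N × ℕ) × List (Interaction N)) × (ℕ → StepNoise N) =>
        (p.1.1.1, p.2)) h0
  have h2 : Measurable fun p : ((Stage N × ℕ) × List (Interaction N)) × (ℕ → StepNoise N) =>
      (loopStepsFrom lam T p.1.1.1 p.2).ncard :=
    (measurable_ncard_loopStepsFrom T (by omega) hlam.le).comp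
      (f := fun p : ((Stage N × ℕ) × List (Interaction N)) × (ℕ → StepNoise N) =>
        (p.1.1.1, p.2)) h0
  have h3 : Measurable fun p : ((Stage N × ℕ) × List (Interaction N)) × (ℕ → StepNoise N) =>
      p.1.2 := by fun_prop
  have h4 : Measurable fun p : ((Stage N × ℕ) × List (Interaction N)) × (ℕ → StepNoise N) =>
      p.1.1.2 := by fun_prop
  exact hf'.comp ((Measurable.list_append h1 h3).prodMk (h2.add h4))

lemma measurable_exploreValue (hN : 2 ≤ N) (hlam : 0 < lam)
    {f : List (Interaction N) → ℕ → ℝ≥0∞} (hf : ∀ k, Measurable fun es => f es k)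
    (C : Finset (Fin N)) {L : ℝ → List (Interaction N)} (hL : Measurable L) (k : ℕ) :
    Measurable fun s => exploreValue lam T f s C (L s) k := by
  obtain ⟨g, hg⟩ : ∃ g : (Stage N × ℕ) × List (Interaction N) → ℝ≥0∞, ∀ p, g p =
      ∫⁻ ω, f (exploredList lam T p.1.1 ω ++ p.2)
        ((loopStepsFrom lam T p.1.1 ω).ncard + p.1.2) ∂noiseLaw N := ⟨_, fun _ => rfl⟩
  have hgm : Measurable g := by
    rw [funext hg]
    exact (measurable_exploreValue_integrand hN hlam hf).lintegral_prod_right'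
  have e : (fun s => exploreValue lam T f s C (L s) k) =
      fun s => g ((⟨((T - s : ℝ) : EReal), C⟩, k), L s) := by
    funext s
    rw [hg]
    rfl
  rw [e]
  exact hgm.comp (((measurable_stage_mk T C).prodMk measurable_const).prodMk hL)

lemma measurable_cons_interaction (i j : Fin N) (es : List (Interaction N)) :
    Measurable fun s : ℝ => (s.toNNReal, i, j) :: es :=
  Measurable.list_cons (by fun_prop) measurable_const

/-- The decomposition of the value of the exploration at its first step. -/
lemma exploreValue_eq (hN : 2 ≤ N) (hlam : 0 < lam) {c : ℝ≥0} (hc : lam = 2 * c * (N - 1))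
    {f : List (Interaction N) → ℕ → ℝ≥0∞} (hf : ∀ k, Measurable fun es => f es k) {t : ℝ}
    (ht : 0 ≤ t) {C : Finset (Fin N)} (hC : C.Nonempty) (es : List (Interaction N)) (k : ℕ) :
    exploreValue lam T f t C es k = ENNReal.ofReal (Real.exp (-(exploreRate c C * t))) * f es k +
      ∫⁻ s in Icc 0 t, ENNReal.ofReal (Real.exp (-(exploreRate c C * (t - s)))) *
        (c * (2 * ∑ i ∈ C, ∑ j ∈ Cᶜ,
            exploreValue lam T f s (insert j C) ((s.toNNReal, i, j) :: es) k +
          ∑ i ∈ C, ∑ j ∈ C.erase i,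
            exploreValue lam T f s C ((s.toNNReal, i, j) :: es) (k + 1))) := by
  have hτ : (T : ℝ) - t ≤ T := by linarith
  obtain ⟨σ, hσ⟩ : ∃ σ : Stage N, σ = ⟨((T - t : ℝ) : EReal), C⟩ := ⟨_, rfl⟩
  have hint : Measurable fun ω : ℕ → StepNoise N => f (exploredList lam T σ ω ++ es)
      ((loopStepsFrom lam T σ ω).ncard + k) :=
    (measurable_exploreValue_integrand (lam := lam) (T := T) hN hlam hf).comp
      (f := fun ω : ℕ → StepNoise N => (((σ, k), es), ω)) measurable_prodMk_left
  have hH : Measurable fun ν : StepNoise N => ∫⁻ ω, f (exploredList lam T σ (consSeq ν ω) ++ es)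
      ((loopStepsFrom lam T σ (consSeq ν ω)).ncard + k) ∂noiseLaw N :=
    (hint.comp measurable_consSeq).lintegral_prod_right'
  rw [exploreValue, ← hσ, lintegral_noiseLaw hint]
  rw [lintegral_firstStep hN hlam hτ hC (f es k)
    (G₁ := fun s i j => exploreValue lam T f s (insert j C) ((s.toNNReal, i, j) :: es) k)
    (G₂ := fun s i j => exploreValue lam T f s C ((s.toNNReal, i, j) :: es) (k + 1))
    (fun i j => measurable_exploreValue hN hlam hf _ (measurable_cons_interaction i j es) _)
    (fun i j => measurable_exploreValue hN hlam hf _ (measurable_cons_interaction i j es) _) hH,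
    birthRate_add_loopRate hN hc, sub_sub_cancel]
  · congr 1
    rw [← lintegral_Icc_reflect t]
    refine lintegral_congr fun r => ?_
    rw [birthRate_mul_birthMean hN hc hC, loopRate_mul_loopMean hN hc hC, ← mul_add,
      sub_sub_cancel]
  · intro ν hν
    rw [← hσ] at hν
    have h1 : ∀ ω, f (exploredList lam T σ (consSeq ν ω) ++ es)
        ((loopStepsFrom lam T σ (consSeq ν ω)).ncard + k) = f es k := fun ω => by
      rw [exploredList_consSeq_of_top hν, ncard_loopStepsFrom_consSeq_of_top hν, List.nil_append,
        zero_add]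
    simp [h1]
  · intro ν hν hν'
    obtain ⟨s, hs0, -, hs⟩ := nextTime_eq_coe hN hlam hν
    rw [← hσ] at hν hν' hs
    have hnext := next_of_birth hν hν'
    rw [← hσ, hs, EReal.toReal_coe, sub_sub_cancel, exploreValue]
    have hact : σ.active = C := by rw [hσ]
    rw [hact, hs] at hnext
    have hnl : σ.nextTime lam T ν ≠ σ.loopTime lam T ν := by
      change min _ _ ≠ _
      rw [min_eq_left hν'.le]
      exact hν'.ne
    refine lintegral_congr_ae ?_
    filter_upwards [ae_finite_stepsFrom (T := T) hN hlam hc hs0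
      (Finset.insert_nonempty (ν.2.2.2 Cᶜ) C)] with ω hω
    rw [← hnext.1] at hω ⊢
    rw [exploredList_consSeq hν hω, ncard_loopStepsFrom_consSeq hν hω, if_neg hnl, add_zero,
      hs, EReal.toReal_coe, sub_sub_cancel, hnext.2, List.append_assoc, List.singleton_append,
      Stage.chosenR, hact]
  · intro ν hν hν'
    obtain ⟨s, hs0, -, hs⟩ := nextTime_eq_coe hN hlam hν
    rw [← hσ] at hν hν' hs
    have hnext := next_of_loop hν'
    rw [← hσ, hs, EReal.toReal_coe, sub_sub_cancel, exploreValue]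
    have hact : σ.active = C := by rw [hσ]
    rw [hact, hs] at hnext
    have hnl : σ.nextTime lam T ν = σ.loopTime lam T ν := min_eq_right hν'.le
    refine lintegral_congr_ae ?_
    filter_upwards [ae_finite_stepsFrom (T := T) hN hlam hc hs0 hC] with ω hω
    rw [← hnext.1] at hω ⊢
    rw [exploredList_consSeq hν hω, ncard_loopStepsFrom_consSeq hν hω, if_pos hnl,
      hs, EReal.toReal_coe, sub_sub_cancel, hnext.2, List.append_assoc, List.singleton_append,
      Stage.chosenR, hact, add_right_comm, add_assoc]

/-- The integral equation of the exploration. -/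
lemma exp_mul_exploreValue_eq (hN : 2 ≤ N) (hlam : 0 < lam) {c R : ℝ≥0}
    (hc : lam = 2 * c * (N - 1)) (hR : ∀ C : Finset (Fin N), exploreRate c C ≤ R)
    {f : List (Interaction N) → ℕ → ℝ≥0∞} (hf : ∀ k, Measurable fun es => f es k) {t : ℝ}
    (ht : 0 ≤ t) {C : Finset (Fin N)} (hC : C.Nonempty) (es : List (Interaction N)) (k : ℕ) :
    ENNReal.ofReal (Real.exp (R * t)) * exploreValue lam T f t C es k =
      f es k + ∫⁻ s in Icc 0 t, exploreGen R c (fun s C es k =>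
        ENNReal.ofReal (Real.exp (R * s)) * exploreValue lam T f s C es k) s C es k := by
  have hm : ∀ D i j k, Measurable fun s : ℝ => ENNReal.ofReal (Real.exp (R * s)) *
      exploreValue lam T f s D ((s.toNNReal, i, j) :: es) k := fun D i j k =>
    Measurable.mul (by fun_prop)
      (measurable_exploreValue hN hlam hf D (measurable_cons_interaction i j es) k)
  have hb : Measurable fun s : ℝ => c * (2 * ∑ i ∈ C, ∑ j ∈ Cᶜ,
      ENNReal.ofReal (Real.exp (R * s)) *
        exploreValue lam T f s (insert j C) ((s.toNNReal, i, j) :: es) k +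
      ∑ i ∈ C, ∑ j ∈ C.erase i, ENNReal.ofReal (Real.exp (R * s)) *
        exploreValue lam T f s C ((s.toNNReal, i, j) :: es) (k + 1)) :=
    (((Finset.measurable_fun_sum _ fun i _ => Finset.measurable_fun_sum _ fun j _ =>
      hm (insert j C) i j k).const_mul 2).add
      (Finset.measurable_fun_sum _ fun i _ => Finset.measurable_fun_sum _ fun j _ =>
        hm C i j (k + 1))).const_mul _
  refine variation_of_constants (y := fun s => ENNReal.ofReal (Real.exp (R * s)) *
    exploreValue lam T f s C es k) (R - exploreRate c C) (f es k) hb (fun s hs => ?_) ht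
  have hsub : ((R - exploreRate c C : ℝ≥0) : ℝ) = R - exploreRate c C := NNReal.coe_sub (hR C)
  rw [exploreValue_eq hN hlam hc hf hs hC, mul_add, ← mul_assoc,
    ← ENNReal.ofReal_mul (Real.exp_nonneg _), ← Real.exp_add, hsub,
    ← lintegral_const_mul' _ _ ENNReal.ofReal_ne_top]
  congr 1
  · congr 3
    ring
  · refine lintegral_congr fun u => ?_
    have e : ENNReal.ofReal (Real.exp (R * s)) *
        ENNReal.ofReal (Real.exp (-(exploreRate c C * (s - u)))) =
        ENNReal.ofReal (Real.exp ((R - exploreRate c C) * (s - u))) *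
          ENNReal.ofReal (Real.exp (R * u)) := by
      rw [← ENNReal.ofReal_mul (Real.exp_nonneg _), ← ENNReal.ofReal_mul (Real.exp_nonneg _),
        ← Real.exp_add, ← Real.exp_add]
      congr 2
      ring
    rw [← mul_assoc, e]
    simp only [← Finset.mul_sum]
    ring

end ExplorationValue

/-! ### The particle system and the backward system -/

section Identity

variable {N : ℕ} [NeZero N]

/-- The interactions of the particle system during the remaining time followed by those already
found, and the interactions found by the exploration, satisfy the same equation. Hence functionals
which depend only on the interactions of the ancestors have the same expectations. -/
lemma forwardValue_eq_exploreValue (hN : 2 ≤ N) {lam : ℝ} (hlam : 0 < lam) {c : ℝ≥0}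
    (hc : lam = 2 * c * (N - 1)) {f : List (Interaction N) → ℝ≥0∞} (hf : Measurable f)
    (hf1 : ∀ l, f l ≤ 1) {C₀ : Finset (Fin N)} (hC₀ : C₀.Nonempty)
    (hswap : ∀ (t : ℝ≥0) (i j : Fin N) (l es : List (Interaction N)), i ≠ j →
      f (l ++ (t, i, j) :: es) = f (l ++ (t, j, i) :: es))
    (hprune : ∀ (t : ℝ≥0) (i j : Fin N) (l es : List (Interaction N)), i ∉ ancestors C₀ es →
      j ∉ ancestors C₀ es → StrictlySorted (l ++ (t, i, j) :: es) →
      f (l ++ (t, i, j) :: es) = f (l ++ es))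
    (σ : Equiv.Perm (Fin N)) (T : ℝ≥0) :
    forwardValue (2 * c) f σ T [] =
      ENNReal.ofReal (Real.exp ((c * (N * (N - 1) : ℕ) : ℝ≥0) * T)) *
        exploreValue lam T (fun es _ => f es) T C₀ [] 0 := by
  let Inv : ℝ → Finset (Fin N) → List (Interaction N) → Prop := fun t C es =>
    Explored C₀ t C es ∧ C.Nonempty
  have hmono : ∀ s t C es, Inv t C es → s ≤ t → Inv s C es := fun s t C es h hst =>
    ⟨h.1.mono hst, h.2⟩
  have hcons : ∀ s t C es i j, Inv t C es → 0 ≤ s → s < t → i ∈ C →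
      Inv s (insert j C) ((s.toNNReal, i, j) :: es) := fun s t C es i j h h0 hst hi =>
    ⟨h.1.cons h0 hst hi, Finset.insert_nonempty _ _⟩
  have hinv : Inv T C₀ [] := ⟨⟨rfl, List.Pairwise.nil, by simp⟩, hC₀⟩
  have hT : (T : ℝ) ∈ Icc (0 : ℝ) T := ⟨T.2, le_rfl⟩
  have hfwd : ∀ t ∈ Icc (0 : ℝ) T, ∀ C es (k : ℕ), Inv t C es → forwardValue (2 * c) f σ t es =
      f es + ∫⁻ s in Icc 0 t, exploreGen (c * (N * (N - 1) : ℕ)) c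
        (fun s _ es _ => forwardValue (2 * c) f σ s es) s C es k :=
    fun t _ C es k h => forwardValue_eq hf hswap hprune σ h.1 k
  have hexp : ∀ t ∈ Icc (0 : ℝ) T, ∀ C es (k : ℕ), Inv t C es → _ :=
    fun t ht C es k h => exp_mul_exploreValue_eq (T := T) hN hlam hc (exploreRate_le c)
      (f := fun es _ => f es) (fun _ => hf) ht.1 h.2 es k
  -- both sides are bounded solutions, hence subsolutions and supersolutions
  refine le_antisymm ?_ ?_
  · refine le_of_exploreGen (exploreRate_le c) hmono hcons (f := fun es _ => f es)
      (y := fun t _ es _ => forwardValue (2 * c) f σ t es)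
      (z := fun t C es k => ENNReal.ofReal (Real.exp ((c * (N * (N - 1) : ℕ) : ℝ≥0) * t)) *
        exploreValue lam T (fun es _ => f es) t C es k)
      (M := ENNReal.ofReal (Real.exp ((2 * c : ℝ≥0) * T)) ^ Fintype.card (Pair N))
      (ENNReal.pow_ne_top ENNReal.ofReal_ne_top) ?_ (fun t ht C es k h => (hfwd t ht C es k h).le)
      (fun t ht C es k h => (hexp t ht C es k h).ge) hT 0 hinv
    intro t ht C es k _
    calc forwardValue (2 * c) f σ t es ≤ ∫⁻ _, 1 ∂pairsRaw N ((2 * c : ℝ≥0) : ℝ) t :=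
          lintegral_mono fun ω => hf1 _
      _ = ENNReal.ofReal (Real.exp ((2 * c : ℝ≥0) * t)) ^ Fintype.card (Pair N) := by
          rw [lintegral_one, Measure.pi_univ, Finset.prod_const,
            poissonRaw_univ (NNReal.coe_nonneg _) ht.1, Finset.card_univ]
      _ ≤ _ := by
          refine pow_le_pow_left' (ENNReal.ofReal_le_ofReal (Real.exp_le_exp.2 ?_)) _
          exact mul_le_mul_of_nonneg_left ht.2 (NNReal.coe_nonneg _)
  · refine le_of_exploreGen (exploreRate_le c) hmono hcons (f := fun es _ => f es)
      (y := fun t C es k => ENNReal.ofReal (Real.exp ((c * (N * (N - 1) : ℕ) : ℝ≥0) * t)) *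
        exploreValue lam T (fun es _ => f es) t C es k)
      (z := fun t _ es _ => forwardValue (2 * c) f σ t es)
      (M := ENNReal.ofReal (Real.exp ((c * (N * (N - 1) : ℕ) : ℝ≥0) * T)) * 1)
      (ENNReal.mul_ne_top ENNReal.ofReal_ne_top ENNReal.one_ne_top) ?_
      (fun t ht C es k h => (hexp t ht C es k h).le)
      (fun t ht C es k h => (hfwd t ht C es k h).ge) hT 0 hinv
    intro t ht C es k _
    refine mul_le_mul' (ENNReal.ofReal_le_ofReal (Real.exp_le_exp.2
      (mul_le_mul_of_nonneg_left ht.2 (NNReal.coe_nonneg _)))) ?_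
    exact (lintegral_mono fun ω => hf1 _).trans (by simp)

/-- A functional of the list of the interactions that depends only on those of the ancestors of the
first `q` particles has the same expectation for the particle system, whatever the names of the
particles, and for the backward system. -/
lemma lintegral_poissonProcess_interactions (hN : 2 ≤ N) {lam : ℝ} (hlam : 0 < lam)
    {f : List (Interaction N) → ℝ≥0∞} (hf : Measurable f)
    (hf1 : ∀ l, f l ≤ 1) {q : ℕ} (hq : 1 ≤ q)
    (hswap : ∀ (t : ℝ≥0) (i j : Fin N) (l es : List (Interaction N)), i ≠ j →
      f (l ++ (t, i, j) :: es) = f (l ++ (t, j, i) :: es))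
    (hprune : ∀ (t : ℝ≥0) (i j : Fin N) (l es : List (Interaction N)),
      i ∉ ancestors (firstParticles q N) es → j ∉ ancestors (firstParticles q N) es →
      StrictlySorted (l ++ (t, i, j) :: es) → f (l ++ (t, i, j) :: es) = f (l ++ es))
    (σ : Equiv.Perm (Fin N)) (T : ℝ≥0) :
    ∫⁻ ω, f ((interactions ω).map (relabel σ))
        ∂(Measure.pi fun _ : Pair N => poissonProcess (lam / (N - 1)) T) =
      ∫⁻ ω, f (backwardInteractions lam T q ω) ∂noiseLaw N := by
  have h2 : (2 : ℝ) ≤ N := by exact_mod_cast hN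
  have h3 : (N : ℝ) - 1 ≠ 0 := by linarith
  have h4 : 0 ≤ lam / (2 * (N - 1)) := div_nonneg hlam.le (by linarith)
  obtain ⟨c, hc⟩ : ∃ c : ℝ≥0, (c : ℝ) = lam / (2 * (N - 1)) := ⟨⟨_, h4⟩, rfl⟩
  have hc' : lam = 2 * c * (N - 1) := by rw [hc]; field_simp
  have hc2 : lam / (N - 1) = ((2 * c : ℝ≥0) : ℝ) := by push_cast; rw [hc]; field_simp
  have hC₀ : (firstParticles q N).Nonempty := ⟨0, by
    simp only [firstParticles, Finset.mem_filter, Finset.mem_univ, true_and, Fin.val_zero]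
    omega⟩
  have e0 : ((T - T : ℝ) : EReal) = 0 := by simp
  have key := forwardValue_eq_exploreValue hN hlam hc' hf hf1 hC₀ hswap hprune σ T
  -- the function `1` identifies the normalising constant
  have one := forwardValue_eq_exploreValue hN hlam hc' (f := fun _ => 1) measurable_const
    (fun _ => le_rfl) hC₀ (fun _ _ _ _ _ _ => rfl) (fun _ _ _ _ _ _ _ _ => rfl) σ T
  simp only [forwardValue, exploreValue, e0, exploredList_init, List.append_nil] at key one
  rw [lintegral_one, lintegral_one, Measure.pi_univ, Finset.prod_const,
    poissonRaw_univ (NNReal.coe_nonneg _) T.coe_nonneg, Finset.card_univ,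
    measure_univ (μ := noiseLaw N), mul_one] at one
  rw [hc2, pi_poissonProcess, lintegral_smul_measure, key, ← one, smul_eq_mul, ← mul_assoc,
    ← mul_pow, ← ENNReal.ofReal_mul (Real.exp_nonneg _), ← Real.exp_add]
  simp

end Identity

lemma measurable_loops {q N : ℕ} (T : ℝ≥0) (hN : 1 ≤ N) {lam : ℝ} (hlam : 0 ≤ lam) :
    Measurable fun ω : ℕ → StepNoise N => loops lam T q ω := by
  simp only [← ncard_loopStepsFrom_init]
  exact Measurable.of_uncurry_left (f := fun σ ω => (loopStepsFrom lam T σ ω).ncard)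
    (measurable_ncard_loopStepsFrom T hN hlam)

namespace ParticleModel

variable (M : ParticleModel d) {q N : ℕ} [NeZero N] (hqN : q ≤ N) (T : ℝ≥0)

lemma measurable_backwardInteractions (hN : 1 ≤ N) {lam : ℝ} (hlam : 0 ≤ lam) :
    Measurable fun ω : ℕ → StepNoise N => backwardInteractions lam T q ω := by
  simp only [← exploredList_init]
  exact Measurable.of_uncurry_left (f := exploredList lam T) (measurable_exploredList T hN hlam)

lemma measurable_backward_kernel (hN : 1 ≤ N) : Measurable fun ω : ℕ → StepNoise N =>
    (M.trajectories T (backwardInteractions M.rate T q ω)).map fun z =>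
      (loops M.rate T q ω, fun i => z (Fin.castLE hqN i)) := by
  refine measurable_map_param (κ := fun ω : ℕ → StepNoise N =>
    M.trajectories T (backwardInteractions M.rate T q ω))
    (g := fun p : (ℕ → StepNoise N) × (Fin N → PathOn T d) =>
      (loops M.rate T q p.1, fun i => p.2 (Fin.castLE hqN i)))
    ((M.measurable_trajectories T).comp (measurable_backwardInteractions T hN M.rate_pos.le))
    (fun ω => inferInstance) ?_
  exact ((measurable_loops T hN M.rate_pos.le).comp measurable_fst).prodMk (by fun_prop)

lemma isProbabilityMeasure_backwardLaw (hN : 1 ≤ N) :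
    IsProbabilityMeasure (M.backwardLaw q N hqN T) :=
  isProbabilityMeasure_bind (M.measurable_backward_kernel hqN T hN) fun _ =>
    Measure.isProbabilityMeasure_map
      (measurable_const.prodMk (measurable_pi_lambda _ fun _ => measurable_pi_apply _)).aemeasurable

lemma measurable_system_kernel :
    Measurable fun ω : Pair N → Points => M.trajectories T (interactions ω) :=
  (M.measurable_trajectories T).comp measurable_interactions

/-- The trajectories of any `q` particles of the particle system have the same law as those of the
first `q` particles of the backward system. -/
lemma systemLaw_map_eq (hN : 2 ≤ N) (hq : 1 ≤ q) (a : Fin q ↪ Fin N) :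
    (M.systemLaw N T).map (fun z i => z (a i)) = (M.backwardLaw q N hqN T).map Prod.snd := by
  classical
  -- a permutation that sends the first `q` particles to the chosen ones
  obtain ⟨σ, hσ⟩ : ∃ σ : Equiv.Perm (Fin N), ∀ i, σ (Fin.castLE hqN i) = a i := by
    obtain ⟨σ, hσ⟩ := Equiv.Perm.exists_extending_pair _ _ (Fin.castLE_injective hqN) a.injective
    exact ⟨σ, fun i => hσ i⟩
  have hma : Measurable fun (z : Fin N → PathOn T d) i => z (a i) := by fun_prop
  have hmc : Measurable fun (z : Fin N → PathOn T d) i => z (Fin.castLE hqN i) := by fun_prop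
  ext B hB
  let G : (Fin N → PathOn T d) → ℝ≥0∞ := fun z =>
    B.indicator 1 fun i => z (Fin.castLE hqN i)
  have hG : Measurable G := (measurable_one.indicator hB).comp hmc
  let f : List (Interaction N) → ℝ≥0∞ := fun l => ∫⁻ z, G z ∂M.trajectories T l
  have hf : Measurable f := (Measure.measurable_lintegral hG).comp (M.measurable_trajectories T)
  have hG1 : ∀ z, G z ≤ 1 := fun z => indicator_le_self' (fun _ _ => zero_le) _
  have hf1 : ∀ l, f l ≤ 1 := fun l => (lintegral_mono hG1).trans (by simp)
  have hd : DependsOn G (firstParticles q N : Set (Fin N)) := fun z z' h => by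
    simp only [G]
    congr 1
    funext i
    exact h _ (by simp [firstParticles])
  rw [Measure.map_apply hma hB, systemLaw, Measure.bind_apply (hma hB)
    (M.measurable_system_kernel T).aemeasurable, Measure.map_apply measurable_snd hB, backwardLaw,
    Measure.bind_apply (measurable_snd hB)
      (M.measurable_backward_kernel hqN T (by omega)).aemeasurable]
  have e1 : ∀ ω : Pair N → Points, M.trajectories T (interactions ω) ((fun z i => z (a i)) ⁻¹' B) =
      f ((interactions ω).map (relabel σ⁻¹)) := fun ω => by
    simp only [f]
    rw [M.lintegral_trajectories_relabel _ T _ hG, ← lintegral_indicator_one (hma hB)]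
    refine lintegral_congr fun z => ?_
    have : ∀ i, (σ⁻¹).symm (Fin.castLE hqN i) = a i := hσ
    simp only [G, this]
    rfl
  have e2 : ∀ ω, ((M.trajectories T (backwardInteractions M.rate T q ω)).map fun z =>
      (loops M.rate T q ω, fun i => z (Fin.castLE hqN i))) (Prod.snd ⁻¹' B) =
      f (backwardInteractions M.rate T q ω) := fun ω => by
    have hm : Measurable fun z : Fin N → PathOn T d =>
        (loops M.rate T q ω, fun i => z (Fin.castLE hqN i)) := measurable_const.prodMk hmc
    rw [Measure.map_apply hm (measurable_snd hB),
      ← lintegral_indicator_one (hm (measurable_snd hB))]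
    rfl
  simp only [e1, e2]
  exact lintegral_poissonProcess_interactions hN M.rate_pos hf hf1 hq
    (fun t i j l es hij => by simp only [f, M.trajectories_swap hij])
    (fun t i j l es hi hj hs => M.lintegral_trajectories_prune hi hj hG hd hs) σ⁻¹ T

end ParticleModel

/-! ### Yule processes -/

section Yule

/-- The probability that a Yule process of parameter `lam` started from `K` has made `n` jumps at
time `t`: the law of the number of jumps is negative binomial. -/
def yuleWeight (lam t : ℝ) (K n : ℕ) : ℝ :=
  Real.exp (-(lam * K * t)) * (K.multichoose n * (1 - Real.exp (-(lam * t))) ^ n)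

/-- The expectation of `φ` at time `t` of a Yule process of parameter `lam` started from `K`. -/
def yuleMean (lam t : ℝ) (K : ℕ) (φ : ℕ → ℝ≥0∞) : ℝ≥0∞ :=
  ∑' n, ENNReal.ofReal (yuleWeight lam t K n) * φ (K + n)

lemma one_sub_exp_nonneg {lam t : ℝ} (hlam : 0 ≤ lam) (ht : 0 ≤ t) :
    0 ≤ 1 - Real.exp (-(lam * t)) :=
  sub_nonneg.2 (Real.exp_le_one_iff.2 (neg_nonpos.2 (mul_nonneg hlam ht)))

lemma yuleWeight_nonneg {lam t : ℝ} (hlam : 0 ≤ lam) (ht : 0 ≤ t) (K n : ℕ) :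
    0 ≤ yuleWeight lam t K n :=
  mul_nonneg (Real.exp_nonneg _)
    (mul_nonneg (Nat.cast_nonneg _) (pow_nonneg (one_sub_exp_nonneg hlam ht) _))

lemma continuous_yuleWeight (lam : ℝ) (K n : ℕ) : Continuous fun t => yuleWeight lam t K n := by
  unfold yuleWeight; fun_prop

lemma measurable_yuleMean (lam : ℝ) (K : ℕ) (φ : ℕ → ℝ≥0∞) :
    Measurable fun t => yuleMean lam t K φ :=
  Measurable.tsum fun n =>
    (continuous_yuleWeight lam K n).measurable.ennreal_ofReal.mul_const _

lemma multichoose_succ_mul (K n : ℕ) :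
    K.multichoose (n + 1) * (n + 1) = K * (K + 1).multichoose n := by
  rw [Nat.multichoose_eq, Nat.multichoose_eq, show K + (n + 1) - 1 = K + n by omega,
    show K + 1 + n - 1 = K + n by omega, Nat.choose_succ_right_eq, Nat.add_sub_cancel, mul_comm]

/-- The first jump of a Yule process started from `K` occurs after an exponential time of parameter
`lam * K`. -/
lemma lintegral_yuleWeight {lam t : ℝ} (hlam : 0 ≤ lam) (ht : 0 ≤ t) (K n : ℕ) :
    ∫⁻ r in Icc 0 t, ENNReal.ofReal (lam * K * Real.exp (-(lam * K * r))) *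
        ENNReal.ofReal (yuleWeight lam (t - r) (K + 1) n) =
      ENNReal.ofReal (yuleWeight lam t K (n + 1)) := by
  have h := lintegral_Ioc_deriv
    (F := fun s => Real.exp (-(lam * K * t)) *
      (K.multichoose (n + 1) * (1 - Real.exp (-(lam * s))) ^ (n + 1)))
    (F' := fun s => lam * K * Real.exp (-(lam * K * (t - s))) * yuleWeight lam s (K + 1) n)
    ht (fun s => ?_)
    (Continuous.mul (by fun_prop) (continuous_yuleWeight lam (K + 1) n)) (fun s hs => ?_)
  · simp only [mul_zero, neg_zero, Real.exp_zero, sub_self, ne_eq, Nat.add_eq_zero_iff,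
      one_ne_zero, and_false, not_false_eq_true, zero_pow, sub_zero] at h
    rw [yuleWeight, ← h, ← lintegral_Icc_eq_Ioc, ← lintegral_Icc_reflect]
    refine setLIntegral_congr_fun measurableSet_Icc fun s hs => ?_
    rw [sub_sub_cancel, ← ENNReal.ofReal_mul (by positivity)]
  · have h1 := ((((((hasDerivAt_id s).const_mul lam).neg.exp).const_sub 1).pow (n + 1)).const_mul
      (K.multichoose (n + 1) : ℝ)).const_mul (Real.exp (-(lam * K * t)))
    refine h1.congr_deriv ?_
    have h2 : ((K.multichoose (n + 1) : ℕ) : ℝ) * (n + 1) = K * (K + 1).multichoose n := by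
      exact_mod_cast multichoose_succ_mul K n
    have h3 : Real.exp (-(lam * K * (t - s))) * Real.exp (-(lam * (K + 1 : ℕ) * s)) =
        Real.exp (-(lam * K * t)) * Real.exp (-(lam * s)) := by
      rw [← Real.exp_add, ← Real.exp_add]
      congr 1
      push_cast
      ring
    simp only [id_eq, Nat.add_sub_cancel, mul_one, yuleWeight, Pi.neg_apply]
    push_cast at h3 ⊢
    linear_combination (-(lam * K * ((K + 1).multichoose n : ℝ) *
      (1 - Real.exp (-(lam * s))) ^ n)) * h3 + Real.exp (-(lam * K * t)) *
      (1 - Real.exp (-(lam * s))) ^ n * lam * Real.exp (-(lam * s)) * h2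
  · exact mul_nonneg (by positivity) (yuleWeight_nonneg hlam hs.1.le _ _)

lemma yuleWeight_zero (lam t : ℝ) (K : ℕ) :
    yuleWeight lam t K 0 = Real.exp (-(lam * K * t)) := by
  simp [yuleWeight, Nat.multichoose_zero_right]

/-- Decomposition of the Yule process at its first jump. -/
lemma yuleMean_eq {lam t : ℝ} (hlam : 0 ≤ lam) (ht : 0 ≤ t) (K : ℕ) (φ : ℕ → ℝ≥0∞) :
    yuleMean lam t K φ = ENNReal.ofReal (Real.exp (-(lam * K * t))) * φ K +
      ∫⁻ s in Icc 0 t, ENNReal.ofReal (lam * K * Real.exp (-(lam * K * (t - s)))) *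
        yuleMean lam s (K + 1) φ := by
  rw [yuleMean, tsum_eq_zero_add' ENNReal.summable, yuleWeight_zero, add_zero,
    ← lintegral_Icc_reflect]
  congr 1
  simp only [sub_sub_cancel, yuleMean, ← ENNReal.tsum_mul_left]
  rw [lintegral_tsum fun n => by
    have := (continuous_yuleWeight lam (K + 1) n).measurable
    fun_prop]
  refine tsum_congr fun n => ?_
  rw [← lintegral_yuleWeight hlam ht, ← lintegral_mul_const]
  · refine lintegral_congr fun s => ?_
    rw [mul_assoc, show K + 1 + n = K + (n + 1) by ring]
  · have := (continuous_yuleWeight lam (K + 1) n).measurable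
    fun_prop

/-- The backward equation of the Yule process, whose generator is
`φ ↦ lam * K * (φ (K + 1) - φ K)`. -/
lemma exp_mul_yuleMean_eq (lam R : ℝ≥0) {t : ℝ} (ht : 0 ≤ t) {K : ℕ} (hK : lam * K ≤ R)
    (φ : ℕ → ℝ≥0∞) :
    ENNReal.ofReal (Real.exp (R * t)) * yuleMean lam t K φ =
      φ K + ∫⁻ s in Icc 0 t,
        ((lam * K : ℝ≥0) * (ENNReal.ofReal (Real.exp (R * s)) * yuleMean lam s (K + 1) φ) +
          (R - lam * K : ℝ≥0) * (ENNReal.ofReal (Real.exp (R * s)) * yuleMean lam s K φ)) := by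
  have hb : Measurable fun s => ((lam * K : ℝ≥0) : ℝ≥0∞) *
      (ENNReal.ofReal (Real.exp (R * s)) * yuleMean lam s (K + 1) φ) := by
    have := measurable_yuleMean lam (K + 1) φ
    fun_prop
  have hr : ((R - lam * K : ℝ≥0) : ℝ) = R - lam * K := by
    rw [NNReal.coe_sub hK]; simp
  refine variation_of_constants (R - lam * K) (φ K) hb
    (y := fun s => ENNReal.ofReal (Real.exp (R * s)) * yuleMean lam s K φ) (fun s hs => ?_) ht
  rw [yuleMean_eq lam.coe_nonneg hs, mul_add, ← mul_assoc,
    ← ENNReal.ofReal_mul (Real.exp_nonneg _), ← Real.exp_add, hr, ← lintegral_const_mul']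
  · congr 1
    · congr 3; ring
    · refine lintegral_congr fun u => ?_
      rw [← ENNReal.ofReal_coe_nnreal, ← mul_assoc, ← mul_assoc, ← mul_assoc,
        ← ENNReal.ofReal_mul (Real.exp_nonneg _), ← ENNReal.ofReal_mul (Real.exp_nonneg _),
        ← ENNReal.ofReal_mul (by positivity)]
      congr 2
      have : Real.exp (R * s) * Real.exp (-(lam * K * (s - u))) =
          Real.exp ((R - lam * K) * (s - u)) * Real.exp (R * u) := by
        rw [← Real.exp_add, ← Real.exp_add]; congr 1; ring
      push_cast
      linear_combination (lam * K : ℝ) * this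
  · exact ENNReal.ofReal_ne_top

lemma tsum_yuleWeight_one {lam t : ℝ} (hlam : 0 ≤ lam) (ht : 0 ≤ t) :
    ∑' n, ENNReal.ofReal (yuleWeight lam t 1 n) = 1 := by
  have h : ∀ n, ENNReal.ofReal (yuleWeight lam t 1 n) = ENNReal.ofReal (Real.exp (-(lam * t))) *
      ENNReal.ofReal (1 - Real.exp (-(lam * t))) ^ n := fun n => by
    rw [← ENNReal.ofReal_pow (one_sub_exp_nonneg hlam ht),
      ← ENNReal.ofReal_mul (Real.exp_nonneg _), yuleWeight]
    simp
  simp only [h]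
  rw [ENNReal.tsum_mul_left, ENNReal.tsum_geometric, ← ENNReal.ofReal_one,
    ← ENNReal.ofReal_sub _ (one_sub_exp_nonneg hlam ht), sub_sub_cancel]
  exact (ENNReal.mul_inv_cancel (by simp [Real.exp_pos]) ENNReal.ofReal_ne_top).trans (by simp)

/-- Among the multisets of size `n` on `K + 1` symbols, `K.multichoose i` contain a given symbol
exactly `n - i` times. -/
lemma sum_antidiagonal_multichoose (K n : ℕ) :
    ∑ p ∈ Finset.HasAntidiagonal.antidiagonal n, K.multichoose p.1 = (K + 1).multichoose n := by
  rw [Finset.Nat.sum_antidiagonal_eq_sum_range_succ_mk, Nat.sum_range_multichoose,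
    Nat.multichoose_eq, show K + 1 + n - 1 = n + K by omega, Nat.choose_symm_add]

/-- A Yule process started from `K + 1` is the sum of independent Yule processes started from `1`
and `K`. -/
lemma yuleMean_succ {lam t : ℝ} (hlam : 0 ≤ lam) (ht : 0 ≤ t) (K : ℕ) (φ : ℕ → ℝ≥0∞) :
    yuleMean lam t (K + 1) φ = yuleMean lam t 1 fun a => yuleMean lam t K fun x => φ (a + x) := by
  have h0 : 0 ≤ 1 - Real.exp (-(lam * t)) := one_sub_exp_nonneg hlam ht
  have e1 : yuleMean lam t 1 (fun a => yuleMean lam t K fun x => φ (a + x)) =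
      ∑' p : ℕ × ℕ, ENNReal.ofReal (Real.exp (-(lam * (K + 1 : ℕ) * t)) *
        (K.multichoose p.1 * (1 - Real.exp (-(lam * t))) ^ (p.1 + p.2))) *
          φ (K + 1 + (p.1 + p.2)) := by
    rw [ENNReal.tsum_prod', ENNReal.tsum_comm, yuleMean]
    refine tsum_congr fun a => ?_
    rw [yuleMean, ← ENNReal.tsum_mul_left]
    refine tsum_congr fun n => ?_
    rw [← mul_assoc, ← ENNReal.ofReal_mul (yuleWeight_nonneg hlam ht _ _),
      show 1 + a + (K + n) = K + 1 + (n + a) by ring]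
    congr 2
    have : Real.exp (-(lam * (K + 1 : ℕ) * t)) =
        Real.exp (-(lam * (1 : ℕ) * t)) * Real.exp (-(lam * K * t)) := by
      rw [← Real.exp_add]; congr 1; push_cast; ring
    rw [this, yuleWeight, yuleWeight, Nat.multichoose_one, pow_add]
    push_cast
    ring
  rw [e1, ← Finset.HasAntidiagonal.sigmaAntidiagonalEquivProd.tsum_eq, ENNReal.tsum_sigma',
    yuleMean]
  refine tsum_congr fun n => ?_
  rw [tsum_fintype]
  simp only [Finset.HasAntidiagonal.sigmaAntidiagonalEquivProd_apply]
  rw [Finset.sum_coe_sort (Finset.HasAntidiagonal.antidiagonal n) fun p : ℕ × ℕ =>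
    ENNReal.ofReal (Real.exp (-(lam * (K + 1 : ℕ) * t)) *
      (K.multichoose p.1 * (1 - Real.exp (-(lam * t))) ^ (p.1 + p.2))) * φ (K + 1 + (p.1 + p.2)),
    Finset.sum_congr rfl fun p hp => by rw [Finset.HasAntidiagonal.mem_antidiagonal.1 hp],
    ← Finset.sum_mul, ← ENNReal.ofReal_sum_of_nonneg fun p _ => by positivity,
    ← Finset.mul_sum, ← Finset.sum_mul,
    yuleWeight, ← sum_antidiagonal_multichoose]
  push_cast
  rfl

lemma yuleMean_mono {lam t : ℝ} {K : ℕ} {φ ψ : ℕ → ℝ≥0∞} (h : ∀ n, φ n ≤ ψ n) :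
    yuleMean lam t K φ ≤ yuleMean lam t K ψ :=
  ENNReal.tsum_le_tsum fun _ => mul_le_mul_right (h _) _

lemma yuleMean_le_succ {lam t : ℝ} (hlam : 0 ≤ lam) (ht : 0 ≤ t) (K : ℕ) {φ : ℕ → ℝ≥0∞}
    (hφ : Monotone φ) : yuleMean lam t K φ ≤ yuleMean lam t (K + 1) φ := by
  rw [yuleMean_succ hlam ht]
  calc yuleMean lam t K φ = yuleMean lam t 1 fun _ => yuleMean lam t K φ := by
        conv_rhs => rw [yuleMean, ENNReal.tsum_mul_right, tsum_yuleWeight_one hlam ht, one_mul]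
    _ ≤ _ := yuleMean_mono fun a => yuleMean_mono fun x => hφ (Nat.le_add_left _ _)

/-- The moments of a Yule process dominate the powers of its initial value. -/
lemma sq_mul_yuleMean_le (lam t : ℝ) (K m : ℕ) :
    (K : ℝ≥0∞) ^ 2 * yuleMean lam t K (fun x => (x : ℝ≥0∞) ^ (2 * m)) ≤
      yuleMean lam t K fun x => (x : ℝ≥0∞) ^ (2 * (m + 1)) := by
  rw [yuleMean, yuleMean, ← ENNReal.tsum_mul_left]
  refine ENNReal.tsum_le_tsum fun n => ?_
  rw [mul_left_comm]
  refine mul_le_mul_right ?_ _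
  rw [show 2 * (m + 1) = 2 + 2 * m by ring, pow_add]
  exact mul_le_mul_left (pow_le_pow_left' (by exact_mod_cast Nat.le_add_right K n) 2) _

lemma yuleMean_pow_lt_top {lam t : ℝ} (hlam : 0 ≤ lam) (ht : 0 ≤ t) (K m : ℕ) :
    yuleMean lam t K (fun x => (x : ℝ≥0∞) ^ m) < ⊤ := by
  have h0 : 0 ≤ 1 - Real.exp (-(lam * t)) := one_sub_exp_nonneg hlam ht
  have h1 : ‖1 - Real.exp (-(lam * t))‖ < 1 := by
    rw [Real.norm_of_nonneg h0]
    linarith [Real.exp_pos (-(lam * t))]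
  have hs : Summable fun n : ℕ => 2 ^ (K + m - 1) * ((K : ℝ) ^ (K + m) *
      ((n : ℝ) ^ 0 * (1 - Real.exp (-(lam * t))) ^ n) +
      (n : ℝ) ^ (K + m) * (1 - Real.exp (-(lam * t))) ^ n) :=
    (((summable_pow_mul_geometric_of_norm_lt_one 0 h1).mul_left _).add
      (summable_pow_mul_geometric_of_norm_lt_one (K + m) h1)).mul_left _
  refine lt_of_le_of_lt (ENNReal.tsum_le_tsum fun n => ?_) hs.tsum_ofReal_lt_top
  simp only
  rw [← ENNReal.ofReal_natCast, ← ENNReal.ofReal_pow (Nat.cast_nonneg _),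
    ← ENNReal.ofReal_mul (yuleWeight_nonneg hlam ht _ _)]
  refine ENNReal.ofReal_le_ofReal ?_
  have h2 : (K.multichoose n : ℝ) ≤ ((K : ℝ) + n) ^ K := by
    have : K.multichoose n ≤ (K + n) ^ K := by
      rcases Nat.eq_zero_or_pos K with rfl | hK
      · cases n <;> simp
      · rw [Nat.multichoose_eq, ← Nat.choose_symm (by omega),
          show K + n - 1 - n = K - 1 by omega]
        exact (Nat.choose_le_pow _ _).trans ((Nat.pow_le_pow_left (by omega : _ ≤ K + n) _).trans
          (Nat.pow_le_pow_right (by omega) (Nat.sub_le K 1)))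
    exact_mod_cast this
  have h3 : Real.exp (-(lam * K * t)) ≤ 1 :=
    Real.exp_le_one_iff.2 (neg_nonpos.2 (by positivity))
  have h4 := add_pow_le (Nat.cast_nonneg (α := ℝ) K) (Nat.cast_nonneg n) (K + m)
  calc yuleWeight lam t K n * ((K + n : ℕ) : ℝ) ^ m
      ≤ (1 * (((K : ℝ) + n) ^ K * (1 - Real.exp (-(lam * t))) ^ n)) * ((K : ℝ) + n) ^ m := by
        rw [yuleWeight]
        push_cast
        gcongr
    _ = ((K : ℝ) + n) ^ (K + m) * (1 - Real.exp (-(lam * t))) ^ n := by rw [pow_add]; ring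
    _ ≤ (2 ^ (K + m - 1) * ((K : ℝ) ^ (K + m) + (n : ℝ) ^ (K + m))) *
        (1 - Real.exp (-(lam * t))) ^ n := by gcongr
    _ = _ := by ring

/-- The event that a Yule process started from `K`, built from the exponential variables `ξ`, makes
exactly `n` jumps before time `t`. -/
def yuleJumps (lam t : ℝ) (K n : ℕ) : Set (ℕ → ℝ) :=
  {ξ | ∀ k, ∑ i ∈ Finset.range (k + 1), ξ i / (lam * (i + K)) ≤ t ↔ k < n}

lemma measurableSet_yuleJumps (lam t : ℝ) (K n : ℕ) : MeasurableSet (yuleJumps lam t K n) := by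
  simp only [yuleJumps, ofPred_forall]
  refine MeasurableSet.iInter fun k => ?_
  have hm : Measurable fun ξ : ℕ → ℝ =>
      ∑ i ∈ Finset.range (k + 1), ξ i / (lam * (i + K)) := by fun_prop
  by_cases hk : k < n
  · simp only [hk, iff_true]
    exact measurableSet_le hm measurable_const
  · simp only [hk, iff_false]
    exact (measurableSet_le hm measurable_const).compl

lemma sum_consSeq_div (lam a : ℝ) (K k : ℕ) (ξ : ℕ → ℝ) :
    ∑ i ∈ Finset.range (k + 1), consSeq a ξ i / (lam * (i + K)) =
      a / (lam * K) + ∑ i ∈ Finset.range k, ξ i / (lam * (i + (K + 1 : ℕ))) := by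
  rw [Finset.sum_range_succ', add_comm]
  congr 1
  · simp [consSeq]
  · refine Finset.sum_congr rfl fun i _ => ?_
    simp only [consSeq]
    push_cast
    ring_nf

lemma consSeq_mem_yuleJumps_succ {lam t a : ℝ} (K n : ℕ) (ξ : ℕ → ℝ) :
    consSeq a ξ ∈ yuleJumps lam t K (n + 1) ↔
      a / (lam * K) ≤ t ∧ ξ ∈ yuleJumps lam (t - a / (lam * K)) (K + 1) n := by
  simp only [yuleJumps, mem_ofPred_eq, sum_consSeq_div]
  constructor
  · intro h
    refine ⟨by simpa using h 0, fun k => ?_⟩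
    have := h (k + 1)
    rw [Nat.add_lt_add_iff_right] at this
    rw [← this, le_sub_iff_add_le']
  · rintro ⟨h1, h2⟩ k
    cases k with
    | zero => simpa using h1
    | succ k => rw [Nat.add_lt_add_iff_right, ← h2 k, le_sub_iff_add_le']

lemma infinitePi_consSeq {S : Set (ℕ → ℝ)} (hS : MeasurableSet S) :
    Measure.infinitePi (fun _ : ℕ => expMeasure 1) S =
      ∫⁻ a, Measure.infinitePi (fun _ : ℕ => expMeasure 1) {ξ | consSeq a ξ ∈ S} ∂expMeasure 1 := by
  conv_lhs => rw [infinitePi_eq_map_consSeq]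
  rw [Measure.map_apply measurable_consSeq hS, Measure.prod_apply (measurable_consSeq hS)]
  rfl

/-- The number of jumps of the Yule process has the law given by `yuleWeight`, by induction on `n`:
after its first jump, the process is a Yule process started from `K + 1`. -/
lemma infinitePi_yuleJumps {lam : ℝ} (hlam : 0 < lam) (n : ℕ) : ∀ {t : ℝ}, 0 ≤ t → ∀ {K : ℕ},
    1 ≤ K → Measure.infinitePi (fun _ : ℕ => expMeasure 1) (yuleJumps lam t K n) =
      ENNReal.ofReal (yuleWeight lam t K n) := by
  induction n with
  | zero =>
    intro t ht K hK
    have hK' : (0 : ℝ) < K := by exact_mod_cast hK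
    have h1 : ∀ᵐ ξ ∂Measure.infinitePi (fun _ : ℕ => expMeasure 1), ∀ i, 0 < ξ i :=
      ae_all_iff.2 fun i => by
        have := (measurePreserving_eval_infinitePi (fun _ : ℕ => expMeasure 1) i)
        exact this.quasiMeasurePreserving.ae ae_expMeasure_pos
    have h2 : yuleJumps lam t K 0 =ᵐ[Measure.infinitePi (fun _ : ℕ => expMeasure 1)]
        (fun ξ : ℕ → ℝ => ξ 0) ⁻¹' Ioi (lam * K * t) := by
      filter_upwards [h1] with ξ hξ
      refine propext ?_
      have e0 : ξ 0 / (lam * K) ≤ t ↔ ξ 0 ≤ lam * K * t := div_le_iff₀' (by positivity)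
      change (∀ k, ∑ i ∈ Finset.range (k + 1), ξ i / (lam * (i + K)) ≤ t ↔ k < 0) ↔
        lam * K * t < ξ 0
      simp only [Nat.not_lt_zero, iff_false, not_le]
      constructor
      · intro h
        have := h 0
        simp only [zero_add, Finset.sum_range_one, Nat.cast_zero] at this
        exact not_le.1 fun h' => absurd (e0.2 h') (not_le.2 this)
      · intro h k
        refine lt_of_lt_of_le (not_le.1 fun h' => absurd (e0.1 h') (not_le.2 h)) ?_
        have := Finset.single_le_sum (f := fun i : ℕ => ξ i / (lam * (i + K)))
          (s := Finset.range (k + 1)) (fun i _ => div_nonneg (hξ i).le (by positivity))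
          (Finset.mem_range.2 (Nat.succ_pos k))
        simpa using this
    rw [measure_congr h2, ← Measure.map_apply (measurable_pi_apply 0) measurableSet_Ioi,
      (measurePreserving_eval_infinitePi (fun _ : ℕ => expMeasure 1) 0).map_eq,
      expMeasure_Ioi (by positivity), yuleWeight_zero]
  | succ n ih =>
    intro t ht K hK
    have hK' : (0 : ℝ) < K := by exact_mod_cast hK
    have hρ : 0 < lam * K := by positivity
    rw [infinitePi_consSeq (measurableSet_yuleJumps _ _ _ _), ← lintegral_yuleWeight hlam.le ht,
      ← lintegral_expMeasure_scaled hρ.le (g := fun r =>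
        ENNReal.ofReal (yuleWeight lam (t - r) (K + 1) n))
        (((continuous_yuleWeight lam (K + 1) n).measurable.comp
          (measurable_const.sub measurable_id)).ennreal_ofReal)]
    refine lintegral_congr fun a => ?_
    simp only [consSeq_mem_yuleJumps_succ, hρ, true_and]
    by_cases h : a ≤ lam * K * t
    · have h' : a / (lam * K) ≤ t := (div_le_iff₀' hρ).2 h
      simp only [h, h', if_true, true_and, ofPred_mem_eq]
      exact ih (sub_nonneg.2 h') (by omega)
    · have h' : ¬ a / (lam * K) ≤ t := fun h' => h ((div_le_iff₀' hρ).1 h')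
      simp [h, h']

lemma yule_of_mem_yuleJumps {lam t : ℝ} {n : ℕ} {ξ : ℕ → ℝ} (h : ξ ∈ yuleJumps lam t 1 n) :
    yule lam ξ t = 1 + n := by
  rw [yule]
  congr 1
  rw [show {n : ℕ | ∑ k ∈ Finset.range (n + 1), ξ k / (lam * (k + 1)) ≤ t} = Iio n from ?_]
  · simp
  · ext k
    simpa using h k

lemma measurable_yule (lam t : ℝ) : Measurable fun ξ : ℕ → ℝ => yule lam ξ t :=
  (measurable_ncard (A := fun n (ξ : ℕ → ℝ) =>
    ∑ k ∈ Finset.range (n + 1), ξ k / (lam * (k + 1)) ≤ t) fun n =>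
      measurableSet_le (by fun_prop) measurable_const).const_add 1

/-- The events that there are exactly `n` jumps have total probability `1`, so that almost surely
the Yule process makes finitely many jumps and its number of jumps is not a junk value of
`Set.ncard`. -/
lemma lintegral_yule {lam t : ℝ} (hlam : 0 < lam) (ht : 0 ≤ t) (φ : ℕ → ℝ≥0∞) :
    ∫⁻ ξ, φ (yule lam ξ t) ∂Measure.infinitePi (fun _ : ℕ => expMeasure 1) =
      yuleMean lam t 1 φ := by
  have hm := measurableSet_yuleJumps lam t 1
  have hd : Pairwise (Function.onFun Disjoint (yuleJumps lam t 1)) := fun m n hmn =>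
    Set.disjoint_left.2 fun ξ h1 h2 => hmn <| by
      have := (yule_of_mem_yuleJumps h1).symm.trans (yule_of_mem_yuleJumps h2)
      omega
  have hu : (⋃ n, yuleJumps lam t 1 n) =ᵐ[Measure.infinitePi (fun _ : ℕ => expMeasure 1)] univ := by
    rw [eventuallyEq_univ, mem_ae_iff, prob_compl_eq_zero_iff (MeasurableSet.iUnion hm),
      measure_iUnion hd hm]
    simp only [infinitePi_yuleJumps hlam _ ht le_rfl, tsum_yuleWeight_one hlam.le ht]
  rw [← setLIntegral_univ, ← setLIntegral_congr hu, lintegral_iUnion hm hd, yuleMean]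
  refine tsum_congr fun n => ?_
  rw [setLIntegral_congr_fun (hm n) fun ξ hξ => by rw [yule_of_mem_yuleJumps hξ],
    setLIntegral_const, infinitePi_yuleJumps hlam _ ht le_rfl, mul_comm]

/-- The sum of `q` independent Yule processes started from `1` has the law of a Yule process started
from `q`. -/
lemma lintegral_sum_yule {lam t : ℝ} (hlam : 0 < lam) (ht : 0 ≤ t) (q : ℕ) (φ : ℕ → ℝ≥0∞) :
    ∫⁻ ξ : Fin q → ℕ → ℝ, φ (∑ i, yule lam (ξ i) t)
        ∂Measure.pi (fun _ => Measure.infinitePi fun _ : ℕ => expMeasure 1) =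
      yuleMean lam t q φ := by
  induction q generalizing φ with
  | zero =>
    rw [yuleMean, tsum_eq_single 0 fun n hn => by
      obtain ⟨k, rfl⟩ := Nat.exists_eq_succ_of_ne_zero hn
      simp [yuleWeight]]
    simp [yuleWeight]
  | succ q ih =>
    have hm : Measurable fun ξ : Fin (q + 1) → ℕ → ℝ => φ (∑ i, yule lam (ξ i) t) :=
      (measurable_from_nat (f := φ)).comp
        (Finset.measurable_sum _ fun i _ => (measurable_yule lam t).comp (measurable_pi_apply i))
    have hp := (measurePreserving_piFinSuccAbove
      (fun _ : Fin (q + 1) => Measure.infinitePi fun _ : ℕ => expMeasure 1) 0).symm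
    have hm' : Measurable fun p : (ℕ → ℝ) × (Fin q → ℕ → ℝ) => φ (∑ i, yule lam
        ((MeasurableEquiv.piFinSuccAbove (fun _ : Fin (q + 1) => ℕ → ℝ) 0).symm p i) t) :=
      hm.comp hp.measurable
    rw [← hp.lintegral_comp hm, lintegral_prod _ hm'.aemeasurable,
      yuleMean_succ hlam.le ht, ← lintegral_yule hlam ht]
    refine lintegral_congr fun ξ => ?_
    rw [← ih fun x => φ (yule lam ξ t + x)]
    refine lintegral_congr fun ζ => ?_
    rw [Fin.sum_univ_succ]
    rfl

lemma yuleSumMoment_eq {lam t : ℝ} (hlam : 0 < lam) (ht : 0 ≤ t) (q m : ℕ) :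
    yuleSumMoment lam q t m = yuleMean lam t q fun x => (x : ℝ≥0∞) ^ m := by
  rw [← lintegral_sum_yule hlam ht, yuleSumMoment, ← Measure.infinitePi_eq_pi,
    ← Measure.infinitePi_map_curry, lintegral_map_equiv]
  rfl

end Yule

/-! ### The number of loops -/

section Loops

variable {N : ℕ}

/-- For a jump to a state of larger value, the generator, completed to total rate `R`, is monotone
in the rate of the jump. -/
lemma mul_add_tsub_mul_le {b A R : ℝ≥0} (hbA : b ≤ A) (hAR : A ≤ R) {x y : ℝ≥0∞} (h : x ≤ y) :
    b * y + (R - b : ℝ≥0) * x ≤ A * y + (R - A : ℝ≥0) * x := by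
  obtain ⟨u, rfl⟩ := exists_add_of_le hbA
  obtain ⟨v, rfl⟩ := exists_add_of_le hAR
  rw [show b + u + v - b = u + v by rw [add_assoc, add_tsub_cancel_left], add_tsub_cancel_left]
  push_cast
  rw [add_mul, add_mul, add_assoc]
  gcongr

/-- The supersolution used to count the loops, `K` being the number of explored particles, `k` the
number of loops so far and `j = l - k` the number of loops still to come: each of them costs a
factor `N - 1` and occurs at a rate at most `lam * K ^ 2`, hence the weight `(lam * t) ^ j / j!` and
the moment of order `2 * j` of a Yule process, which dominates the number of explored particles. -/
def loopWeight (N : ℕ) (lam R : ℝ≥0) (l : ℕ) (t : ℝ) (K k : ℕ) : ℝ≥0∞ :=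
  ((N - 1 : ℕ) : ℝ≥0∞) ^ min k l * (ENNReal.ofReal ((lam * t) ^ (l - k) / (l - k).factorial) *
    (ENNReal.ofReal (Real.exp (R * t)) *
      yuleMean lam t K fun x => (x : ℝ≥0∞) ^ (2 * (l - k))))

lemma measurable_loopWeight (lam R : ℝ≥0) (l K k : ℕ) :
    Measurable fun t => loopWeight N lam R l t K k := by
  have := measurable_yuleMean lam K fun x => (x : ℝ≥0∞) ^ (2 * (l - k))
  unfold loopWeight
  fun_prop

lemma loopWeight_le_succ (lam R : ℝ≥0) (l : ℕ) {t : ℝ} (ht : 0 ≤ t) (K k : ℕ) :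
    loopWeight N lam R l t K k ≤ loopWeight N lam R l t (K + 1) k := by
  unfold loopWeight
  gcongr
  exact yuleMean_le_succ lam.coe_nonneg ht K fun x y hxy => by gcongr

lemma exploreGen_loopWeight (lam R c : ℝ≥0) (l : ℕ) (s : ℝ) (C : Finset (Fin N))
    (es : List (Interaction N)) (k : ℕ) :
    exploreGen R c (fun s C _ k => loopWeight N lam R l s C.card k) s C es k =
      (c * (2 * (C.card * Cᶜ.card : ℕ)) : ℝ≥0) * loopWeight N lam R l s (C.card + 1) k +
      (c * (C.card * (C.card - 1) : ℕ) : ℝ≥0) * loopWeight N lam R l s C.card (k + 1) +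
      (R - exploreRate c C : ℝ≥0) * loopWeight N lam R l s C.card k := by
  have h : ∑ i ∈ C, ∑ j ∈ Cᶜ, loopWeight N lam R l s (insert j C).card k =
      (C.card * Cᶜ.card : ℕ) * loopWeight N lam R l s (C.card + 1) k := by
    rw [Finset.sum_congr rfl fun i _ => Finset.sum_congr rfl fun j hj => by
      rw [Finset.card_insert_of_notMem (Finset.mem_compl.1 hj)]]
    simp only [Finset.sum_const, nsmul_eq_mul]
    push_cast
    ring
  rw [exploreGen, h, sum_erase_const]
  push_cast
  ring

/-- The rate of the births is at most that of the Yule process. -/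
lemma birth_rate_le {lam c : ℝ≥0} (hc : lam = 2 * c * (N - 1 : ℕ)) {C : Finset (Fin N)}
    (hC : C.Nonempty) : c * (2 * (C.card * Cᶜ.card : ℕ)) ≤ lam * C.card := by
  have h1 : C.card + Cᶜ.card = N := by simp
  have h2 := hC.card_pos
  have h3 : Cᶜ.card ≤ N - 1 := by omega
  rw [hc, Nat.cast_mul]
  calc c * (2 * (C.card * Cᶜ.card)) = 2 * c * C.card * Cᶜ.card := by ring
    _ ≤ 2 * c * C.card * ((N - 1 : ℕ) : ℝ≥0) := by gcongr
    _ = _ := by ring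

lemma loop_rate_mul_le {lam c : ℝ≥0} (hc : lam = 2 * c * (N - 1 : ℕ)) (K : ℕ) :
    c * (K * (K - 1) : ℕ) * (N - 1 : ℕ) ≤ lam * K ^ 2 := by
  have h : ((K * (K - 1) : ℕ) : ℝ≥0) ≤ K ^ 2 := by
    rw [sq]; exact_mod_cast Nat.mul_le_mul_left K (Nat.sub_le K 1)
  calc c * (K * (K - 1) : ℕ) * (N - 1 : ℕ) ≤ c * K ^ 2 * (N - 1 : ℕ) := by gcongr
    _ ≤ 2 * (c * K ^ 2 * (N - 1 : ℕ)) := by rw [two_mul]; exact le_self_add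
    _ = lam * K ^ 2 := by rw [hc]; ring

/-- While `k < l`, the loops are paid for by the growth of the factor `(lam * t) ^ (l - k)`. -/
lemma loop_rate_loopWeight_le {lam c : ℝ≥0} (hc : lam = 2 * c * (N - 1 : ℕ)) (R : ℝ≥0) {l k : ℕ}
    (hk : k < l) (s : ℝ) (K : ℕ) :
    (c * (K * (K - 1) : ℕ) : ℝ≥0) * loopWeight N lam R l s K (k + 1) ≤
      ((N - 1 : ℕ) : ℝ≥0∞) ^ k * (lam * ENNReal.ofReal ((lam * s) ^ (l - (k + 1)) /
        (l - (k + 1)).factorial) * (ENNReal.ofReal (Real.exp (R * s)) *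
          yuleMean lam s K fun x => (x : ℝ≥0∞) ^ (2 * (l - k)))) := by
  obtain ⟨j, rfl⟩ : ∃ j, l = k + 1 + j := ⟨l - (k + 1), by omega⟩
  rw [loopWeight, min_eq_left (by omega), Nat.add_sub_cancel_left,
    show k + 1 + j - k = j + 1 by omega]
  set a := ENNReal.ofReal ((lam * s) ^ j / j.factorial)
  set e := ENNReal.ofReal (Real.exp (R * s))
  have h1 : ((c * (K * (K - 1) : ℕ) : ℝ≥0) : ℝ≥0∞) * ((N - 1 : ℕ) : ℝ≥0∞) ≤
      lam * (K : ℝ≥0∞) ^ 2 := by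
    have := ENNReal.coe_le_coe.2 (loop_rate_mul_le hc K)
    simpa only [ENNReal.coe_mul, ENNReal.coe_natCast, ENNReal.coe_pow] using this
  calc _ = ((N - 1 : ℕ) : ℝ≥0∞) ^ k * (((c * (K * (K - 1) : ℕ) : ℝ≥0) * ((N - 1 : ℕ) : ℝ≥0∞)) *
        (a * (e * yuleMean lam s K fun x => (x : ℝ≥0∞) ^ (2 * j)))) := by rw [pow_succ]; ring
    _ ≤ ((N - 1 : ℕ) : ℝ≥0∞) ^ k * ((lam * (K : ℝ≥0∞) ^ 2) *
        (a * (e * yuleMean lam s K fun x => (x : ℝ≥0∞) ^ (2 * j)))) := by gcongr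
    _ = ((N - 1 : ℕ) : ℝ≥0∞) ^ k * (lam * a * (e * ((K : ℝ≥0∞) ^ 2 *
        yuleMean lam s K fun x => (x : ℝ≥0∞) ^ (2 * j)))) := by ring
    _ ≤ _ := by
      gcongr
      exact sq_mul_yuleMean_le lam s K j

/-- The function `loopWeight` is a supersolution of the equation of the exploration with the final
value `(N - 1) ^ l` on the event of at least `l` loops. For `l ≤ k` it does not depend on `k`, so
that the loops have no effect; for `k < l` the product rule separates the growth of `(lam * t) ^ (l
- k)`, which dominates the loops, from that of the moment of the Yule process, which dominates the
births. -/
lemma loopWeight_supersolution {lam c R : ℝ≥0} (hc : lam = 2 * c * (N - 1 : ℕ))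
    (hR : ∀ C : Finset (Fin N), lam * C.card ≤ R)
    (hR' : ∀ C : Finset (Fin N), exploreRate c C ≤ R) (l : ℕ) {t : ℝ} (ht : 0 ≤ t)
    {C : Finset (Fin N)} (hC : C.Nonempty) (es : List (Interaction N)) (k : ℕ) :
    (if l ≤ k then ((N - 1 : ℕ) : ℝ≥0∞) ^ l else 0) +
      ∫⁻ s in Icc 0 t, exploreGen R c (fun s C _ k => loopWeight N lam R l s C.card k) s C es k ≤
      loopWeight N lam R l t C.card k := by
  have hb := birth_rate_le hc hC
  have hrate : exploreRate c C =
      c * (2 * (C.card * Cᶜ.card : ℕ)) + c * (C.card * (C.card - 1) : ℕ) := mul_add _ _ _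
  -- the births and the absence of interaction are dominated by the generator of the Yule process
  have hgen : ∀ s, 0 ≤ s → (c * (2 * (C.card * Cᶜ.card : ℕ)) : ℝ≥0) *
      loopWeight N lam R l s (C.card + 1) k +
      (R - c * (2 * (C.card * Cᶜ.card : ℕ)) : ℝ≥0) * loopWeight N lam R l s C.card k ≤
      (lam * C.card : ℝ≥0) * loopWeight N lam R l s (C.card + 1) k +
      (R - lam * C.card : ℝ≥0) * loopWeight N lam R l s C.card k := fun s hs =>
    mul_add_tsub_mul_le hb (hR C) (loopWeight_le_succ lam R l hs C.card k)
  have hm1 := measurable_loopWeight (N := N) lam R l C.card k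
  have hm2 := measurable_loopWeight (N := N) lam R l (C.card + 1) k
  rcases le_or_gt l k with hk | hk
  · have hw : ∀ s K k', k ≤ k' → loopWeight N lam R l s K k' = ((N - 1 : ℕ) : ℝ≥0∞) ^ l *
        (ENNReal.ofReal (Real.exp (R * s)) * yuleMean lam s K fun _ => 1) := fun s K k' hk' => by
      simp [loopWeight, min_eq_right (hk.trans hk'), Nat.sub_eq_zero_of_le (hk.trans hk')]
    rw [if_pos hk, hw t _ _ le_rfl, exp_mul_yuleMean_eq lam R ht (hR C), mul_add, mul_one]
    refine add_le_add le_rfl ?_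
    rw [← lintegral_const_mul' _ _ (ENNReal.pow_ne_top (ENNReal.natCast_ne_top _))]
    refine setLIntegral_mono' measurableSet_Icc fun s hs => ?_
    have hloop : c * (C.card * (C.card - 1) : ℕ) ≤ R - c * (2 * (C.card * Cᶜ.card : ℕ)) :=
      le_tsub_of_add_le_left (hrate ▸ hR' C)
    rw [exploreGen_loopWeight, hrate, ← tsub_tsub]
    refine le_trans (le_of_eq ?_) ((hgen s hs.1).trans (le_of_eq ?_))
    · rw [hw s _ (k + 1) (Nat.le_succ k), hw s _ k le_rfl, hw s _ k le_rfl]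
      obtain ⟨v, hv⟩ := exists_add_of_le hloop
      rw [hv, add_tsub_cancel_left]
      push_cast
      ring
    · rw [hw s _ k le_rfl, hw s _ k le_rfl]
      ring
  · obtain ⟨j, hj⟩ : ∃ j, l - k = j + 1 := ⟨l - k - 1, by omega⟩
    have hj' : l - (k + 1) = j := by omega
    have hmy : ∀ K, Measurable fun s => yuleMean lam s K fun x => (x : ℝ≥0∞) ^ (2 * (l - k)) :=
      fun K => measurable_yuleMean lam K _
    have hy1 := hmy C.card
    have hy2 := hmy (C.card + 1)
    rw [if_neg (not_le.2 hk), zero_add, loopWeight, exp_mul_yuleMean_eq lam R ht (hR C), hj,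
      ← lintegral_Icc_pow lam ht, ← hj, min_eq_left hk.le,
      lintegral_mul_lintegral (by fun_prop) (by fun_prop),
      ← lintegral_const_mul' _ _ (ENNReal.pow_ne_top (ENNReal.natCast_ne_top _))]
    refine setLIntegral_mono' measurableSet_Icc fun s hs => ?_
    have e := exp_mul_yuleMean_eq lam R hs.1 (hR C) fun x => (x : ℝ≥0∞) ^ (2 * (l - k))
    rw [exploreGen_loopWeight, ← e, lintegral_Icc_pow lam hs.1, ← hj, mul_add]
    refine (add_le_add_left (add_comm _ _).le _).trans ?_
    rw [add_assoc]
    refine add_le_add ?_ ?_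
    · have := loop_rate_loopWeight_le hc R hk s C.card
      rwa [hj'] at this
    · refine le_trans ?_ ((hgen s hs.1).trans (le_of_eq ?_))
      · gcongr
        rw [hrate]
        exact le_self_add
      · rw [loopWeight, loopWeight, min_eq_left hk.le]
        ring

/-- The tail of the number of loops, by comparison of its expectation with the supersolution
`loopWeight`. -/
lemma pow_mul_noiseLaw_loops_le [NeZero N] (hN : 2 ≤ N) {lam : ℝ} (hlam : 0 < lam) (T : ℝ≥0)
    {q : ℕ} (hq : 1 ≤ q) (hqN : q ≤ N) (l : ℕ) :
    ((N - 1 : ℕ) : ℝ≥0∞) ^ l * noiseLaw N {ω | l ≤ loops lam T q ω} ≤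
      ENNReal.ofReal ((lam * T) ^ l / l.factorial) * yuleSumMoment lam q T (2 * l) := by
  rw [yuleSumMoment_eq hlam T.coe_nonneg]
  obtain ⟨r, rfl⟩ : ∃ r : ℝ≥0, (r : ℝ) = lam := ⟨⟨lam, hlam.le⟩, rfl⟩
  have hN1 : ((N - 1 : ℕ) : ℝ≥0) ≠ 0 := by
    rw [Nat.cast_ne_zero]; omega
  obtain ⟨c, hc⟩ : ∃ c : ℝ≥0, r = 2 * c * (N - 1 : ℕ) :=
    ⟨r / (2 * (N - 1 : ℕ)), by field_simp⟩
  have hc' : (r : ℝ) = 2 * c * (N - 1) := by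
    rw [hc, NNReal.coe_mul, NNReal.coe_mul, NNReal.coe_natCast, Nat.cast_sub (by omega)]
    simp
  -- a rate that dominates both the Yule process and the exploration
  obtain ⟨R, hRN⟩ : ∃ R : ℝ≥0, R = r * N := ⟨_, rfl⟩
  have hR : ∀ C : Finset (Fin N), r * C.card ≤ R := fun C => by
    have : (C.card : ℝ≥0) ≤ N := by exact_mod_cast card_finset_fin_le C
    rw [hRN]
    gcongr
  have hR' : ∀ C : Finset (Fin N), exploreRate c C ≤ R := fun C => by
    refine (exploreRate_le c C).trans ?_
    rw [hRN, hc, Nat.cast_mul]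
    calc c * (N * (N - 1 : ℕ)) ≤ 2 * (c * (N * (N - 1 : ℕ))) := by
          rw [two_mul]; exact le_self_add
      _ = _ := by ring
  let f : List (Interaction N) → ℕ → ℝ≥0∞ := fun _ k =>
    if l ≤ k then ((N - 1 : ℕ) : ℝ≥0∞) ^ l else 0
  have hf : ∀ k, Measurable fun es => f es k := fun k => measurable_const
  have hf1 : ∀ es k, f es k ≤ ((N - 1 : ℕ) : ℝ≥0∞) ^ l := fun es k => by
    simp only [f]; split_ifs <;> simp
  have hC : (firstParticles q N).Nonempty := ⟨0, by
    simp only [firstParticles, Finset.mem_filter, Finset.mem_univ, true_and, Fin.val_zero]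
    omega⟩
  have key := le_of_exploreGen (R := R) (c := c) hR' (Inv := fun _ C _ => C.Nonempty)
    (fun _ _ _ _ h _ => h) (fun _ _ _ _ _ _ _ _ _ _ => Finset.insert_nonempty _ _) (f := f)
    (y := fun s C es k => ENNReal.ofReal (Real.exp (R * s)) * exploreValue r T f s C es k)
    (z := fun s C _ k => loopWeight N r R l s C.card k) (t₀ := T)
    (M := ENNReal.ofReal (Real.exp (R * T)) * ((N - 1 : ℕ) : ℝ≥0∞) ^ l)
    (ENNReal.mul_ne_top ENNReal.ofReal_ne_top (ENNReal.pow_ne_top (ENNReal.natCast_ne_top _)))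
    (fun t ht C es k _ => by
      refine mul_le_mul' (ENNReal.ofReal_le_ofReal (Real.exp_le_exp.2
        (mul_le_mul_of_nonneg_left ht.2 R.coe_nonneg))) ?_
      rw [exploreValue]
      refine (lintegral_mono fun ω => hf1 [] _).trans ?_
      rw [lintegral_const, measure_univ, mul_one])
    (fun t ht C es k h => (exp_mul_exploreValue_eq hN hlam hc' hR' hf ht.1 h es k).le)
    (fun t ht C es k h => loopWeight_supersolution hc hR hR' l ht.1 h es k)
    (right_mem_Icc.2 T.coe_nonneg) (es := []) 0 hC
  have e0 : ((T - T : ℝ) : EReal) = 0 := by simp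
  have hcard : (firstParticles q N).card = q := by
    rw [firstParticles, Fin.card_filter_val_lt, min_eq_right hqN]
  have hm : MeasurableSet {ω : ℕ → StepNoise N | l ≤ loops (r : ℝ) T q ω} :=
    measurable_loops T (by omega) hlam.le measurableSet_Ici
  have hval : exploreValue (r : ℝ) T f T (firstParticles q N) [] 0 =
      ((N - 1 : ℕ) : ℝ≥0∞) ^ l * noiseLaw N {ω | l ≤ loops (r : ℝ) T q ω} := by
    simp only [exploreValue, e0, ncard_loopStepsFrom_init, f, add_zero]
    rw [← lintegral_indicator_one hm, ← lintegral_const_mul _ (measurable_one.indicator hm)]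
    refine lintegral_congr fun ω => ?_
    simp [indicator_apply]
  simp only [hval, hcard, loopWeight, Nat.zero_min, pow_zero, one_mul, Nat.sub_zero] at key
  rw [mul_left_comm (ENNReal.ofReal _) (ENNReal.ofReal _)] at key
  exact (ENNReal.mul_le_mul_iff_right (ENNReal.ofReal_pos.2 (Real.exp_pos _)).ne'
    ENNReal.ofReal_ne_top).1 key

end Loops

/-! ### The expansion -/

lemma integral_pow_smul {α : Type*} [MeasurableSpace α] {N : ℕ} (hN : 2 ≤ N) (l : ℕ)
    (μ : Measure α) (F : α → ℝ) :
    1 / ((N : ℝ) - 1) ^ l * ∫ x, F x ∂(((N - 1 : ℕ) : ℝ≥0∞) ^ l • μ) = ∫ x, F x ∂μ := by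
  have h1 : ((N - 1 : ℕ) : ℝ) = N - 1 := by rw [Nat.cast_sub (by omega), Nat.cast_one]
  have h2 : (2 : ℝ) ≤ N := by exact_mod_cast hN
  have h3 : ((N : ℝ) - 1) ^ l ≠ 0 := pow_ne_zero _ (by linarith)
  rw [integral_smul_measure, ENNReal.toReal_pow, ENNReal.toReal_natCast, h1, smul_eq_mul,
    ← mul_assoc, one_div_mul_cancel h3, one_mul]

lemma abs_integral_le_of_apply_univ_le {α : Type*} [MeasurableSpace α] {μ : Measure α}
    {a : ℝ} (ha : 0 ≤ a) {b : ℝ≥0∞} (hb : b < ⊤) (hμ : μ univ ≤ ENNReal.ofReal a * b)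
    {F : α → ℝ} {C : ℝ} (hC : ∀ x, |F x| ≤ C) :
    |∫ x, F x ∂μ| ≤ a * b.toReal * ⨆ x, |F x| := by
  have hs : ∀ x, |F x| ≤ ⨆ x, |F x| := le_ciSup ⟨C, by rintro _ ⟨x, rfl⟩; exact hC x⟩
  have htop : ENNReal.ofReal a * b < ⊤ := ENNReal.mul_lt_top ENNReal.ofReal_lt_top hb
  have : IsFiniteMeasure μ := ⟨hμ.trans_lt htop⟩
  have h1 : μ.real univ ≤ a * b.toReal := by
    have := ENNReal.toReal_mono htop.ne hμ
    rwa [ENNReal.toReal_mul, ENNReal.toReal_ofReal ha] at this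
  calc |∫ x, F x ∂μ| ≤ (⨆ x, |F x|) * μ.real univ :=
        norm_integral_le_of_norm_le_const (μ := μ) (f := F) (ae_of_all μ hs)
    _ ≤ (⨆ x, |F x|) * (a * b.toReal) := by
        have := Real.iSup_nonneg fun x => abs_nonneg (F x)
        gcongr
    _ = _ := mul_comm _ _

namespace ParticleModel

variable (M : ParticleModel d) {q N : ℕ} [NeZero N] (hqN : q ≤ N) (T : ℝ≥0)

/-- Conditioning and multiplying by the probability of the event is restricting to the event; if the
event is null, both sides vanish. -/
lemma conditioned_eq (hN : 1 ≤ N) (S : Set ℕ) : M.conditioned q N hqN T S =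
    ((M.backwardLaw q N hqN T).restrict (Prod.fst ⁻¹' S)).map Prod.snd := by
  have := M.isProbabilityMeasure_backwardLaw hqN T hN
  rw [conditioned, ProbabilityTheory.cond, Measure.map_smul, smul_smul]
  by_cases h : M.backwardLaw q N hqN T (Prod.fst ⁻¹' S) = 0
  · rw [Measure.restrict_eq_zero.2 h]
    simp
  · rw [ENNReal.mul_inv_cancel h (measure_ne_top _ _), one_smul]

lemma conditioned_univ (hN : 1 ≤ N) : M.conditioned q N hqN T univ =
    (M.backwardLaw q N hqN T).map Prod.snd := by
  rw [conditioned_eq M hqN T hN, preimage_univ, Measure.restrict_univ]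

lemma isFiniteMeasure_conditioned (hN : 1 ≤ N) (S : Set ℕ) :
    IsFiniteMeasure (M.conditioned q N hqN T S) := by
  have := M.isProbabilityMeasure_backwardLaw hqN T hN
  rw [conditioned_eq M hqN T hN]
  infer_instance

lemma conditioned_Ici (hN : 1 ≤ N) (l : ℕ) : M.conditioned q N hqN T (Ici l) =
    M.conditioned q N hqN T {l} + M.conditioned q N hqN T (Ici (l + 1)) := by
  have h : Ici l = {l} ∪ Ici (l + 1) := by
    ext k
    simp only [mem_Ici, mem_union, mem_singleton_iff]
    omega
  rw [conditioned_eq M hqN T hN, conditioned_eq M hqN T hN, conditioned_eq M hqN T hN, h,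
    preimage_union, Measure.restrict_union _ (measurable_fst measurableSet_Ici),
    Measure.map_add _ _ measurable_snd]
  refine Disjoint.preimage _ (Set.disjoint_left.2 fun k hk hk' => ?_)
  rw [mem_singleton_iff] at hk
  rw [mem_Ici] at hk'
  omega

lemma conditioned_apply_univ (hN : 1 ≤ N) (S : Set ℕ) : M.conditioned q N hqN T S univ =
    noiseLaw N {ω | loops M.rate T q ω ∈ S} := by
  have hS : MeasurableSet (Prod.fst ⁻¹' S : Set (ℕ × (Fin q → PathOn T d))) :=
    measurable_fst (MeasurableSet.of_discrete)
  have hS' : MeasurableSet {ω : ℕ → StepNoise N | loops M.rate T q ω ∈ S} :=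
    measurable_loops T hN M.rate_pos.le (MeasurableSet.of_discrete)
  rw [conditioned_eq M hqN T hN, Measure.map_apply measurable_snd MeasurableSet.univ,
    preimage_univ, Measure.restrict_apply_univ, backwardLaw, Measure.bind_apply hS
      (M.measurable_backward_kernel hqN T hN).aemeasurable, ← lintegral_indicator_one hS']
  refine lintegral_congr fun ω => ?_
  have hm : Measurable fun z : Fin N → PathOn T d =>
      (loops M.rate T q ω, fun i => z (Fin.castLE hqN i)) :=
    measurable_const.prodMk (measurable_pi_lambda _ fun _ => measurable_pi_apply _)
  rw [Measure.map_apply hm hS, preimage_preimage]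
  by_cases h : loops M.rate T q ω ∈ S
  · simp [h]
  · simp [h]

/-- The masses of the terms of the expansion are bounded through the tail of the number of loops. -/
lemma pow_mul_conditioned_apply_univ_le (hN : 2 ≤ N) (hq : 1 ≤ q) (l : ℕ) {S : Set ℕ}
    (hS : S ⊆ Ici l) : (((N - 1 : ℕ) : ℝ≥0∞) ^ l • M.conditioned q N hqN T S) univ ≤
      ENNReal.ofReal ((M.rate * T) ^ l / l.factorial) * yuleSumMoment M.rate q T (2 * l) := by
  rw [Measure.smul_apply, smul_eq_mul, conditioned_apply_univ M hqN T (by omega)]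
  refine le_trans ?_ (pow_mul_noiseLaw_loops_le hN M.rate_pos T hq hqN l)
  gcongr
  exact fun h => hS h

lemma yuleSumMoment_lt_top (m : ℕ) : yuleSumMoment M.rate q T m < ⊤ := by
  rw [yuleSumMoment_eq M.rate_pos T.coe_nonneg]
  exact yuleMean_pow_lt_top M.rate_pos.le T.coe_nonneg q m

/-- The mean of the U-statistic is the mean of `F` for the backward system, as each of its terms has
this mean. -/
lemma integral_uStatistic (hN : 2 ≤ N) (hq : 1 ≤ q) {F : (Fin q → PathOn T d) → ℝ}
    (hF : Measurable F) {C : ℝ} (hC : ∀ x, |F x| ≤ C) :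
    ∫ z, uStatistic q F z ∂(M.systemLaw N T) =
      ∫ x, F x ∂(M.backwardLaw q N hqN T).map Prod.snd := by
  have := M.isProbabilityMeasure_backwardLaw hqN T (by omega)
  have hm : ∀ a : Fin q ↪ Fin N, Measurable fun (z : Fin N → PathOn T d) i => z (a i) :=
    fun a => measurable_pi_lambda _ fun _ => measurable_pi_apply _
  have : IsFiniteMeasure (M.systemLaw N T) := ⟨by
    have h := M.systemLaw_map_eq hqN T hN hq (Fin.castLEEmb hqN)
    have h' := congrArg (fun μ => μ univ) h
    simp only [Measure.map_apply (hm _) MeasurableSet.univ,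
      Measure.map_apply measurable_snd MeasurableSet.univ, preimage_univ, measure_univ] at h'
    rw [h']
    exact ENNReal.one_lt_top⟩
  have hi : ∀ a : Fin q ↪ Fin N, Integrable (fun z => F fun i => z (a i)) (M.systemLaw N T) :=
    fun a => Integrable.of_bound (hF.comp (hm a)).aestronglyMeasurable C
      (ae_of_all _ fun z => hC _)
  have he : ∀ a : Fin q ↪ Fin N, ∫ z, F (fun i => z (a i)) ∂(M.systemLaw N T) =
      ∫ x, F x ∂(M.backwardLaw q N hqN T).map Prod.snd := fun a => by
    rw [← M.systemLaw_map_eq hqN T hN hq a, integral_map (hm a).aemeasurable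
      hF.aestronglyMeasurable]
  have hd : ((N.descFactorial q : ℕ) : ℝ) ≠ 0 := by
    rw [Nat.cast_ne_zero, Ne, Nat.descFactorial_eq_zero_iff_lt]
    omega
  simp only [uStatistic]
  rw [integral_div, integral_finsetSum _ fun a _ => hi a, Finset.sum_congr rfl fun a _ => he a,
    Finset.sum_const, Finset.card_univ, Fintype.card_embedding_eq, Fintype.card_fin,
    Fintype.card_fin, nsmul_eq_mul, mul_div_cancel_left₀ _ hd]

lemma integral_conditioned_univ_eq (hN : 1 ≤ N) {F : (Fin q → PathOn T d) → ℝ}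
    (hF : Measurable F) {C : ℝ} (hC : ∀ x, |F x| ≤ C) (n : ℕ) :
    ∫ x, F x ∂(M.conditioned q N hqN T univ) =
      ∑ l ∈ Finset.range n, ∫ x, F x ∂(M.conditioned q N hqN T {l}) +
        ∫ x, F x ∂(M.conditioned q N hqN T (Ici n)) := by
  have := M.isFiniteMeasure_conditioned hqN T hN
  have hi : ∀ S, Integrable F (M.conditioned q N hqN T S) := fun S =>
    Integrable.of_bound hF.aestronglyMeasurable C (ae_of_all _ hC)
  induction n with
  | zero =>
    have : Ici 0 = (univ : Set ℕ) := by ext; simp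
    simp [this]
  | succ n ih =>
    rw [ih, M.conditioned_Ici hqN T hN n, integral_add_measure (hi _) (hi _),
      Finset.sum_range_succ, add_assoc]

end ParticleModel

end BirdNanbu

end

theorem mainTheorem1 {d : ℕ} (M : BirdNanbu.ParticleModel d) (q : ℕ) (hq : 1 ≤ q) (T : ℝ≥0) :
    (∀ l : ℕ, BirdNanbu.yuleSumMoment M.rate q T (2 * l) < ⊤) ∧
    ∀ (N : ℕ) [NeZero N] (_ : 2 ≤ N) (hqN : q ≤ N),
      (∀ (l₀ : ℕ) (F : (Fin q → BirdNanbu.PathOn T d) → ℝ), Measurable F →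
        (∃ C, ∀ x, |F x| ≤ C) → (∀ (σ : Equiv.Perm (Fin q)) x, F (fun i => x (σ i)) = F x) →
        ∫ z, BirdNanbu.uStatistic q F z ∂(M.systemLaw N T) =
          (∑ l ∈ Finset.range (l₀ + 1),
            1 / ((N : ℝ) - 1) ^ l * (∫ x, F x ∂(M.Delta q N hqN T l))) +
          1 / ((N : ℝ) - 1) ^ (l₀ + 1) * (∫ x, F x ∂(M.DeltaBar q N hqN T (l₀ + 1)))) ∧
      (∀ l : ℕ,
        max (M.Delta q N hqN T l univ) (M.DeltaBar q N hqN T l univ) ≤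
          ENNReal.ofReal ((M.rate * T) ^ l / l.factorial) *
            BirdNanbu.yuleSumMoment M.rate q T (2 * l)) ∧
      (∀ (l : ℕ) (F : (Fin q → BirdNanbu.PathOn T d) → ℝ), Measurable F →
        (∃ C, ∀ x, |F x| ≤ C) →
        max |∫ x, F x ∂(M.Delta q N hqN T l)| |∫ x, F x ∂(M.DeltaBar q N hqN T l)| ≤
          (M.rate * T) ^ l / l.factorial *
            (BirdNanbu.yuleSumMoment M.rate q T (2 * l)).toReal * ⨆ x, |F x|) := by
  refine ⟨fun l => M.yuleSumMoment_lt_top T _, fun N _ hN hqN => ⟨?_, ?_, ?_⟩⟩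
  · rintro l₀ F hF ⟨C, hC⟩ -
    rw [M.integral_uStatistic hqN T hN hq hF hC, ← M.conditioned_univ hqN T (by omega),
      M.integral_conditioned_univ_eq hqN T (by omega) hF hC (l₀ + 1)]
    simp only [BirdNanbu.ParticleModel.Delta, BirdNanbu.ParticleModel.DeltaBar,
      BirdNanbu.integral_pow_smul hN]
  · exact fun l => max_le
      (M.pow_mul_conditioned_apply_univ_le hqN T hN hq l (by simp))
      (M.pow_mul_conditioned_apply_univ_le hqN T hN hq l Subset.rfl)
  · rintro l F - ⟨C, hC⟩
    have ha : 0 ≤ (M.rate * T) ^ l / l.factorial :=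
      div_nonneg (pow_nonneg (mul_nonneg M.rate_pos.le T.coe_nonneg) _) (Nat.cast_nonneg _)
    have hb := M.yuleSumMoment_lt_top (q := q) T (2 * l)
    exact max_le
      (BirdNanbu.abs_integral_le_of_apply_univ_le ha hb
        (M.pow_mul_conditioned_apply_univ_le hqN T hN hq l (by simp)) hC)
      (BirdNanbu.abs_integral_le_of_apply_univ_le ha hb
        (M.pow_mul_conditioned_apply_univ_le hqN T hN hq l Subset.rfl) hC)
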